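/- **Setting.** Consider $\min_{x\in\mathbb R^p}\Phi(x):=f(x,y^*(x))$, where $f(x,y)=\mathbb E_\xi[F(x,y;\xi)]$, $g(x,y)=\mathbb E_\zeta[G(x,y;\zeta)]$, $y^*(x)=\operatorname{arg\,min}_{y\in\mathbb R^q}g(x,y)$, $q\ge 1$. Norms are Euclidean (spectral for matrices); $\nabla_x\nabla_y g$ is the Jacobian of $\nabla_x g$ in $y$. **Assumptions.** (1) $f$ and every $F(\cdot,\cdot;\xi)$ are $C^1$, $g$ and every $G(\cdot,\cdot;\zeta)$ are $C^2$; $g(x,\cdot)$ and $G(x,\cdot;\zeta)$ are $\mu$-strongly convex ($\mu>0$) for all $x,\zeta$; $\inf\Phi>-\infty$. (2) In $(x,y)$, $f$ is $C_f$-Lipschitz, $\nabla f$ is $L_f$-Lipschitz, and $\nabla g$, $\nabla_x\nabla_y g$, $\nabla_y^2g$ are $L_g$-, $L_{gxy}$-, $L_{gyy}$-Lipschitz. (3) $\nabla F$, $\nabla G$, $\nabla_x\nabla_yG$, $\nabla_y^2G$ are unbiased estimates of $\nabla f$, $\nabla g$, $\nabla_x\nabla_yg$, $\nabla_y^2g$,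 with mean squared errors at most $\sigma_f^2,\sigma_g^2,\sigma_{gxy}^2,\sigma_{gyy}^2$ at every $(x,y)$. (4) For all $\xi,\zeta$, $F(\cdot,\cdot;\xi)$ and $G(\cdot,\cdot;\zeta)$ satisfy the conditions of (2) on $f$ and $g$, with the same constants. Let $M\ge C_f/\mu$. **Algorithm (ALS-STORM).** A sample is a pair $(\xi,\zeta)$ whose components have the given laws, and all samples drawn are mutually independent. For a batch $\mathcal S$, let $D_y(x,y;\mathcal S)$, $D_v(x,y,v;\mathcal S)$, $D_x(x,y,v;\mathcal S)$ be the averages over $\mathcal S$ of $\nabla_yG(x,y;\zeta)$, $\nabla_y^2G(x,y;\zeta)v-\nabla_yF(x,y;\xi)$, $\nabla_xF(x,y;\xi)-\nabla_x\nabla_yG(x,y;\zeta)v$. Given deterministic $x_0,y_0,v_0$ with $\|v_0\|\le M$, let $D_0^x,D_0^y,D_0^v$ be $D_x,D_y,D_v$ at $(x_0,y_0,v_0)$, each over its own batch of size $S_1$. For $k=0,\dots,K-1$ do the following. * Set $x_{k+1}=x_k-\alpha D_k^x$. * For $t=0,\dots,T-1$: $\bar y_{t}=\bar y_{t-1}-\lambda_1\beta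 D^y_{k,t-1}$ and $D^y_{k,t}=D_y(\bar x_t,\bar y_t;\mathcal S)+(1-\tau^y)\bigl(D^y_{k,t-1}-D_y(\bar x_{t-1},\bar y_{t-1};\mathcal S)\bigr)$, with a fresh batch $\mathcal S$ of size $S_2$, where $\bar x_{-1}=x_k$, $\bar x_t=x_{k+1}$ for $t\ge0$, $\bar y_{-1}=y_k$, $D^y_{k,-1}=D^y_k$. Set $y_{k+1}=\bar y_{T-1}$, $D_{k+1}^y=D^y_{k,T-1}$. * For $j=0,\dots,J-1$: let $v_{k,j}$ be the projection of $v_{k,j-1}-\lambda_2\eta D^v_{k,j-1}$ onto $\{\|v\|\le M\}$, and update $D^x_{k,j},D^v_{k,j}$ by the analogous recursions at $(x_{k+1},y_{k+1},v_{k,j})$ with momenta $\tau^x,\tau^v$ and two fresh independent batches of size $S_2$, starting from $(x_k,y_k,v_k)$, $D^x_k,D^v_k$ at $j=-1$. Set $v_{k+1}=v_{k,J-1}$, $D^x_{k+1}=D^x_{k,J-1}$, $D^v_{k+1}=D^v_{k,J-1}$. (This is ALS-SPIDER with period $q_1=K$ and positive momenta.) The output $\bar x$ is uniformly distributed on $\{x_0,\dots,x_{K-1}\}$,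 independently of the samples. **Parameters.** Put $L_{gg}=\max\{L_{gxy},L_{gyy}\}$, $C_y=\frac{L_g}{\mu}$, $C_v=\bigl(\frac{L_f}{\mu}+\frac{C_fL_{gg}}{\mu^2}\bigr)\bigl(1+\frac{L_g}{\mu}\bigr)$, $\bar M_1=4L_f^2+4M^2L_{gg}^2$, $L_\Phi=L_f+\frac{2L_fL_{gg}+C_f^2L_{gg}}{\mu}+\frac{L_fL_g^2+2C_fL_gL_{gg}}{\mu^2}+\frac{C_fL_g^2L_{gg}}{\mu^3}$, $\sigma^2=\sigma_f^2+\sigma_g^2+\sigma_{gxy}^2+\sigma_{gyy}^2$. Let $T,J,S_2$ be arbitrary positive integers, $0<\lambda_1,\lambda_2\le\frac1{2L_g+2\mu}$, and $$C_\eta=\tfrac{48(L_g^2+C_v^2)}{\mu\lambda_2},\quad C_\beta=\max\Bigl\{\tfrac{96C_y^2+8\bar M_1}{\mu\lambda_1},\tfrac{128\bar M_1JC_\eta\lambda_2}{\mu^2\lambda_1}\Bigr\},\quad C_3=J^2+J^2M^2+2T^2,\quad C_6=L_g^2\lambda_1C_\beta+\bar M_1\lambda_2C_\eta,$$ $$C_7=2^{2(T+J)+11}\bigl[L_g^2C_\eta+(\bar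 M_1+L_g^2)(1+TC_\beta)\bigr],\quad C_{\eta x}=\tfrac{C_7}{S_2},\quad C_{\eta y}=\tfrac{C_7\lambda_1C_\beta T}{\mu S_2},\quad C_{\eta v}=\tfrac{C_7\lambda_2C_\eta J}{\mu S_2},$$ $$C_8=1+6L_\Phi+C_\beta+C_\eta+\sqrt{C_{\eta x}}+\sqrt{C_{\eta y}}+\sqrt{C_{\eta v}},\quad P_6=\min\Bigl\{\tfrac{S_2}{32(\bar M_1+L_g^2)},\tfrac{(1/2)^{2T+2}S_2}{TC_\beta(\bar M_1+L_g^2)},\tfrac{(1/2)^{2J-1}S_2}{24L_g^2C_\eta}\Bigr\},$$ $$\tilde P_6=(C_{\eta x}^2+C_{\eta y}^2+C_{\eta v}^2)\bigl(1+P_6+\tfrac8\mu\lambda_1C_\beta C_3+\tfrac8\mu\lambda_2C_\eta J\bigr)C_3\sigma^2,$$ $$\alpha=\min\Bigl\{\sqrt{\tfrac{S_2\epsilon}{16\tilde P_6}},\ \sqrt{\tfrac{(1/2)^{2(T+J+4)}\mu S_2}{\lambda_2L_g^2C_\eta^2J+TC_\beta C_3C_6}},\ \tfrac1{32}\sqrt{\tfrac{\mu}{C_6(S_2^{-1}C_3+1+C_y^2)}},\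 \sqrt{\tfrac{S_2}{C_7}},\ \tfrac1{C_8}\Bigr\}$$ (the first term is $+\infty$ if $\sigma=0$). Take $\beta=C_\beta\alpha$, $\eta=C_\eta\alpha$, $\tau^x=C_{\eta x}\alpha^2$, $\tau^y=C_{\eta y}\alpha^2$, $\tau^v=C_{\eta v}\alpha^2$, and $S_1$ of order $\epsilon^{-0.5}$, i.e. $c_1\epsilon^{-0.5}\le S_1\le c_2\epsilon^{-0.5}$ with fixed $c_1>0$ and $c_2$. **Theorem.** Under Assumptions (1)–(4), ALS-STORM finds an $\epsilon$-stationary point with sample complexity $O(\epsilon^{-1.5})$. Precisely, there are $A,C>0$, depending only on the constants in the assumptions, on $M,T,J,S_2,\lambda_1,\lambda_2,c_1,c_2$ and on an upper bound of $\Phi(x_0)-\inf\Phi+\|y_0-y^*(x_0)\|^2$, such that for all $0<\epsilon\le1$ and all $K\ge A\epsilon^{-1.5}$ the function $\Phi$ is differentiable and $\mathbb E\|\nabla\Phi(\bar x)\|^2\le\epsilon$; and if moreover $K\le A\epsilon^{-1.5}+1$, then the total number of evaluations of stochastic gradients of $F$, of $\nabla_yG$, of Jacobian-vector products $\nabla_x\nabla_yG\,v$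 and of Hessian-vector products $\nabla_y^2G\,v$ is at most $C\epsilon^{-1.5}$. -/

import Mathlib

open MeasureTheory ProbabilityTheory

noncomputable section

namespace ALS

/-- The space `ℝ^n` with its `L2` norm. -/
abbrev Vec (n : ℕ) := EuclideanSpace ℝ (Fin n)

/-! ### Derivatives of a function of two vector variables -/

section Calculus

variable {p q : ℕ}

/-- The partial gradient `∇_x h (x, y)`. -/
def gradX (h : Vec p → Vec q → ℝ) (x : Vec p) (y : Vec q) : Vec p :=
  gradient (fun x' => h x' y) x

/-- The partial gradient `∇_y h (x, y)`. -/
def gradY (h : Vec p → Vec q → ℝ) (x : Vec p) (y : Vec q) : Vec q :=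
  gradient (fun y' => h x y') y

/-- The full gradient `∇ h (x, y) = (∇_x h, ∇_y h)`, in `ℝ^p × ℝ^q` with the `L2` norm. -/
def fullGrad (h : Vec p → Vec q → ℝ) (x : Vec p) (y : Vec q) : WithLp 2 (Vec p × Vec q) :=
  WithLp.toLp 2 (gradX h x y, gradY h x y)

/-- `∇_x ∇_y h (x, y)`: the Jacobian with respect to `y` of `∇_x h`
(its operator norm is the spectral norm). -/
def jacXY (h : Vec p → Vec q → ℝ) (x : Vec p) (y : Vec q) : Vec q →L[ℝ] Vec p :=
  fderiv ℝ (fun y' => gradX h x y') y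

/-- `∇_y^2 h (x, y)`: the Hessian with respect to `y`. -/
def hessY (h : Vec p → Vec q → ℝ) (x : Vec p) (y : Vec q) : Vec q →L[ℝ] Vec q :=
  fderiv ℝ (fun y' => gradY h x y') y

/-- `A` is `L`-Lipschitz in `(x, y)` for the `L2` norm of `ℝ^p × ℝ^q`. -/
def LipXY {E : Type*} [NormedAddCommGroup E] (L : ℝ) (A : Vec p → Vec q → E) : Prop :=
  ∀ (x x' : Vec p) (y y' : Vec q),
    ‖A x y - A x' y'‖ ≤ L * Real.sqrt (‖x - x'‖ ^ 2 + ‖y - y'‖ ^ 2)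

end Calculus

/-! ### The constants of the problem class -/

/-- Strong convexity, Lipschitz and variance constants, and the radius `M` of the ball `Ω`. -/
structure Consts where
  mu : ℝ
  Cf : ℝ
  Lf : ℝ
  Lg : ℝ
  Lgxy : ℝ
  Lgyy : ℝ
  sf : ℝ
  sg : ℝ
  sgxy : ℝ
  sgyy : ℝ
  M : ℝ

/-- Sign conditions on the constants, and `M ≥ C_f / μ`. -/
structure Consts.Valid (c : Consts) : Prop where
  mu_pos : 0 < c.mu
  Cf_nonneg : 0 ≤ c.Cf
  Lf_nonneg : 0 ≤ c.Lf
  Lg_nonneg : 0 ≤ c.Lg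
  Lgxy_nonneg : 0 ≤ c.Lgxy
  Lgyy_nonneg : 0 ≤ c.Lgyy
  M_ge : c.Cf / c.mu ≤ c.M

/-! ### The stochastic bilevel problem -/

/-- Stochastic component functions `F(x, y; ξ)`, `G(x, y; ζ)` with the laws of `ξ` and `ζ`. -/
structure Bilevel (p q : ℕ) (Ξ Z : Type*) [MeasurableSpace Ξ] [MeasurableSpace Z] where
  F : Ξ → Vec p → Vec q → ℝ
  G : Z → Vec p → Vec q → ℝ
  lawF : Measure Ξ
  lawG : Measure Z

section Problem

variable {p q : ℕ} {Ξ Z : Type*} [MeasurableSpace Ξ] [MeasurableSpace Z]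

/-- The upper level function `f(x, y) = E_ξ F(x, y; ξ)`. -/
def Bilevel.f (B : Bilevel p q Ξ Z) (x : Vec p) (y : Vec q) : ℝ := ∫ ξ, B.F ξ x y ∂B.lawF

/-- The lower level function `g(x, y) = E_ζ G(x, y; ζ)`. -/
def Bilevel.g (B : Bilevel p q Ξ Z) (x : Vec p) (y : Vec q) : ℝ := ∫ ζ, B.G ζ x y ∂B.lawG

/-- The lower level solution `y*(x)`, a minimizer of `g(x, ·)` (unique under strong convexity). -/
def Bilevel.ystar (B : Bilevel p q Ξ Z) (x : Vec p) : Vec q :=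
  Classical.epsilon (fun y => ∀ y', B.g x y ≤ B.g x y')

/-- The value function `Φ(x) = f(x, y*(x))`. -/
def Bilevel.Phi (B : Bilevel p q Ξ Z) (x : Vec p) : ℝ := B.f x (B.ystar x)

/-- The expectations defining `f` and `g` make sense. -/
structure Bilevel.WellPosed (B : Bilevel p q Ξ Z) : Prop where
  probF : IsProbabilityMeasure B.lawF
  probG : IsProbabilityMeasure B.lawG
  measF : ∀ x y, Measurable (fun ξ => B.F ξ x y)
  measG : ∀ x y, Measurable (fun ζ => B.G ζ x y)
  intF : ∀ x y, Integrable (fun ξ => B.F ξ x y) B.lawF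
  intG : ∀ x y, Integrable (fun ζ => B.G ζ x y) B.lawG

/-- Differentiability, strong convexity of the lower level, and `inf Φ > -∞`. -/
structure Bilevel.Regular (B : Bilevel p q Ξ Z) (c : Consts) : Prop where
  contDiff_f : ContDiff ℝ 1 (Function.uncurry B.f)
  contDiff_F : ∀ ξ, ContDiff ℝ 1 (Function.uncurry (B.F ξ))
  contDiff_g : ContDiff ℝ 2 (Function.uncurry B.g)
  contDiff_G : ∀ ζ, ContDiff ℝ 2 (Function.uncurry (B.G ζ))
  strong_g : ∀ x, StrongConvexOn Set.univ c.mu (B.g x)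
  strong_G : ∀ ζ x, StrongConvexOn Set.univ c.mu (B.G ζ x)
  bddBelow : BddBelow (Set.range B.Phi)

/-- Lipschitz conditions on the upper level function and its gradient. -/
structure UpperLip (c : Consts) (h : Vec p → Vec q → ℝ) : Prop where
  lip : LipXY c.Cf h
  lip_grad : LipXY c.Lf (fullGrad h)

/-- Lipschitz conditions on the derivatives of the lower level function. -/
structure LowerLip (c : Consts) (h : Vec p → Vec q → ℝ) : Prop where
  lip_grad : LipXY c.Lg (fullGrad h)
  lip_jac : LipXY c.Lgxy (jacXY h)
  lip_hess : LipXY c.Lgyy (hessY h)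

/-- The random element `A` with law parameter `ν` is an unbiased estimate of `a`. -/
def Unbiased {Θ E : Type*} [MeasurableSpace Θ] [NormedAddCommGroup E] [NormedSpace ℝ E]
    (ν : Measure Θ) (A : Θ → E) (a : E) : Prop :=
  Integrable A ν ∧ ∫ θ, A θ ∂ν = a

/-- `E ‖A - a‖^2 ≤ s^2` (the expectation is a lower integral, so it is never a junk value). -/
def VarLe {Θ E : Type*} [MeasurableSpace Θ] [NormedAddCommGroup E]
    (ν : Measure Θ) (A : Θ → E) (a : E) (s : ℝ) : Prop :=
  ∫⁻ θ, ENNReal.ofReal (‖A θ - a‖ ^ 2) ∂ν ≤ ENNReal.ofReal (s ^ 2)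

/-- Unbiasedness and bounded variance of the stochastic derivatives. -/
structure Bilevel.Stochastic (B : Bilevel p q Ξ Z) (c : Consts) : Prop where
  unbiased_F : ∀ x y, Unbiased B.lawF (fun ξ => fullGrad (B.F ξ) x y) (fullGrad B.f x y)
  unbiased_G : ∀ x y, Unbiased B.lawG (fun ζ => fullGrad (B.G ζ) x y) (fullGrad B.g x y)
  unbiased_jac : ∀ x y, Unbiased B.lawG (fun ζ => jacXY (B.G ζ) x y) (jacXY B.g x y)
  unbiased_hess : ∀ x y, Unbiased B.lawG (fun ζ => hessY (B.G ζ) x y) (hessY B.g x y)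
  var_F : ∀ x y, VarLe B.lawF (fun ξ => fullGrad (B.F ξ) x y) (fullGrad B.f x y) c.sf
  var_G : ∀ x y, VarLe B.lawG (fun ζ => fullGrad (B.G ζ) x y) (fullGrad B.g x y) c.sg
  var_jac : ∀ x y, VarLe B.lawG (fun ζ => jacXY (B.G ζ) x y) (jacXY B.g x y) c.sgxy
  var_hess : ∀ x y, VarLe B.lawG (fun ζ => hessY (B.G ζ) x y) (hessY B.g x y) c.sgyy

/-- All standing assumptions on the bilevel problem: well-posedness, regularity, Lipschitz
conditions on `f`, `g`, stochastic conditions, and the same Lipschitz conditions on every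
component function. -/
structure Bilevel.Assumptions (B : Bilevel p q Ξ Z) (c : Consts) : Prop where
  wellPosed : B.WellPosed
  regular : B.Regular c
  upper_f : UpperLip c B.f
  lower_g : LowerLip c B.g
  stochastic : B.Stochastic c
  upper_F : ∀ ξ, UpperLip c (B.F ξ)
  lower_G : ∀ ζ, LowerLip c (B.G ζ)

end Problem

/-! ### The algorithm -/

/-- Numbers of evaluations of stochastic gradients of `F`, gradients `∇_y G`, Jacobian-vector
products `∇_x ∇_y G v` and Hessian-vector products `∇_y^2 G v`. -/
structure OracleCount where
  gradF : ℕ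
  gradG : ℕ
  jacG : ℕ
  hessG : ℕ

namespace OracleCount

/-- No oracle call. -/
def zero : OracleCount := ⟨0, 0, 0, 0⟩

/-- Sum of two counts. -/
def add (a b : OracleCount) : OracleCount :=
  ⟨a.gradF + b.gradF, a.gradG + b.gradG, a.jacG + b.jacG, a.hessG + b.hessG⟩

/-- Total number of oracle calls. -/
def total (a : OracleCount) : ℕ := a.gradF + a.gradG + a.jacG + a.hessG

/-- Cost of one evaluation of `D_x` averaged over `S` samples. -/
def evalX (S : ℕ) : OracleCount := ⟨S, 0, S, 0⟩

/-- Cost of one evaluation of `D_y` averaged over `S` samples. -/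
def evalY (S : ℕ) : OracleCount := ⟨0, S, 0, 0⟩

/-- Cost of one evaluation of `D_v` averaged over `S` samples. -/
def evalV (S : ℕ) : OracleCount := ⟨S, 0, 0, S⟩

end OracleCount

/-- The places at which the algorithm draws a sample: the `i`-th sample of the large batches at
outer iteration `k`, and of the small batches at inner iteration `t` (or `j`) of outer
iteration `k`. -/
inductive Slot where
  | initX (k i : ℕ)
  | initY (k i : ℕ)
  | initV (k i : ℕ)
  | stepY (k t i : ℕ)
  | stepX (k j i : ℕ)
  | stepV (k j i : ℕ)

/-- Input parameters of the algorithm; `M` is the radius of the ball `Ω`. -/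
structure Params where
  T : ℕ
  J : ℕ
  q1 : ℕ
  S1 : ℕ
  S2 : ℕ
  lam1 : ℝ
  lam2 : ℝ
  alpha : ℝ
  beta : ℝ
  eta : ℝ
  taux : ℝ
  tauy : ℝ
  tauv : ℝ
  M : ℝ

section Algorithm

variable {p q : ℕ} {Ξ Z : Type*} [MeasurableSpace Ξ] [MeasurableSpace Z]

/-- Projection onto the ball `{v : ‖v‖ ≤ M}`. -/
def projBall (M : ℝ) (v : Vec q) : Vec q :=
  if ‖v‖ ≤ M then v else (M / ‖v‖) • v

/-- `D_x(x, y, v; (ξ, ζ)) = ∇_x F(x, y; ξ) - ∇_x ∇_y G(x, y; ζ) v`. -/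
def Bilevel.Dx (B : Bilevel p q Ξ Z) (s : Ξ × Z) (x : Vec p) (y v : Vec q) : Vec p :=
  gradX (B.F s.1) x y - jacXY (B.G s.2) x y v

/-- `D_y(x, y; ζ) = ∇_y G(x, y; ζ)`. -/
def Bilevel.Dy (B : Bilevel p q Ξ Z) (s : Ξ × Z) (x : Vec p) (y : Vec q) : Vec q :=
  gradY (B.G s.2) x y

/-- `D_v(x, y, v; (ξ, ζ)) = ∇_y^2 G(x, y; ζ) v - ∇_y F(x, y; ξ)`. -/
def Bilevel.Dv (B : Bilevel p q Ξ Z) (s : Ξ × Z) (x : Vec p) (y v : Vec q) : Vec q :=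
  hessY (B.G s.2) x y v - gradY (B.F s.1) x y

/-- Average of `D` over a batch of `S` samples. -/
def batch {n : ℕ} (S : ℕ) (sample : ℕ → Ξ × Z) (D : Ξ × Z → Vec n) : Vec n :=
  (S : ℝ)⁻¹ • ∑ i ∈ Finset.range S, D (sample i)

/-- State of the inner loop on `y`: current point, current estimator, oracle calls so far. -/
structure YState (p q : ℕ) where
  x : Vec p
  y : Vec q
  D : Vec q
  cost : OracleCount

/-- One inner iteration on `y`, from index `t - 1` to index `t`; `xn = x_{k+1}` is the current
outer point, and `smp` is the batch drawn at this iteration. -/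
def Bilevel.stepY (B : Bilevel p q Ξ Z) (P : Params) (xn : Vec p) (smp : ℕ → Ξ × Z)
    (st : YState p q) : YState p q :=
  let y' := st.y - (P.lam1 * P.beta) • st.D
  { x := xn
    y := y'
    D := batch P.S2 smp (fun s => B.Dy s xn y') +
      (1 - P.tauy) • (st.D - batch P.S2 smp (fun s => B.Dy s st.x st.y))
    cost := st.cost.add ((OracleCount.evalY P.S2).add (OracleCount.evalY P.S2)) }

/-- The inner loop on `y` at outer iteration `k`; `loopY … (t + 1)` is the state with index `t`,
and `loopY … 0` is the input state, with index `-1`. -/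
def Bilevel.loopY (B : Bilevel p q Ξ Z) (P : Params) (ω : Slot → Ξ × Z) (k : ℕ) (xn : Vec p)
    (init : YState p q) : ℕ → YState p q
  | 0 => init
  | t + 1 => B.stepY P xn (fun i => ω (Slot.stepY k t i)) (B.loopY P ω k xn init t)

/-- State of the inner loop on `v`: current point, current estimators, oracle calls so far. -/
structure VState (p q : ℕ) where
  x : Vec p
  y : Vec q
  v : Vec q
  Dx : Vec p
  Dv : Vec q
  cost : OracleCount

/-- One inner iteration on `v`, from index `j - 1` to index `j`; `xn = x_{k+1}`, `yn = y_{k+1}`,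
and `smpX`, `smpV` are the batches drawn at this iteration. -/
def Bilevel.stepV (B : Bilevel p q Ξ Z) (P : Params) (xn : Vec p) (yn : Vec q)
    (smpX smpV : ℕ → Ξ × Z) (st : VState p q) : VState p q :=
  let v' := projBall P.M (st.v - (P.lam2 * P.eta) • st.Dv)
  { x := xn
    y := yn
    v := v'
    Dx := batch P.S2 smpX (fun s => B.Dx s xn yn v') +
      (1 - P.taux) • (st.Dx - batch P.S2 smpX (fun s => B.Dx s st.x st.y st.v))
    Dv := batch P.S2 smpV (fun s => B.Dv s xn yn v') +
      (1 - P.tauv) • (st.Dv - batch P.S2 smpV (fun s => B.Dv s st.x st.y st.v))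
    cost := st.cost.add
      (((OracleCount.evalX P.S2).add (OracleCount.evalX P.S2)).add
        ((OracleCount.evalV P.S2).add (OracleCount.evalV P.S2))) }

/-- The inner loop on `v` at outer iteration `k`, with the same indexing as `loopY`. -/
def Bilevel.loopV (B : Bilevel p q Ξ Z) (P : Params) (ω : Slot → Ξ × Z) (k : ℕ) (xn : Vec p)
    (yn : Vec q) (init : VState p q) : ℕ → VState p q
  | 0 => init
  | j + 1 => B.stepV P xn yn (fun i => ω (Slot.stepX k j i)) (fun i => ω (Slot.stepV k j i))
      (B.loopV P ω k xn yn init j)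

/-- State of the outer loop: the iterates `x_k, y_k, v_k` and the estimators
available at the start of iteration `k` (the outputs of the inner loops of iteration `k - 1`). -/
structure OuterState (p q : ℕ) where
  x : Vec p
  y : Vec q
  v : Vec q
  Dx : Vec p
  Dy : Vec q
  Dv : Vec q
  cost : OracleCount

/-- Recomputation of the three estimators over large batches when `q1` divides `k`; otherwise the
estimators are kept. -/
def Bilevel.refresh (B : Bilevel p q Ξ Z) (P : Params) (ω : Slot → Ξ × Z) (k : ℕ)
    (st : OuterState p q) : OuterState p q :=
  if k % P.q1 = 0 then
    { st with
      Dx := batch P.S1 (fun i => ω (Slot.initX k i)) (fun s => B.Dx s st.x st.y st.v)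
      Dy := batch P.S1 (fun i => ω (Slot.initY k i)) (fun s => B.Dy s st.x st.y)
      Dv := batch P.S1 (fun i => ω (Slot.initV k i)) (fun s => B.Dv s st.x st.y st.v)
      cost := st.cost.add (((OracleCount.evalX P.S1).add (OracleCount.evalY P.S1)).add
        (OracleCount.evalV P.S1)) }
  else st

/-- One outer iteration. -/
def Bilevel.outerStep (B : Bilevel p q Ξ Z) (P : Params) (ω : Slot → Ξ × Z) (k : ℕ)
    (st₀ : OuterState p q) : OuterState p q :=
  let st := B.refresh P ω k st₀
  let xn := st.x - P.alpha • st.Dx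
  let a := B.loopY P ω k xn ⟨st.x, st.y, st.Dy, st.cost⟩ P.T
  let b := B.loopV P ω k xn a.y ⟨st.x, st.y, st.v, st.Dx, st.Dv, a.cost⟩ P.J
  ⟨xn, a.y, b.v, b.Dx, a.D, b.Dv, b.cost⟩

/-- The state after `k` outer iterations from `(x0, y0, v0)`; the initial estimators are
placeholders, overwritten at iteration `0`. -/
def Bilevel.run (B : Bilevel p q Ξ Z) (P : Params) (x0 : Vec p) (y0 v0 : Vec q)
    (ω : Slot → Ξ × Z) : ℕ → OuterState p q
  | 0 => ⟨x0, y0, v0, 0, 0, 0, OracleCount.zero⟩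
  | k + 1 => B.outerStep P ω k (B.run P x0 y0 v0 ω k)

end Algorithm

/-! ### Sampling and the convergence criterion -/

section Probability

variable {p q : ℕ} {Ξ Z : Type*} [MeasurableSpace Ξ] [MeasurableSpace Z]

/-- The samples at different slots are mutually independent, and each is a pair whose components
have the laws of `ξ` and `ζ`. -/
structure Bilevel.IsSampling (B : Bilevel p q Ξ Z) {Ω : Type*} [MeasurableSpace Ω]
    (P : Measure Ω) (X : Slot → Ω → Ξ × Z) : Prop where
  meas : ∀ s, Measurable (X s)
  indep : iIndepFun X P
  law_fst : ∀ s, P.map (fun ω => (X s ω).1) = B.lawF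
  law_snd : ∀ s, P.map (fun ω => (X s ω).2) = B.lawG

/-- The random point `xbar` is `ε`-stationary for `Φ`: `Φ` is differentiable and
`E ‖∇ Φ(xbar)‖^2 ≤ ε`, the expectation being finite. -/
def IsEpsStationary (Φ : Vec p → ℝ) {Ω : Type*} [MeasurableSpace Ω] (P : Measure Ω)
    (xbar : Ω → Vec p) (ε : ℝ) : Prop :=
  Differentiable ℝ Φ ∧
  Integrable (fun ω => ‖gradient Φ (xbar ω)‖ ^ 2) P ∧
  ∫ ω, ‖gradient Φ (xbar ω)‖ ^ 2 ∂P ≤ ε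

end Probability

/-! ### The parameter choice -/

/-- The problem constants together with the free parameters of the algorithm. -/
structure Setup extends Consts where
  T : ℕ
  J : ℕ
  S2 : ℕ
  lam1 : ℝ
  lam2 : ℝ

namespace Setup

variable (c : Setup)

def Lgg : ℝ := max c.Lgxy c.Lgyy

def LPhi : ℝ :=
  c.Lf + (2 * c.Lf * c.Lgg + c.Cf ^ 2 * c.Lgg) / c.mu +
    (c.Lf * c.Lg ^ 2 + 2 * c.Cf * c.Lg * c.Lgg) / c.mu ^ 2 +
    c.Cf * c.Lg ^ 2 * c.Lgg / c.mu ^ 3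

def Cy : ℝ := c.Lg / c.mu

def Cv : ℝ := (c.Lf / c.mu + c.Cf * c.Lgg / c.mu ^ 2) * (1 + c.Lg / c.mu)

def M1 : ℝ := 4 * c.Lf ^ 2 + 4 * c.M ^ 2 * c.Lgg ^ 2

/-- `C_η`. -/
def Ceta : ℝ := 48 * (c.Lg ^ 2 + c.Cv ^ 2) / (c.mu * c.lam2)

/-- `C_β`. -/
def Cbeta : ℝ :=
  max ((96 * c.Cy ^ 2 + 8 * c.M1) / (c.mu * c.lam1))
    (128 * c.M1 * c.J * c.Ceta * c.lam2 / (c.mu ^ 2 * c.lam1))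

def C3 : ℝ := (c.J : ℝ) ^ 2 + (c.J : ℝ) ^ 2 * c.M ^ 2 + 2 * (c.T : ℝ) ^ 2

def C6 : ℝ := c.Lg ^ 2 * c.lam1 * c.Cbeta + c.M1 * c.lam2 * c.Ceta

def C7 : ℝ :=
  2 ^ (2 * (c.T + c.J) + 11) *
    (c.Lg ^ 2 * c.Ceta + (c.M1 + c.Lg ^ 2) * (1 + c.T * c.Cbeta))

/-- `C_{ηx}`, the ratio `τ^x / α^2`. -/
def Cetax : ℝ := 1 / c.S2 * c.C7

/-- `C_{ηy}`, the ratio `τ^y / α^2`. -/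
def Cetay : ℝ := 1 / (c.mu * c.S2) * c.C7 * c.lam1 * c.Cbeta * c.T

/-- `C_{ηv}`, the ratio `τ^v / α^2`. -/
def Cetav : ℝ := 1 / (c.mu * c.S2) * c.C7 * c.lam2 * c.Ceta * c.J

def C8 : ℝ :=
  1 + 6 * c.LPhi + c.Cbeta + c.Ceta +
    Real.sqrt c.Cetax + Real.sqrt c.Cetay + Real.sqrt c.Cetav

def P6 : ℝ :=
  min (c.S2 / (32 * (c.M1 + c.Lg ^ 2)))
    (min ((1 / 2) ^ (2 * c.T + 2) * c.S2 / (c.T * c.Cbeta * (c.M1 + c.Lg ^ 2)))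
      ((1 / 2) ^ (2 * c.J - 1) * c.S2 / (24 * c.Lg ^ 2 * c.Ceta)))

/-- `σ^2`, the sum of the variance bounds. -/
def sigmaSq : ℝ := c.sf ^ 2 + c.sg ^ 2 + c.sgxy ^ 2 + c.sgyy ^ 2

def P6t : ℝ :=
  (c.Cetax ^ 2 + c.Cetay ^ 2 + c.Cetav ^ 2) *
    (1 + c.P6 + 8 / c.mu * c.lam1 * c.Cbeta * c.C3 + 8 / c.mu * c.lam2 * c.Ceta * c.J) *
    c.C3 * c.sigmaSq

/-- The part of the stepsize bound that does not involve `ε`. -/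
def alphaMax : ℝ :=
  min (Real.sqrt ((1 / 2) ^ (2 * (c.T + c.J + 4)) * c.mu * c.S2 /
      (c.lam2 * c.Lg ^ 2 * c.Ceta ^ 2 * c.J + c.T * c.Cbeta * c.C3 * c.C6)))
    (min (1 / 32 * Real.sqrt (c.mu / (c.C6 * (c.C3 / c.S2 + 1 + c.Cy ^ 2))))
      (min (Real.sqrt (c.S2 / c.C7)) (1 / c.C8)))

open Classical in
/-- The stepsize `α`. In the noiseless case the term with `ε` is `+∞` (its denominator is `0`)
and drops out of the minimum. -/
def alpha (ε : ℝ) : ℝ :=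
  if c.P6t = 0 then c.alphaMax
  else min (Real.sqrt (c.S2 * ε / (16 * c.P6t))) c.alphaMax

/-- Admissible free parameters. -/
structure Valid : Prop where
  consts : c.toConsts.Valid
  T_pos : 0 < c.T
  J_pos : 0 < c.J
  S2_pos : 0 < c.S2
  lam1_pos : 0 < c.lam1
  lam1_le : c.lam1 ≤ 1 / (2 * c.Lg + 2 * c.mu)
  lam2_pos : 0 < c.lam2
  lam2_le : c.lam2 ≤ 1 / (2 * c.Lg + 2 * c.mu)

/-- The parameters of ALS-STORM with `K` outer iterations: `q1 = K`, `β = C_β α`, `η = C_η α`,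
and momenta proportional to `α^2`. -/
def storm (ε : ℝ) (K S1 : ℕ) : Params where
  T := c.T
  J := c.J
  q1 := K
  S1 := S1
  S2 := c.S2
  lam1 := c.lam1
  lam2 := c.lam2
  alpha := c.alpha ε
  beta := c.Cbeta * c.alpha ε
  eta := c.Ceta * c.alpha ε
  taux := c.Cetax * c.alpha ε ^ 2
  tauy := c.Cetay * c.alpha ε ^ 2
  tauv := c.Cetav * c.alpha ε ^ 2
  M := c.M

end Setup

end ALS

end

/-! The argument is a Lyapunov analysis. At a point x put v*(x) for the solution of ∇_y²g(x, y*(x))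
v = ∇_y f(x, y*(x)). Then Φ is differentiable with ∇Φ(x) = ∇_x f − ∇_x∇_y g · v*(x), both taken at
(x, y*(x)) (`hasGradientAt_Phi`), and y*, v*, ∇Φ are Lipschitz. So the algorithm runs three coupled
inexact gradient methods: on Φ in x, on the strongly convex g(x, ·) in y, and on a positive definite
linear system in v.

Pathwise, one outer iteration lowers Φ(x_k) + ‖y_k − y*(x_k)‖² + ‖v_k − v*(x_k)‖² by α/2 ‖∇Φ(x_k)‖²
together with multiples of ‖D^x‖², ‖D^y‖², ‖D^v‖², up to multiples of the squared errors of the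
three estimators (`potential_step_le`). The contractions in y and v pay for the bias of the
hypergradient and for the motion of the targets y*(x_k), v*(x_k). This works because β and η are
large enough multiples of α, and β is large enough compared with η.

In mean square, each momentum estimator obeys e⁺ ≤ (1 − τ) e + (2τ²V + 2·drift)/S₂
(`memLp_momentum_update`). Old and new points are evaluated on the same fresh batch, so the noise
that momentum does not damp is that of a difference of sample functions; it is bounded by the
squared displacement of the iterates, and this displacement is again controlled by the ‖D‖² terms.
Adding the errors to the potential with weights of order 1/α makes weight times τ equal to the
coefficient with which the error enters the potential, while the drift is absorbed by the ‖D‖² terms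
(`weights_storm`, `lyapunov_step_le`). What remains per iteration is a noise of order α³, and the
first term in the definition of α makes it at most αε/100 (`noise_storm_le`).

Telescoping gives (α/2) Σ_k E‖∇Φ(x_k)‖² ≤ const + const/(α S₁) + Kαε/100
(`sum_integral_sq_norm_gradPhi_le`). Since α is at least a constant times √ε, S₁ at least c₁
ε^(-1/2) and K at least A ε^(-3/2), division by αK leaves at most ε once A is large (`average_le`).
The cost is linear in S₁ and in K, with an exact formula in `total_run`. -/

noncomputable section

namespace ALS

/-! ### Gradient inequalities for smooth and strongly convex functions -/

section ConvexAnalysis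

open InnerProductSpace

variable {E : Type*} [NormedAddCommGroup E] [InnerProductSpace ℝ E] [CompleteSpace E]

lemma hasDerivAt_comp_line {φ : E → ℝ} {φ' : E} {a b : E} {t : ℝ}
    (h : HasGradientAt φ φ' (a + t • (b - a))) :
    HasDerivAt (fun s : ℝ => φ (a + s • (b - a))) (inner ℝ φ' (b - a)) t := by
  have h1 : HasDerivAt (fun s : ℝ => a + s • (b - a)) (b - a) t := by
    simpa using ((hasDerivAt_id t).smul_const (b - a)).const_add a
  have := (hasGradientAt_iff_hasFDerivAt.mp h).comp_hasDerivAt t h1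
  simpa [Function.comp_def] using this

/-- The descent lemma for a function with Lipschitz gradient. -/
lemma le_add_inner_add_sq {φ : E → ℝ} {φ' : E → E} {L : ℝ}
    (h : ∀ x, HasGradientAt φ (φ' x) x) (hL : ∀ x y, ‖φ' x - φ' y‖ ≤ L * ‖x - y‖) (a b : E) :
    φ b ≤ φ a + inner ℝ (φ' a) (b - a) + L / 2 * ‖b - a‖ ^ 2 := by
  -- The gap to the quadratic model along the segment; the Lipschitz bound makes its derivative
  -- nonpositive, and the claim is ψ(1) ≤ ψ(0).
  set ψ : ℝ → ℝ := fun s => φ (a + s • (b - a)) - s * inner ℝ (φ' a) (b - a)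
    - L / 2 * s ^ 2 * ‖b - a‖ ^ 2
  have hψ : ∀ t : ℝ, HasDerivAt ψ (inner ℝ (φ' (a + t • (b - a))) (b - a)
      - inner ℝ (φ' a) (b - a) - L * t * ‖b - a‖ ^ 2) t := by
    intro t
    have h1 := hasDerivAt_comp_line (h (a + t • (b - a)))
    have h2 : HasDerivAt (fun s : ℝ => s * inner ℝ (φ' a) (b - a))
      (inner ℝ (φ' a) (b - a)) t := by
      simpa using (hasDerivAt_id t).mul_const (inner ℝ (φ' a) (b - a))
    have h3 : HasDerivAt (fun s : ℝ => L / 2 * s ^ 2 * ‖b - a‖ ^ 2)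
      (L * t * ‖b - a‖ ^ 2) t := by
      have := (((hasDerivAt_pow 2 t).const_mul (L / 2)).mul_const (‖b - a‖ ^ 2))
      refine this.congr_deriv ?_
      push_cast
      ring
    exact (h1.sub h2).sub h3
  have hanti : AntitoneOn ψ (Set.Icc 0 1) := by
    apply antitoneOn_of_deriv_nonpos (convex_Icc 0 1)
    · exact fun t _ => (hψ t).continuousAt.continuousWithinAt
    · exact fun t _ => (hψ t).differentiableAt.differentiableWithinAt
    · intro t ht
      rw [interior_Icc] at ht
      rw [(hψ t).deriv, ← inner_sub_left]
      have h1 := real_inner_le_norm (φ' (a + t • (b - a)) - φ' a) (b - a)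
      have h2 := hL (a + t • (b - a)) a
      rw [add_sub_cancel_left, norm_smul, Real.norm_eq_abs, abs_of_pos ht.1] at h2
      have h3 := mul_le_mul_of_nonneg_right h2 (norm_nonneg (b - a))
      nlinarith
  have := hanti (Set.left_mem_Icc.2 zero_le_one) (Set.right_mem_Icc.2 zero_le_one) zero_le_one
  simp only [ψ] at this
  simp at this
  linarith

lemma ConvexOn.inner_gradient_le {φ : E → ℝ} (hφ : ConvexOn ℝ Set.univ φ) {a φ' : E}
    (h : HasGradientAt φ φ' a) (b : E) : φ a + inner ℝ φ' (b - a) ≤ φ b := by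
  have hc : ConvexOn ℝ Set.univ (fun s : ℝ => φ (a + s • (b - a))) := by
    refine ⟨convex_univ, fun s _ t _ p q hp hq hpq => ?_⟩
    have h3 := hφ.2 (Set.mem_univ (a + s • (b - a))) (Set.mem_univ (a + t • (b - a))) hp hq hpq
    refine le_trans (le_of_eq ?_) h3
    obtain rfl : q = 1 - p := by linarith
    refine congrArg φ ?_
    simp only [smul_eq_mul]
    module
  have hd : HasDerivAt (fun s : ℝ => φ (a + s • (b - a))) (inner ℝ φ' (b - a)) 0 :=
    hasDerivAt_comp_line (by simpa using h)
  have := hc.le_slope_of_hasDerivAt (Set.mem_univ 0) (Set.mem_univ 1) one_pos hd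
  simp [slope_def_field] at this
  linarith

/-- Subtracting m/2 ‖x‖² leaves a convex function, to which the tangent inequality applies. -/
lemma StrongConvexOn.inner_gradient_le {φ : E → ℝ} {m : ℝ} (hφ : StrongConvexOn Set.univ m φ)
    {a φ' : E} (h : HasGradientAt φ φ' a) (b : E) :
    φ a + inner ℝ φ' (b - a) + m / 2 * ‖b - a‖ ^ 2 ≤ φ b := by
  have hc := strongConvexOn_iff_convex.mp hφ
  have h2 : HasGradientAt (fun x : E => φ x - m / 2 * ‖x‖ ^ 2) (φ' - m • a) a := by
    rw [hasGradientAt_iff_hasFDerivAt] at h ⊢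
    have h3 := ((hasStrictFDerivAt_norm_sq a).hasFDerivAt).const_mul (m / 2)
    refine (h.sub h3).congr_fderiv ?_
    ext w
    simp
    ring
  have := ConvexOn.inner_gradient_le hc h2 b
  have e : ‖b‖ ^ 2 = ‖a‖ ^ 2 + 2 * inner ℝ a (b - a) + ‖b - a‖ ^ 2 := by
    rw [← norm_add_sq_real]; simp
  rw [inner_sub_left, inner_smul_left] at this
  simp at this
  rw [e] at this
  linarith

lemma StrongConvexOn.inner_gradient_sub {φ : E → ℝ} {m : ℝ} (hφ : StrongConvexOn Set.univ m φ)
    {φ' : E → E} (h : ∀ x, HasGradientAt φ (φ' x) x) (a b : E) :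
    m * ‖a - b‖ ^ 2 ≤ inner ℝ (φ' a - φ' b) (a - b) := by
  have h1 := StrongConvexOn.inner_gradient_le hφ (h a) b
  have h2 := StrongConvexOn.inner_gradient_le hφ (h b) a
  have h3 : inner ℝ (φ' a) (b - a) = - inner ℝ (φ' a) (a - b) := by
    rw [← inner_neg_right, neg_sub]
  rw [norm_sub_rev b a] at h1
  rw [inner_sub_left]
  linarith

/-- The auxiliary point `c` minimizes the quadratic upper model at `b` minus the tangent at `a`.
Comparing the tangent bound from `a` with the descent lemma from `b` at this point leaves the
squared gradient difference. -/
lemma ConvexOn.add_sq_gradient_le {φ : E → ℝ} (hφ : ConvexOn ℝ Set.univ φ) {L : ℝ} (hL0 : 0 < L)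
    {φ' : E → E} (h : ∀ x, HasGradientAt φ (φ' x) x)
    (hL : ∀ x y, ‖φ' x - φ' y‖ ≤ L * ‖x - y‖) (a b : E) :
    φ a + inner ℝ (φ' a) (b - a) + 1 / (2 * L) * ‖φ' b - φ' a‖ ^ 2 ≤ φ b := by
  set c := b - (1 / L) • (φ' b - φ' a)
  have h1 := ConvexOn.inner_gradient_le hφ (h a) c
  have h2 := le_add_inner_add_sq h hL b c
  have e1 : c - b = -((1 / L) • (φ' b - φ' a)) := by simp [c]
  have e2 : c - a = (b - a) - (1 / L) • (φ' b - φ' a) := by simp only [c]; abel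
  rw [e1, norm_neg, norm_smul, inner_neg_right, inner_smul_right, Real.norm_eq_abs,
    abs_of_pos (by positivity)] at h2
  rw [e2, inner_sub_right, inner_smul_right] at h1
  have e3 : ‖φ' b - φ' a‖ ^ 2 = inner ℝ (φ' b) (φ' b - φ' a) - inner ℝ (φ' a) (φ' b - φ' a) := by
    rw [← inner_sub_left, real_inner_self_eq_norm_sq]
  have e4 : L / 2 * (1 / L * ‖φ' b - φ' a‖) ^ 2 = 1 / (2 * L) * ‖φ' b - φ' a‖ ^ 2 := by
    field_simp
  have e5 : 1 / L * ‖φ' b - φ' a‖ ^ 2 = 2 * (1 / (2 * L) * ‖φ' b - φ' a‖ ^ 2) := by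
    field_simp
  have e6 : 1 / L * ‖φ' b - φ' a‖ ^ 2 = 1 / L * inner ℝ (φ' b) (φ' b - φ' a)
    - 1 / L * inner ℝ (φ' a) (φ' b - φ' a) := by rw [e3]; ring
  linarith

/-- Cocoercivity of the Lipschitz gradient of a convex function. -/
lemma ConvexOn.cocoercive_gradient {φ : E → ℝ} (hφ : ConvexOn ℝ Set.univ φ) {L : ℝ} (hL0 : 0 < L)
    {φ' : E → E} (h : ∀ x, HasGradientAt φ (φ' x) x)
    (hL : ∀ x y, ‖φ' x - φ' y‖ ≤ L * ‖x - y‖) (a b : E) :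
    1 / L * ‖φ' a - φ' b‖ ^ 2 ≤ inner ℝ (φ' a - φ' b) (a - b) := by
  have h1 := ConvexOn.add_sq_gradient_le hφ hL0 h hL a b
  have h2 := ConvexOn.add_sq_gradient_le hφ hL0 h hL b a
  have h3 : inner ℝ (φ' a) (b - a) = - inner ℝ (φ' a) (a - b) := by
    rw [← inner_neg_right, neg_sub]
  have e5 : 1 / L * ‖φ' a - φ' b‖ ^ 2 = 2 * (1 / (2 * L) * ‖φ' a - φ' b‖ ^ 2) := by
    field_simp
  rw [norm_sub_rev (φ' b)] at h1
  rw [inner_sub_left, e5]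
  linarith

end ConvexAnalysis

/-! ### One inexact gradient step and the change of target -/

section GradientStep

variable {E : Type*} [NormedAddCommGroup E] [InnerProductSpace ℝ E]

/-- One inexact gradient step on a strongly monotone, cocoercive operator, whose value at distance
`w` from the solution is `a`, estimated by `D`. -/
lemma norm_sub_smul_sq_le {m L g : ℝ} (hm : 0 < m) (hL : 0 < L) (hg : 0 ≤ g)
    (hgL : g ≤ 1 / (2 * L)) (hmL : m ≤ L) {a w D : E} (h1 : m * ‖w‖ ^ 2 ≤ inner ℝ a w)
    (h2 : 1 / L * ‖a‖ ^ 2 ≤ inner ℝ a w) :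
    ‖w - g • D‖ ^ 2 ≤ (1 - g * m / 2) * ‖w‖ ^ 2 - g / (4 * L) * ‖D‖ ^ 2
      + 5 * g / m * ‖D - a‖ ^ 2 := by
  set e := D - a
  have hD : D = a + e := by simp [e]
  have hexp : ‖w - g • D‖ ^ 2 = ‖w‖ ^ 2 - 2 * g * inner ℝ a w - 2 * g * inner ℝ e w
      + g ^ 2 * ‖D‖ ^ 2 := by
    rw [norm_sub_sq_real, inner_smul_right, norm_smul, Real.norm_eq_abs, mul_pow, sq_abs,
      real_inner_comm, hD, inner_add_left]
    ring
  have hyoung : -(2 * inner ℝ e w) ≤ m / 2 * ‖w‖ ^ 2 + 2 / m * ‖e‖ ^ 2 := by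
    have h3 : -(2 * inner ℝ e w) ≤ 2 * (‖e‖ * ‖w‖) := by
      have := abs_real_inner_le_norm e w
      have := neg_abs_le (inner ℝ e w : ℝ)
      linarith
    have h4 : 0 ≤ (m / 2) * (‖w‖ - 2 / m * ‖e‖) ^ 2 := by positivity
    have h5 : (m / 2) * (‖w‖ - 2 / m * ‖e‖) ^ 2
      = m / 2 * ‖w‖ ^ 2 + 2 / m * ‖e‖ ^ 2 - 2 * (‖e‖ * ‖w‖) := by
      field_simp; ring
    linarith
  -- The decrease is expressed through the estimator `D` rather than the exact value `a`: `D` is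
  -- what moves the iterate, and this term later absorbs the drift.
  have ha : 3 / 4 * ‖D‖ ^ 2 - 3 * ‖e‖ ^ 2 ≤ ‖a‖ ^ 2 := by
    have h6 : a = D - e := by simp [e]
    have h7 : ‖D‖ ≤ ‖a‖ + ‖e‖ := by rw [hD]; exact norm_add_le _ _
    nlinarith [sq_nonneg (‖a‖ - 3 * ‖e‖), norm_nonneg D, norm_nonneg a, norm_nonneg e]
  have ha' : 1 / L * (3 / 4 * ‖D‖ ^ 2 - 3 * ‖e‖ ^ 2) ≤ 1 / L * ‖a‖ ^ 2 :=
    mul_le_mul_of_nonneg_left ha (by positivity)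
  have hg2 : g ^ 2 * ‖D‖ ^ 2 ≤ g * (1 / (2 * L)) * ‖D‖ ^ 2 := by
    rw [sq]; gcongr
  have hLm : 1 / L * (3 * ‖e‖ ^ 2) ≤ 1 / m * (3 * ‖e‖ ^ 2) := by gcongr
  -- One copy of the inner product is spent on strong monotonicity, the other on cocoercivity.
  have key : -(2 * inner ℝ a w) ≤ -(m * ‖w‖ ^ 2) - 1 / L * (3 / 4 * ‖D‖ ^ 2) + 1 / m * (3 * ‖e‖ ^ 2) := by
    have := mul_sub (1 / L) (3 / 4 * ‖D‖ ^ 2) (3 * ‖e‖ ^ 2)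
    linarith
  have key2 := mul_le_mul_of_nonneg_left (add_le_add key hyoung) hg
  rw [hexp]
  have e1 : g / (4 * L) * ‖D‖ ^ 2 = g * (1 / L * (3 / 4 * ‖D‖ ^ 2)) - g * (1 / (2 * L)) * ‖D‖ ^ 2 := by
    field_simp; ring
  have e2 : 5 * g / m * ‖e‖ ^ 2 = g * (1 / m * (3 * ‖e‖ ^ 2)) + g * (2 / m * ‖e‖ ^ 2) := by
    field_simp; ring
  rw [e1, e2]
  linarith

/-- Young's inequality, with 1 + 1/θ ≤ 2/θ because θ ≤ 1. It is the price of replacing the target of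
a contraction by a nearby one. -/
lemma sq_dist_shift_le {E : Type*} [NormedAddCommGroup E] {u w z : E} {θ : ℝ} (hθ : 0 < θ) (hθ1 : θ ≤ 1) :
    ‖u - z‖ ^ 2 ≤ (1 + θ) * ‖u - w‖ ^ 2 + 2 / θ * ‖w - z‖ ^ 2 := by
  have h1 : ‖u - z‖ ≤ ‖u - w‖ + ‖w - z‖ := by
    have := norm_add_le (u - w) (w - z); simpa using this
  have h2 : ‖u - z‖ ^ 2 ≤ (‖u - w‖ + ‖w - z‖) ^ 2 := by gcongr
  have h3 : 0 ≤ θ * (‖u - w‖ - 1 / θ * ‖w - z‖) ^ 2 := by positivity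
  have h4 : θ * (‖u - w‖ - 1 / θ * ‖w - z‖) ^ 2 = θ * ‖u - w‖ ^ 2 + 1 / θ * ‖w - z‖ ^ 2
      - 2 * (‖u - w‖ * ‖w - z‖) := by field_simp; ring
  have h5 : 1 * ‖w - z‖ ^ 2 ≤ 1 / θ * ‖w - z‖ ^ 2 := by
    gcongr
    rw [le_div_iff₀ hθ]; linarith
  have h6 : 2 / θ * ‖w - z‖ ^ 2 = 1 / θ * ‖w - z‖ ^ 2 + 1 / θ * ‖w - z‖ ^ 2 := by ring
  nlinarith

end GradientStep

end ALS

end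

noncomputable section

namespace ALS

/-! ### Partial derivatives, Hessian bounds and existence of minimizers -/

section Partials

variable {p q : ℕ} {h : Vec p → Vec q → ℝ} {L m : ℝ}

lemma sqrt_add_sq_le {a b : ℝ} (ha : 0 ≤ a) (hb : 0 ≤ b) : Real.sqrt (a ^ 2 + b ^ 2) ≤ a + b := by
  rw [Real.sqrt_le_left (by positivity)]
  nlinarith

lemma LipXY.le_left {E : Type*} [NormedAddCommGroup E] {A : Vec p → Vec q → E} (hA : LipXY L A)
    (x x' : Vec p) (y : Vec q) : ‖A x y - A x' y‖ ≤ L * ‖x - x'‖ := by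
  simpa using hA x x' y y

lemma LipXY.le_right {E : Type*} [NormedAddCommGroup E] {A : Vec p → Vec q → E} (hA : LipXY L A)
    (x : Vec p) (y y' : Vec q) : ‖A x y - A x y'‖ ≤ L * ‖y - y'‖ := by
  simpa using hA x x y y'

lemma LipXY.continuous {E : Type*} [NormedAddCommGroup E] {A : Vec p → Vec q → E}
    (hA : LipXY L A) : Continuous (Function.uncurry A) := by
  rw [continuous_iff_continuousAt]
  rintro ⟨x, y⟩
  rw [ContinuousAt, tendsto_iff_norm_sub_tendsto_zero]
  refine squeeze_zero (fun _ => norm_nonneg _) (fun z => hA z.1 x z.2 y) ?_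
  have : Continuous (fun z : Vec p × Vec q => L * Real.sqrt (‖z.1 - x‖ ^ 2 + ‖z.2 - y‖ ^ 2)) := by
    fun_prop
  have h2 := this.tendsto (x, y)
  simpa using h2

lemma LipXY.gradX (hA : LipXY L (fullGrad h)) : LipXY L (gradX h) := by
  intro x x' y y'
  refine le_trans ?_ (hA x x' y y')
  have := WithLp.prod_norm_sq_eq_of_L2 (fullGrad h x y - fullGrad h x' y')
  refine le_of_sq_le_sq ?_ (norm_nonneg _)
  rw [this]
  simp [fullGrad]

lemma LipXY.gradY (hA : LipXY L (fullGrad h)) : LipXY L (gradY h) := by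
  intro x x' y y'
  refine le_trans ?_ (hA x x' y y')
  have := WithLp.prod_norm_sq_eq_of_L2 (fullGrad h x y - fullGrad h x' y')
  refine le_of_sq_le_sq ?_ (norm_nonneg _)
  rw [this]
  simp [fullGrad]

lemma hasGradientAt_gradX (hh : ContDiff ℝ 1 (Function.uncurry h)) (x : Vec p) (y : Vec q) :
    HasGradientAt (fun x' => h x' y) (gradX h x y) x := by
  apply DifferentiableAt.hasGradientAt
  have : Differentiable ℝ (fun x' => Function.uncurry h (x', y)) :=
    (hh.differentiable (by norm_num)).comp (by fun_prop)
  exact this x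

lemma hasGradientAt_gradY (hh : ContDiff ℝ 1 (Function.uncurry h)) (x : Vec p) (y : Vec q) :
    HasGradientAt (fun y' => h x y') (gradY h x y) y := by
  apply DifferentiableAt.hasGradientAt
  have : Differentiable ℝ (fun y' => Function.uncurry h (x, y')) :=
    (hh.differentiable (by norm_num)).comp (by fun_prop)
  exact this y

lemma inner_gradX (hh : ContDiff ℝ 1 (Function.uncurry h)) (x : Vec p) (y : Vec q) (u : Vec p) :
    inner ℝ (gradX h x y) u = fderiv ℝ (Function.uncurry h) (x, y) (u, 0) := by
  have h0 : HasFDerivAt (Function.uncurry h) _ (x, y) :=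
    ((hh.differentiable (by norm_num)) (x, y)).hasFDerivAt
  have h1 := HasFDerivAt.comp (f := fun e : Vec p => (e, y)) x h0 (hasFDerivAt_prodMk_left x y)
  have h2 := (hasGradientAt_iff_hasFDerivAt.mp (hasGradientAt_gradX hh x y)).unique h1
  simpa using congrArg (fun T => T u) h2

lemma inner_gradY (hh : ContDiff ℝ 1 (Function.uncurry h)) (x : Vec p) (y : Vec q) (w : Vec q) :
    inner ℝ (gradY h x y) w = fderiv ℝ (Function.uncurry h) (x, y) (0, w) := by
  have h1 := ((hh.differentiable (by norm_num)) (x, y)).hasFDerivAt.comp y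
    (hasFDerivAt_prodMk_right x y)
  have h2 := (hasGradientAt_iff_hasFDerivAt.mp (hasGradientAt_gradY hh x y)).unique h1
  simpa using congrArg (fun T => T w) h2

lemma differentiable_of_inner {n : ℕ} {V : Type*} [NormedAddCommGroup V] [NormedSpace ℝ V]
    {A : V → Vec n} (hA : ∀ u, Differentiable ℝ (fun z => inner ℝ (A z) u)) :
    Differentiable ℝ A := by
  intro z
  rw [differentiableAt_euclidean]
  intro i
  have := hA (EuclideanSpace.single i 1) z
  simpa [EuclideanSpace.inner_single_right] using this

lemma hasFDerivAt_jacXY (hh : ContDiff ℝ 2 (Function.uncurry h)) (x : Vec p) (y : Vec q) :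
    HasFDerivAt (fun y' => gradX h x y') (jacXY h x y) y := by
  apply DifferentiableAt.hasFDerivAt
  apply differentiable_of_inner
  intro u
  have h1 : ContDiff ℝ 1 (Function.uncurry h) := hh.of_le (by norm_num)
  simp_rw [inner_gradX h1]
  have h2 : Differentiable ℝ (fderiv ℝ (Function.uncurry h)) :=
    (hh.fderiv_right (m := 1) (by norm_num)).differentiable (by norm_num)
  have h3 : Differentiable ℝ (fun y' : Vec q => (x, y')) := by fun_prop
  exact (h2.comp h3).clm_apply (differentiable_const _)

lemma hasFDerivAt_hessY (hh : ContDiff ℝ 2 (Function.uncurry h)) (x : Vec p) (y : Vec q) :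
    HasFDerivAt (fun y' => gradY h x y') (hessY h x y) y := by
  apply DifferentiableAt.hasFDerivAt
  apply differentiable_of_inner
  intro u
  have h1 : ContDiff ℝ 1 (Function.uncurry h) := hh.of_le (by norm_num)
  simp_rw [inner_gradY h1]
  have h2 : Differentiable ℝ (fderiv ℝ (Function.uncurry h)) :=
    (hh.fderiv_right (m := 1) (by norm_num)).differentiable (by norm_num)
  have h3 : Differentiable ℝ (fun y' : Vec q => (x, y')) := by fun_prop
  exact (h2.comp h3).clm_apply (differentiable_const _)

/-- Obtained by differentiating `inner_gradX` in y. Seeing this Jacobian and the Hessian as blocks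
of one second derivative allows its symmetry to be used in `hasGradientAt_Phi`. -/
lemma inner_jacXY (hh : ContDiff ℝ 2 (Function.uncurry h)) (x : Vec p) (y v : Vec q) (u : Vec p) :
    inner ℝ (jacXY h x y v) u =
      fderiv ℝ (fderiv ℝ (Function.uncurry h)) (x, y) (0, v) (u, 0) := by
  have h1 : ContDiff ℝ 1 (Function.uncurry h) := hh.of_le (by norm_num)
  have h2 : Differentiable ℝ (fderiv ℝ (Function.uncurry h)) :=
    (hh.fderiv_right (m := 1) (by norm_num)).differentiable (by norm_num)
  have h3 := ((h2 (x, y)).hasFDerivAt.comp y (hasFDerivAt_prodMk_right x y)).clm_apply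
    (hasFDerivAt_const ((u, 0) : Vec p × Vec q) y)
  have h4 := (hasFDerivAt_jacXY hh x y).inner ℝ (hasFDerivAt_const u y)
  have h5 : (fun y' => inner ℝ (gradX h x y') u) =
      fun y' => fderiv ℝ (Function.uncurry h) (x, y') (u, 0) := by
    ext y'; exact inner_gradX h1 x y' u
  rw [h5] at h4
  have := congrArg (fun T => T v) (h4.unique h3)
  simpa using this

lemma inner_hessY (hh : ContDiff ℝ 2 (Function.uncurry h)) (x : Vec p) (y v w : Vec q) :
    inner ℝ (hessY h x y v) w =
      fderiv ℝ (fderiv ℝ (Function.uncurry h)) (x, y) (0, v) (0, w) := by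
  have h1 : ContDiff ℝ 1 (Function.uncurry h) := hh.of_le (by norm_num)
  have h2 : Differentiable ℝ (fderiv ℝ (Function.uncurry h)) :=
    (hh.fderiv_right (m := 1) (by norm_num)).differentiable (by norm_num)
  have h3 := ((h2 (x, y)).hasFDerivAt.comp y (hasFDerivAt_prodMk_right x y)).clm_apply
    (hasFDerivAt_const ((0, w) : Vec p × Vec q) y)
  have h4 := (hasFDerivAt_hessY hh x y).inner ℝ (hasFDerivAt_const w y)
  have h5 : (fun y' => inner ℝ (gradY h x y') w) =
      fun y' => fderiv ℝ (Function.uncurry h) (x, y') (0, w) := by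
    ext y'; exact inner_gradY h1 x y' w
  rw [h5] at h4
  have := congrArg (fun T => T v) (h4.unique h3)
  simpa using this

lemma norm_gradX_le (hh : ContDiff ℝ 1 (Function.uncurry h)) (hL : 0 ≤ L) (hl : LipXY L h)
    (x : Vec p) (y : Vec q) : ‖gradX h x y‖ ≤ L := by
  have h1 := hasGradientAt_iff_hasFDerivAt.mp (hasGradientAt_gradX hh x y)
  have h2 := h1.le_of_lip' hL (Filter.Eventually.of_forall fun x' => hl.le_left x' x y)
  simpa using h2

lemma norm_gradY_le (hh : ContDiff ℝ 1 (Function.uncurry h)) (hL : 0 ≤ L) (hl : LipXY L h)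
    (x : Vec p) (y : Vec q) : ‖gradY h x y‖ ≤ L := by
  have h1 := hasGradientAt_iff_hasFDerivAt.mp (hasGradientAt_gradY hh x y)
  have h2 := h1.le_of_lip' hL (Filter.Eventually.of_forall fun y' => hl.le_right x y' y)
  simpa using h2

lemma norm_jacXY_le (hh : ContDiff ℝ 2 (Function.uncurry h)) (hL : 0 ≤ L)
    (hl : LipXY L (fullGrad h)) (x : Vec p) (y : Vec q) : ‖jacXY h x y‖ ≤ L :=
  (hasFDerivAt_jacXY hh x y).le_of_lip' hL
    (Filter.Eventually.of_forall fun y' => hl.gradX.le_right x y' y)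

lemma norm_hessY_le (hh : ContDiff ℝ 2 (Function.uncurry h)) (hL : 0 ≤ L)
    (hl : LipXY L (fullGrad h)) (x : Vec p) (y : Vec q) : ‖hessY h x y‖ ≤ L :=
  (hasFDerivAt_hessY hh x y).le_of_lip' hL
    (Filter.Eventually.of_forall fun y' => hl.gradY.le_right x y' y)

lemma inner_gradY_sub_ge (hh : ContDiff ℝ 1 (Function.uncurry h)) {x : Vec p}
    (hs : StrongConvexOn Set.univ m (h x)) (a b : Vec q) :
    m * ‖a - b‖ ^ 2 ≤ inner ℝ (gradY h x a - gradY h x b) (a - b) :=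
  StrongConvexOn.inner_gradient_sub hs (fun y => hasGradientAt_gradY hh x y) a b

lemma cocoercive_gradY (hh : ContDiff ℝ 1 (Function.uncurry h)) {x : Vec p} (hm : 0 ≤ m)
    (hs : StrongConvexOn Set.univ m (h x)) (hL : 0 < L) (hl : LipXY L (fullGrad h))
    (a b : Vec q) :
    1 / L * ‖gradY h x a - gradY h x b‖ ^ 2 ≤ inner ℝ (gradY h x a - gradY h x b) (a - b) :=
  ConvexOn.cocoercive_gradient (strongConvexOn_zero.mp (hs.mono hm)) hL
    (fun y => hasGradientAt_gradY hh x y) (fun y y' => hl.gradY.le_right x y y') a b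

/-- The Hessian is a limit of difference quotients of the gradient, so strong monotonicity and
cocoercivity of the gradient pass to it. -/
lemma tendsto_hessY (hh : ContDiff ℝ 2 (Function.uncurry h)) (x : Vec p) (y w : Vec q) :
    Filter.Tendsto (fun c : ℝ => c • (gradY h x (y + c⁻¹ • w) - gradY h x y)) Filter.atTop
      (nhds (hessY h x y w)) :=
  (hasFDerivAt_hessY hh x y).lim_real w

lemma inner_hessY_ge (hh : ContDiff ℝ 2 (Function.uncurry h)) {x : Vec p}
    (hs : StrongConvexOn Set.univ m (h x)) (y w : Vec q) :
    m * ‖w‖ ^ 2 ≤ inner ℝ (hessY h x y w) w := by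
  have h1 : ContDiff ℝ 1 (Function.uncurry h) := hh.of_le (by norm_num)
  refine ge_of_tendsto ((tendsto_hessY hh x y w).inner tendsto_const_nhds) ?_
  filter_upwards [Filter.eventually_gt_atTop (0 : ℝ)] with c hc
  have h2 := inner_gradY_sub_ge h1 hs (y + c⁻¹ • w) y
  rw [add_sub_cancel_left, inner_smul_right, norm_smul, Real.norm_eq_abs, mul_pow, sq_abs] at h2
  rw [inner_smul_left]
  simp only [conj_trivial]
  have h3 := mul_le_mul_of_nonneg_left h2 (sq_nonneg c)
  have e1 : c ^ 2 * (m * (c⁻¹ ^ 2 * ‖w‖ ^ 2)) = m * ‖w‖ ^ 2 := by field_simp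
  have e2 : ∀ z : ℝ, c ^ 2 * (c⁻¹ * z) = c * z := by intro z; field_simp
  rw [e1, e2] at h3
  exact h3

lemma cocoercive_hessY (hh : ContDiff ℝ 2 (Function.uncurry h)) {x : Vec p} (hm : 0 ≤ m)
    (hs : StrongConvexOn Set.univ m (h x)) (hL : 0 < L) (hl : LipXY L (fullGrad h))
    (y w : Vec q) :
    1 / L * ‖hessY h x y w‖ ^ 2 ≤ inner ℝ (hessY h x y w) w := by
  have h1 : ContDiff ℝ 1 (Function.uncurry h) := hh.of_le (by norm_num)
  have ht := tendsto_hessY hh x y w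
  refine le_of_tendsto_of_tendsto ((ht.norm.pow 2).const_mul (1 / L))
    (ht.inner tendsto_const_nhds) ?_
  filter_upwards [Filter.eventually_gt_atTop (0 : ℝ)] with c hc
  have h2 := cocoercive_gradY h1 hm hs hL hl (y + c⁻¹ • w) y
  rw [add_sub_cancel_left, inner_smul_right] at h2
  rw [inner_smul_left, norm_smul, mul_pow, Real.norm_eq_abs, sq_abs]
  simp only [conj_trivial]
  have h3 := mul_le_mul_of_nonneg_left h2 (sq_nonneg c)
  have e2 : ∀ z : ℝ, c ^ 2 * (c⁻¹ * z) = c * z := by intro z; field_simp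
  rw [e2] at h3
  linarith

lemma norm_hessY_ge (hh : ContDiff ℝ 2 (Function.uncurry h)) {x : Vec p}
    (hs : StrongConvexOn Set.univ m (h x)) (y w : Vec q) : m * ‖w‖ ≤ ‖hessY h x y w‖ := by
  have h1 := (inner_hessY_ge hh hs y w).trans (real_inner_le_norm _ _)
  rcases (norm_nonneg w).eq_or_lt with h0 | h0
  · rw [← h0]; simp
  · rw [sq, ← mul_assoc] at h1
    exact le_of_mul_le_mul_right h1 h0

/-- The lower bound of `norm_hessY_ge` gives injectivity, and the dimension is finite. -/
lemma hessY_surjective (hm : 0 < m) (hh : ContDiff ℝ 2 (Function.uncurry h)) {x : Vec p}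
    (hs : StrongConvexOn Set.univ m (h x)) (y : Vec q) :
    Function.Surjective (hessY h x y) := by
  have hinj : Function.Injective (hessY h x y : Vec q →ₗ[ℝ] Vec q) := by
    rw [← LinearMap.ker_eq_bot, LinearMap.ker_eq_bot']
    intro w hw
    have h1 := norm_hessY_ge hh hs y w
    have h2 : hessY h x y w = 0 := hw
    rw [h2, norm_zero] at h1
    have : ‖w‖ ≤ 0 := by nlinarith [norm_nonneg w]
    simpa using this
  exact LinearMap.surjective_of_injective hinj

/-- The tangent inequality at 0 bounds the function below by a quadratic with positive leading
coefficient, so it is coercive. -/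
lemma exists_forall_le_of_strongConvex (hm : 0 < m) (hh : ContDiff ℝ 1 (Function.uncurry h))
    {x : Vec p} (hs : StrongConvexOn Set.univ m (h x)) : ∃ y, ∀ y', h x y ≤ h x y' := by
  have hcont : Continuous (h x) := hh.continuous.comp (Continuous.prodMk_right x)
  refine hcont.exists_forall_le ?_
  have hlow : ∀ y, h x 0 - ‖gradY h x 0‖ * ‖y‖ + m / 2 * ‖y‖ ^ 2 ≤ h x y := by
    intro y
    have h1 := StrongConvexOn.inner_gradient_le hs (hasGradientAt_gradY hh x 0) y
    rw [sub_zero] at h1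
    have h2 := abs_real_inner_le_norm (gradY h x 0) y
    have := neg_abs_le (inner ℝ (gradY h x 0) y : ℝ)
    linarith
  refine Filter.tendsto_atTop_mono hlow ?_
  have h3 : Filter.Tendsto (fun t : ℝ => h x 0 - ‖gradY h x 0‖ * t + m / 2 * t ^ 2) Filter.atTop
      Filter.atTop := by
    have h4 : Filter.Tendsto (fun t : ℝ => h x 0 + t * (m / 2 * t - ‖gradY h x 0‖))
        Filter.atTop Filter.atTop := by
      apply Filter.tendsto_atTop_add_const_left
      apply Filter.Tendsto.atTop_mul_atTop₀ Filter.tendsto_id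
      apply Filter.tendsto_atTop_add_const_right
      exact Filter.Tendsto.const_mul_atTop (by positivity) Filter.tendsto_id
    refine h4.congr fun t => ?_
    ring
  exact h3.comp tendsto_norm_cocompact_atTop

end Partials

end ALS

end

noncomputable section

namespace ALS

/-! ### Regularity of y*, v* and the hypergradient -/

section Problem

variable {p q : ℕ} {Ξ Z : Type*} [MeasurableSpace Ξ] [MeasurableSpace Z]

/-- The expectation of `D_x`. -/
def Bilevel.dx (B : Bilevel p q Ξ Z) (x : Vec p) (y v : Vec q) : Vec p :=
  gradX B.f x y - jacXY B.g x y v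

/-- The expectation of `D_v`. -/
def Bilevel.dv (B : Bilevel p q Ξ Z) (x : Vec p) (y v : Vec q) : Vec q :=
  hessY B.g x y v - gradY B.f x y

/-- The solution `v*(x)` of the linear system `∇_y² g(x, y*(x)) v = ∇_y f(x, y*(x))`. -/
def Bilevel.vstar (B : Bilevel p q Ξ Z) (x : Vec p) : Vec q :=
  Classical.epsilon (fun v => hessY B.g x (B.ystar x) v = gradY B.f x (B.ystar x))

/-- The hypergradient. -/
def Bilevel.gradPhi (B : Bilevel p q Ξ Z) (x : Vec p) : Vec p := B.dx x (B.ystar x) (B.vstar x)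

namespace Setup

variable {c : Setup}

lemma Valid.mu_pos (hc : c.Valid) : 0 < c.mu := hc.consts.mu_pos

lemma Valid.M_nonneg (hc : c.Valid) : 0 ≤ c.M :=
  (div_nonneg hc.consts.Cf_nonneg hc.mu_pos.le).trans hc.consts.M_ge

lemma Valid.Lgg_nonneg (hc : c.Valid) : 0 ≤ c.Lgg :=
  hc.consts.Lgxy_nonneg.trans (le_max_left _ _)

lemma M1_nonneg (c : Setup) : 0 ≤ c.M1 := by
  unfold M1; positivity

end Setup

variable {c : Setup} {B : Bilevel p q Ξ Z}

lemma Bilevel.Assumptions.contDiff_g_one (hB : B.Assumptions c.toConsts) :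
    ContDiff ℝ 1 (Function.uncurry B.g) :=
  hB.regular.contDiff_g.of_le (by norm_num)

/-- Test the Hessian on a unit vector, which exists because q ≥ 1. If the inequality fails, no
problem satisfies the assumptions. -/
lemma mu_le_Lg (hc : c.Valid) (hB : B.Assumptions c.toConsts) (hq : 0 < q) : c.mu ≤ c.Lg := by
  have h1 := norm_hessY_ge hB.regular.contDiff_g (hB.regular.strong_g 0) 0
    (EuclideanSpace.single ⟨0, hq⟩ 1)
  have h2 := (hessY B.g 0 0).le_of_opNorm_le
    (norm_hessY_le hB.regular.contDiff_g hc.consts.Lg_nonneg hB.lower_g.lip_grad 0 0)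
    (EuclideanSpace.single ⟨0, hq⟩ 1)
  have h3 := h1.trans h2
  simpa using h3

lemma ystar_le (hc : c.Valid) (hB : B.Assumptions c.toConsts) (x : Vec p) (y : Vec q) :
    B.g x (B.ystar x) ≤ B.g x y :=
  Classical.epsilon_spec (exists_forall_le_of_strongConvex hc.mu_pos hB.contDiff_g_one
    (hB.regular.strong_g x)) y

lemma gradY_ystar (hc : c.Valid) (hB : B.Assumptions c.toConsts) (x : Vec p) :
    gradY B.g x (B.ystar x) = 0 := by
  have h1 : IsLocalMin (fun y => B.g x y) (B.ystar x) :=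
    Filter.Eventually.of_forall (ystar_le hc hB x)
  have h2 := h1.hasFDerivAt_eq_zero
    (hasGradientAt_iff_hasFDerivAt.mp (hasGradientAt_gradY hB.contDiff_g_one x (B.ystar x)))
  simpa using h2

/-- Strong monotonicity of ∇_y g(x', ·) between the two minimizers: ∇_y g(x', y*(x)) differs from
∇_y g(x, y*(x)) = 0 by at most L_g ‖x − x'‖. -/
lemma norm_ystar_sub_le (hc : c.Valid) (hB : B.Assumptions c.toConsts) (x x' : Vec p) :
    ‖B.ystar x - B.ystar x'‖ ≤ c.Cy * ‖x - x'‖ := by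
  have h1 := inner_gradY_sub_ge hB.contDiff_g_one (hB.regular.strong_g x') (B.ystar x) (B.ystar x')
  rw [gradY_ystar hc hB x', sub_zero] at h1
  have h2 : gradY B.g x' (B.ystar x) = gradY B.g x' (B.ystar x) - gradY B.g x (B.ystar x) := by
    rw [gradY_ystar hc hB x, sub_zero]
  have h3 := hB.lower_g.lip_grad.gradY.le_left x' x (B.ystar x)
  rw [← h2] at h3
  have h4 := real_inner_le_norm (gradY B.g x' (B.ystar x)) (B.ystar x - B.ystar x')
  have hm := hc.mu_pos
  rw [Setup.Cy, div_mul_eq_mul_div, le_div_iff₀ hm, norm_sub_rev x x']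
  rcases (norm_nonneg (B.ystar x - B.ystar x')).eq_or_lt with h0 | h0
  · rw [← h0, zero_mul]
    exact mul_nonneg hc.consts.Lg_nonneg (norm_nonneg _)
  · refine le_of_mul_le_mul_right ?_ h0
    nlinarith

lemma hessY_vstar (hc : c.Valid) (hB : B.Assumptions c.toConsts) (x : Vec p) :
    hessY B.g x (B.ystar x) (B.vstar x) = gradY B.f x (B.ystar x) :=
  Classical.epsilon_spec (hessY_surjective hc.mu_pos hB.regular.contDiff_g
    (hB.regular.strong_g x) (B.ystar x) (gradY B.f x (B.ystar x)))

lemma norm_vstar_le_div (hc : c.Valid) (hB : B.Assumptions c.toConsts) (x : Vec p) :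
    ‖B.vstar x‖ ≤ c.Cf / c.mu := by
  have h1 := norm_hessY_ge hB.regular.contDiff_g (hB.regular.strong_g x) (B.ystar x) (B.vstar x)
  rw [hessY_vstar hc hB] at h1
  rw [le_div_iff₀ hc.mu_pos, mul_comm]
  exact h1.trans (norm_gradY_le hB.regular.contDiff_f hc.consts.Cf_nonneg hB.upper_f.lip _ _)

/-- Thanks to M ≥ C_f/μ the exact solution lies in the ball, so projecting onto the ball never
increases the distance to it. -/
lemma norm_vstar_le (hc : c.Valid) (hB : B.Assumptions c.toConsts) (x : Vec p) :
    ‖B.vstar x‖ ≤ c.M :=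
  (norm_vstar_le_div hc hB x).trans hc.consts.M_ge

lemma sqrt_ystar_le (hc : c.Valid) (hB : B.Assumptions c.toConsts) (x x' : Vec p) :
    Real.sqrt (‖x - x'‖ ^ 2 + ‖B.ystar x - B.ystar x'‖ ^ 2) ≤ (1 + c.Lg / c.mu) * ‖x - x'‖ := by
  have h1 := sqrt_add_sq_le (norm_nonneg (x - x')) (norm_nonneg (B.ystar x - B.ystar x'))
  have h2 := norm_ystar_sub_le hc hB x x'
  unfold Setup.Cy at h2
  linarith

/-- Subtract the two linear systems and invert the Hessian at `x`. The perturbation of the Hessian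
acts on v*(x'), which is bounded by C_f/μ and not merely by M. -/
lemma norm_vstar_sub_le (hc : c.Valid) (hB : B.Assumptions c.toConsts) (x x' : Vec p) :
    ‖B.vstar x - B.vstar x'‖ ≤ c.Cv * ‖x - x'‖ := by
  have hm := hc.mu_pos
  have h1 := norm_hessY_ge hB.regular.contDiff_g (hB.regular.strong_g x) (B.ystar x)
    (B.vstar x - B.vstar x')
  have h2 : hessY B.g x (B.ystar x) (B.vstar x - B.vstar x') =
      (gradY B.f x (B.ystar x) - gradY B.f x' (B.ystar x')) -
      (hessY B.g x (B.ystar x) - hessY B.g x' (B.ystar x')) (B.vstar x') := by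
    rw [map_sub, sub_apply, hessY_vstar hc hB, hessY_vstar hc hB]
    abel
  have h3 := hB.upper_f.lip_grad.gradY x x' (B.ystar x) (B.ystar x')
  have h4 := hB.lower_g.lip_hess x x' (B.ystar x) (B.ystar x')
  have h5 := (hessY B.g x (B.ystar x) - hessY B.g x' (B.ystar x')).le_of_opNorm_le h4 (B.vstar x')
  have h6 := norm_vstar_le_div hc hB x'
  have h7 := sqrt_ystar_le hc hB x x'
  set r := Real.sqrt (‖x - x'‖ ^ 2 + ‖B.ystar x - B.ystar x'‖ ^ 2)
  have hr : 0 ≤ r := Real.sqrt_nonneg _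
  have h8 : c.Lgyy ≤ c.Lgg := le_max_right _ _
  have h9 : c.Lgyy * r * ‖B.vstar x'‖ ≤ c.Lgg * r * (c.Cf / c.mu) := by
    have := hc.Lgg_nonneg
    gcongr
  have h10 := norm_sub_le (gradY B.f x (B.ystar x) - gradY B.f x' (B.ystar x'))
    ((hessY B.g x (B.ystar x) - hessY B.g x' (B.ystar x')) (B.vstar x'))
  rw [← h2] at h10
  have h11 : (c.Lf + c.Lgg * (c.Cf / c.mu)) * r ≤
      (c.Lf + c.Lgg * (c.Cf / c.mu)) * ((1 + c.Lg / c.mu) * ‖x - x'‖) := by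
    have := hc.Lgg_nonneg
    have := hc.consts.Lf_nonneg
    have := hc.consts.Cf_nonneg
    gcongr
  have h12 : c.mu * (c.Cv * ‖x - x'‖) =
      (c.Lf + c.Lgg * (c.Cf / c.mu)) * ((1 + c.Lg / c.mu) * ‖x - x'‖) := by
    unfold Setup.Cv; field_simp
  refine le_of_mul_le_mul_left ?_ hm
  rw [h12]
  linarith

/-- The variation of ∇_x f and of the Jacobian contributes μ C_v, and that of v* contributes L_g
C_v. This product serves as the smoothness constant of Φ throughout, in place of `LPhi`. -/
lemma norm_gradPhi_sub_le (hc : c.Valid) (hB : B.Assumptions c.toConsts) (x x' : Vec p) :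
    ‖B.gradPhi x - B.gradPhi x'‖ ≤ (c.Lg + c.mu) * c.Cv * ‖x - x'‖ := by
  have hm := hc.mu_pos
  have h2 : B.gradPhi x - B.gradPhi x' =
      (gradX B.f x (B.ystar x) - gradX B.f x' (B.ystar x')) -
      (jacXY B.g x (B.ystar x) - jacXY B.g x' (B.ystar x')) (B.vstar x') -
      jacXY B.g x (B.ystar x) (B.vstar x - B.vstar x') := by
    simp only [Bilevel.gradPhi, Bilevel.dx, map_sub, sub_apply]
    abel
  have h3 := hB.upper_f.lip_grad.gradX x x' (B.ystar x) (B.ystar x')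
  have h4 := hB.lower_g.lip_jac x x' (B.ystar x) (B.ystar x')
  have h5 := (jacXY B.g x (B.ystar x) - jacXY B.g x' (B.ystar x')).le_of_opNorm_le h4 (B.vstar x')
  have h6 := norm_vstar_le_div hc hB x'
  have h7 := sqrt_ystar_le hc hB x x'
  set r := Real.sqrt (‖x - x'‖ ^ 2 + ‖B.ystar x - B.ystar x'‖ ^ 2)
  have hr : 0 ≤ r := Real.sqrt_nonneg _
  have h8 : c.Lgxy ≤ c.Lgg := le_max_left _ _
  have h9 : c.Lgxy * r * ‖B.vstar x'‖ ≤ c.Lgg * r * (c.Cf / c.mu) := by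
    have := hc.Lgg_nonneg
    gcongr
  have h10 := norm_sub_le (gradX B.f x (B.ystar x) - gradX B.f x' (B.ystar x'))
    ((jacXY B.g x (B.ystar x) - jacXY B.g x' (B.ystar x')) (B.vstar x'))
  have h11 : (c.Lf + c.Lgg * (c.Cf / c.mu)) * r ≤
      (c.Lf + c.Lgg * (c.Cf / c.mu)) * ((1 + c.Lg / c.mu) * ‖x - x'‖) := by
    have := hc.Lgg_nonneg
    have := hc.consts.Lf_nonneg
    have := hc.consts.Cf_nonneg
    gcongr
  have h12 : c.mu * (c.Cv * ‖x - x'‖) =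
      (c.Lf + c.Lgg * (c.Cf / c.mu)) * ((1 + c.Lg / c.mu) * ‖x - x'‖) := by
    unfold Setup.Cv; field_simp
  have h13 := (jacXY B.g x (B.ystar x)).le_of_opNorm_le
    (norm_jacXY_le hB.regular.contDiff_g hc.consts.Lg_nonneg hB.lower_g.lip_grad x (B.ystar x))
    (B.vstar x - B.vstar x')
  have h14 := mul_le_mul_of_nonneg_left (norm_vstar_sub_le hc hB x x') hc.consts.Lg_nonneg
  have h15 := norm_sub_le ((gradX B.f x (B.ystar x) - gradX B.f x' (B.ystar x')) -
      (jacXY B.g x (B.ystar x) - jacXY B.g x' (B.ystar x')) (B.vstar x'))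
      (jacXY B.g x (B.ystar x) (B.vstar x - B.vstar x'))
  rw [h2]
  linarith

/-- No differentiability of y* is needed. Expanding f along (x', y*(x')) leaves the unknown term
⟨∇_y f, y*(x') − y*(x)⟩. Expanding 0 = ⟨∇_y g(x', y*(x')), v*(x)⟩ to first order at x, with the
system defining v*, rewrites this term as −⟨∇_x∇_y g v*, x' − x⟩ up to o(‖x' − x‖). -/
lemma hasGradientAt_Phi (hc : c.Valid) (hB : B.Assumptions c.toConsts) (x : Vec p) :
    HasGradientAt B.Phi (B.gradPhi x) x := by
  rw [hasGradientAt_iff_isLittleO]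
  have hf := ((hB.regular.contDiff_f.differentiable (by norm_num)) (x, B.ystar x)).hasFDerivAt
  have hg2 : Differentiable ℝ (fderiv ℝ (Function.uncurry B.g)) :=
    (hB.regular.contDiff_g.fderiv_right (m := 1) (by norm_num)).differentiable (by norm_num)
  have hg := (hg2 (x, B.ystar x)).hasFDerivAt
  -- Lipschitz continuity of y* turns remainders that are small in the joint increment into
  -- remainders small in x' − x.
  have hO : (fun x' => (x', B.ystar x') - (x, B.ystar x)) =O[nhds x] fun x' => x' - x := by
    refine Asymptotics.IsBigO.of_bound (max 1 c.Cy) (Filter.Eventually.of_forall fun x' => ?_)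
    rw [Prod.mk_sub_mk, Prod.norm_def]
    refine max_le ?_ ?_
    · exact le_mul_of_one_le_left (norm_nonneg _) (le_max_left _ _)
    · exact (norm_ystar_sub_le hc hB x' x).trans (by gcongr; exact le_max_right _ _)
  have ht : Filter.Tendsto (fun x' => (x', B.ystar x')) (nhds x) (nhds (x, B.ystar x)) := by
    rw [tendsto_iff_norm_sub_tendsto_zero]
    exact (hO.trans_tendsto (by
      have : Filter.Tendsto (fun x' : Vec p => x' - x) (nhds x) (nhds (x - x)) :=
        (continuous_id.sub continuous_const).tendsto x
      simpa using this)).norm.trans (by simp)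
  have h1 := (hf.isLittleO.comp_tendsto ht).trans_isBigO hO
  have h2 := (hg.isLittleO.comp_tendsto ht).trans_isBigO hO
  have h3 := ((ContinuousLinearMap.apply ℝ ℝ ((0, B.vstar x) : Vec p × Vec q)).isBigO_comp
    _ (nhds x)).trans_isLittleO h2
  refine (h1.sub h3).congr_left fun x' => ?_
  have hsymm : IsSymmSndFDerivAt ℝ (Function.uncurry B.g) (x, B.ystar x) :=
    (hB.regular.contDiff_g.contDiffAt).isSymmSndFDerivAt (by simp)
  have e0 : ((x' - x, B.ystar x' - B.ystar x) : Vec p × Vec q) =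
      (x' - x, 0) + (0, B.ystar x' - B.ystar x) := by simp
  have e1 := inner_gradY hB.contDiff_g_one x' (B.ystar x') (B.vstar x)
  have e2 := inner_gradY hB.contDiff_g_one x (B.ystar x) (B.vstar x)
  rw [gradY_ystar hc hB, inner_zero_left] at e1 e2
  have e3 := inner_jacXY hB.regular.contDiff_g x (B.ystar x) (B.vstar x) (x' - x)
  have e4 := inner_hessY hB.regular.contDiff_g x (B.ystar x) (B.vstar x) (B.ystar x' - B.ystar x)
  rw [hessY_vstar hc hB] at e4
  have e5 := inner_gradX hB.regular.contDiff_f x (B.ystar x) (x' - x)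
  have e6 := inner_gradY hB.regular.contDiff_f x (B.ystar x) (B.ystar x' - B.ystar x)
  -- Symmetry moves v* into the first slot, where the second derivative splits into the Jacobian and
  -- Hessian blocks.
  have e7 := hsymm.eq (x' - x, B.ystar x' - B.ystar x) (0, B.vstar x)
  simp only [Function.comp_apply, ContinuousLinearMap.apply_apply, Prod.mk_sub_mk,
    sub_apply]
  rw [e7, e0, map_add, map_add, ← e1, ← e2, ← e3, ← e4, ← e5, ← e6]
  simp only [Bilevel.gradPhi, Bilevel.dx, inner_sub_left, Bilevel.Phi, Function.uncurry]
  ring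

lemma Phi_descent (hc : c.Valid) (hB : B.Assumptions c.toConsts) (x x' : Vec p) :
    B.Phi x' ≤ B.Phi x + inner ℝ (B.gradPhi x) (x' - x) +
      (c.Lg + c.mu) * c.Cv / 2 * ‖x' - x‖ ^ 2 :=
  le_add_inner_add_sq (hasGradientAt_Phi hc hB) (norm_gradPhi_sub_le hc hB) x x'

lemma norm_dx_le (hc : c.Valid) (hB : B.Assumptions c.toConsts) (x : Vec p) (y v : Vec q)
    (hv : ‖v‖ ≤ c.M) : ‖B.dx x y v‖ ≤ c.Cf + c.Lg * c.M := by
  refine (norm_sub_le _ _).trans (add_le_add ?_ ?_)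
  · exact norm_gradX_le hB.regular.contDiff_f hc.consts.Cf_nonneg hB.upper_f.lip x y
  · refine ((jacXY B.g x y).le_of_opNorm_le (norm_jacXY_le hB.regular.contDiff_g
      hc.consts.Lg_nonneg hB.lower_g.lip_grad x y) v).trans ?_
    exact mul_le_mul_of_nonneg_left hv hc.consts.Lg_nonneg

lemma norm_dv_le (hc : c.Valid) (hB : B.Assumptions c.toConsts) (x : Vec p) (y v : Vec q)
    (hv : ‖v‖ ≤ c.M) : ‖B.dv x y v‖ ≤ c.Lg * c.M + c.Cf := by
  refine (norm_sub_le _ _).trans (add_le_add ?_ ?_)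
  · refine ((hessY B.g x y).le_of_opNorm_le (norm_hessY_le hB.regular.contDiff_g
      hc.consts.Lg_nonneg hB.lower_g.lip_grad x y) v).trans ?_
    exact mul_le_mul_of_nonneg_left hv hc.consts.Lg_nonneg
  · exact norm_gradY_le hB.regular.contDiff_f hc.consts.Cf_nonneg hB.upper_f.lip x y

lemma norm_gradPhi_le (hc : c.Valid) (hB : B.Assumptions c.toConsts) (x : Vec p) :
    ‖B.gradPhi x‖ ≤ c.Cf + c.Lg * c.M :=
  norm_dx_le hc hB _ _ _ (norm_vstar_le hc hB x)

/-- The factor 2 is there so that (a + b)² ≤ 2a² + 2b² can separate the displacement of (x, y) from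
that of v. -/
lemma two_mul_sq_le_M1 (hc : c.Valid) {l t : ℝ} (hl : 0 ≤ l) (hl' : l ≤ c.Lgg) (ht : 0 ≤ t)
    (ht' : t ≤ c.M) : 2 * (c.Lf + l * t) ^ 2 ≤ c.M1 := by
  have h1 : l * t ≤ c.Lgg * c.M := by
    have := hc.Lgg_nonneg
    gcongr
  have h2 : (c.Lf + l * t) ^ 2 ≤ (c.Lf + c.Lgg * c.M) ^ 2 := by
    have := hc.consts.Lf_nonneg
    gcongr
  unfold Setup.M1
  nlinarith [sq_nonneg (c.Lf - c.Lgg * c.M)]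

lemma sq_norm_dx_sub_gradPhi_le (hc : c.Valid) (hB : B.Assumptions c.toConsts) (x : Vec p)
    (y v : Vec q) (hv : ‖v‖ ≤ c.M) :
    ‖B.dx x y v - B.gradPhi x‖ ^ 2 ≤
      c.M1 * ‖y - B.ystar x‖ ^ 2 + 2 * c.Lg ^ 2 * ‖v - B.vstar x‖ ^ 2 := by
  have h2 : B.dx x y v - B.gradPhi x =
      (gradX B.f x y - gradX B.f x (B.ystar x)) -
      (jacXY B.g x y - jacXY B.g x (B.ystar x)) v -
      jacXY B.g x (B.ystar x) (v - B.vstar x) := by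
    simp only [Bilevel.gradPhi, Bilevel.dx, map_sub, sub_apply]
    abel
  have h3 := hB.upper_f.lip_grad.gradX.le_right x y (B.ystar x)
  have h4 := hB.lower_g.lip_jac.le_right x y (B.ystar x)
  have h5 := (jacXY B.g x y - jacXY B.g x (B.ystar x)).le_of_opNorm_le h4 v
  have h13 := (jacXY B.g x (B.ystar x)).le_of_opNorm_le
    (norm_jacXY_le hB.regular.contDiff_g hc.consts.Lg_nonneg hB.lower_g.lip_grad x (B.ystar x))
    (v - B.vstar x)
  have h10 := norm_sub_le (gradX B.f x y - gradX B.f x (B.ystar x))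
    ((jacXY B.g x y - jacXY B.g x (B.ystar x)) v)
  have h15 := norm_sub_le ((gradX B.f x y - gradX B.f x (B.ystar x)) -
      (jacXY B.g x y - jacXY B.g x (B.ystar x)) v) (jacXY B.g x (B.ystar x) (v - B.vstar x))
  have h16 := two_mul_sq_le_M1 hc hc.consts.Lgxy_nonneg (le_max_left _ _) (norm_nonneg v) hv
  have h17 : ‖B.dx x y v - B.gradPhi x‖ ≤ (c.Lf + c.Lgxy * ‖v‖) * ‖y - B.ystar x‖ +
      c.Lg * ‖v - B.vstar x‖ := by
    rw [h2]; linarith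
  have h18 := mul_le_mul_of_nonneg_right h16 (sq_nonneg ‖y - B.ystar x‖)
  have h19 := pow_le_pow_left₀ (norm_nonneg _) h17 2
  nlinarith [sq_nonneg ((c.Lf + c.Lgxy * ‖v‖) * ‖y - B.ystar x‖ - c.Lg * ‖v - B.vstar x‖)]

/-- At y = y*(x) the direction d_v is exactly the Hessian applied to v − v*(x). Evaluating at
another y is the only bias of the v-step, and it is linear in ‖y − y*(x)‖ because v stays in the
ball. -/
lemma sq_norm_dv_sub_hessY_le (hc : c.Valid) (hB : B.Assumptions c.toConsts) (x : Vec p)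
    (y v : Vec q) (hv : ‖v‖ ≤ c.M) :
    ‖B.dv x y v - hessY B.g x (B.ystar x) (v - B.vstar x)‖ ^ 2 ≤
      c.M1 / 2 * ‖y - B.ystar x‖ ^ 2 := by
  have h2 : B.dv x y v - hessY B.g x (B.ystar x) (v - B.vstar x) =
      (hessY B.g x y - hessY B.g x (B.ystar x)) v -
      (gradY B.f x y - gradY B.f x (B.ystar x)) := by
    simp only [Bilevel.dv, map_sub, sub_apply, hessY_vstar hc hB]
    abel
  have h3 := hB.upper_f.lip_grad.gradY.le_right x y (B.ystar x)
  have h4 := hB.lower_g.lip_hess.le_right x y (B.ystar x)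
  have h5 := (hessY B.g x y - hessY B.g x (B.ystar x)).le_of_opNorm_le h4 v
  have h10 := norm_sub_le ((hessY B.g x y - hessY B.g x (B.ystar x)) v)
    (gradY B.f x y - gradY B.f x (B.ystar x))
  have h16 := two_mul_sq_le_M1 hc hc.consts.Lgyy_nonneg (le_max_right _ _) (norm_nonneg v) hv
  have h17 : ‖B.dv x y v - hessY B.g x (B.ystar x) (v - B.vstar x)‖ ≤
      (c.Lf + c.Lgyy * ‖v‖) * ‖y - B.ystar x‖ := by
    rw [h2]; linarith
  have h18 := mul_le_mul_of_nonneg_right h16 (sq_nonneg ‖y - B.ystar x‖)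
  have h19 := pow_le_pow_left₀ (norm_nonneg _) h17 2
  nlinarith

end Problem

end ALS

end

noncomputable section

namespace ALS

/-! ### Centered square-integrable noises -/

section Noise

variable {Θ E : Type*} [MeasurableSpace Θ] [NormedAddCommGroup E] {ν : Measure Θ}

/-- Integrability is extracted from the finite lower integral, so that the Bochner integral is
meaningful when it is bounded. -/
lemma integral_sq_norm_le_of_lintegral {A : Θ → E} (hA : AEStronglyMeasurable A ν) {V : ℝ}
    (hV : 0 ≤ V) (h : ∫⁻ θ, ENNReal.ofReal (‖A θ‖ ^ 2) ∂ν ≤ ENNReal.ofReal V) :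
    MemLp A 2 ν ∧ ∫ θ, ‖A θ‖ ^ 2 ∂ν ≤ V := by
  have h1 : Integrable (fun θ => ‖A θ‖ ^ 2) ν := by
    refine ⟨hA.norm.pow 2, ?_⟩
    rw [hasFiniteIntegral_iff_ofReal (Filter.Eventually.of_forall fun _ => sq_nonneg _)]
    exact h.trans_lt ENNReal.ofReal_lt_top
  refine ⟨(memLp_two_iff_integrable_sq_norm hA).2 h1, ?_⟩
  rw [← ENNReal.ofReal_le_ofReal_iff hV, ofReal_integral_eq_lintegral_ofReal h1
    (Filter.Eventually.of_forall fun _ => sq_nonneg _)]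
  exact h

lemma _root_.MeasureTheory.MemLp.integrable_sq_norm {A : Θ → E} (h : MemLp A 2 ν) :
    Integrable (fun θ => ‖A θ‖ ^ 2) ν :=
  (memLp_two_iff_integrable_sq_norm h.1).1 h

lemma sq_norm_add_le (a b : E) : ‖a + b‖ ^ 2 ≤ 2 * ‖a‖ ^ 2 + 2 * ‖b‖ ^ 2 := by
  have := pow_le_pow_left₀ (norm_nonneg _) (norm_add_le a b) 2
  nlinarith [sq_nonneg (‖a‖ - ‖b‖)]

variable [NormedSpace ℝ E]

/-- `N` is square integrable and centered, with second moment at most `V`. -/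
structure IsNoise (ν : Measure Θ) (N : Θ → E) (V : ℝ) : Prop where
  memLp : MemLp N 2 ν
  mean : ∫ θ, N θ ∂ν = 0
  var : ∫ θ, ‖N θ‖ ^ 2 ∂ν ≤ V

lemma Unbiased.isNoise [CompleteSpace E] [IsProbabilityMeasure ν] {A : Θ → E} {a : E} {s : ℝ}
    (h : Unbiased ν A a) (hv : VarLe ν A a s) : IsNoise ν (fun θ => A θ - a) (s ^ 2) := by
  have h1 : Integrable (fun θ => A θ - a) ν := h.1.sub (integrable_const a)
  obtain ⟨h2, h3⟩ := integral_sq_norm_le_of_lintegral h1.1 (sq_nonneg s) hv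
  refine ⟨h2, ?_, h3⟩
  rw [integral_sub h.1 (integrable_const a), h.2]
  simp

lemma IsNoise.smul {N : Θ → E} {V : ℝ} (h : IsNoise ν N V) (r : ℝ) :
    IsNoise ν (fun θ => r • N θ) (r ^ 2 * V) := by
  refine ⟨h.memLp.const_smul r, by rw [integral_smul, h.mean, smul_zero], ?_⟩
  simp_rw [norm_smul, mul_pow, Real.norm_eq_abs, sq_abs]
  rw [integral_const_mul]
  exact mul_le_mul_of_nonneg_left h.var (sq_nonneg r)

/-- Independence is not available here: the two components of a sample pair may be dependent, since
only their marginal laws are prescribed. Hence the factor 2. -/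
lemma IsNoise.add [IsFiniteMeasure ν] {N N' : Θ → E} {V V' : ℝ} (h : IsNoise ν N V)
    (h' : IsNoise ν N' V') : IsNoise ν (fun θ => N θ + N' θ) (2 * V + 2 * V') := by
  have hs := h.memLp.add h'.memLp
  refine ⟨hs, ?_, ?_⟩
  · rw [integral_add (h.memLp.integrable (by norm_num)) (h'.memLp.integrable (by norm_num)),
      h.mean, h'.mean, add_zero]
  · have h1 := h.memLp.integrable_sq_norm.const_mul 2
    have h2 := h'.memLp.integrable_sq_norm.const_mul 2
    refine (integral_mono hs.integrable_sq_norm (h1.add h2)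
      (fun θ => sq_norm_add_le (N θ) (N' θ))).trans ?_
    rw [integral_add' h1 h2, integral_const_mul, integral_const_mul]
    linarith [h.var, h'.var]

lemma IsNoise.sub [IsFiniteMeasure ν] {N N' : Θ → E} {V V' : ℝ} (h : IsNoise ν N V)
    (h' : IsNoise ν N' V') : IsNoise ν (fun θ => N θ - N' θ) (2 * V + 2 * V') := by
  have := h.add (h'.smul (-1))
  simpa [sub_eq_add_neg] using this

lemma IsNoise.clm [IsFiniteMeasure ν] [CompleteSpace E] {E' : Type*} [NormedAddCommGroup E']
    [NormedSpace ℝ E'] [CompleteSpace E'] {N : Θ → E} {V : ℝ} (h : IsNoise ν N V) (T : E →L[ℝ] E')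
    {r : ℝ} (hT : ∀ a, ‖T a‖ ≤ r * ‖a‖) :
    IsNoise ν (fun θ => T (N θ)) (r ^ 2 * V) := by
  have hm : MemLp (fun θ => T (N θ)) 2 ν := T.comp_memLp' h.memLp
  refine ⟨hm, ?_, ?_⟩
  · rw [T.integral_comp_comm (h.memLp.integrable (by norm_num)), h.mean, map_zero]
  · refine (integral_mono hm.integrable_sq_norm (h.memLp.integrable_sq_norm.const_mul (r ^ 2))
      (fun θ => ?_)).trans ?_
    · have := pow_le_pow_left₀ (norm_nonneg _) (hT (N θ)) 2
      simpa [mul_pow] using this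
    · rw [integral_const_mul]
      exact mul_le_mul_of_nonneg_left h.var (sq_nonneg r)

lemma IsNoise.comp_map {Θ' : Type*} [MeasurableSpace Θ'] {π : Measure Θ'} {φ : Θ' → Θ}
    (hφ : Measurable φ) {N : Θ → E} {V : ℝ} (h : IsNoise (π.map φ) N V) :
    IsNoise π (fun θ => N (φ θ)) V := by
  have h1 := h.memLp.1
  refine ⟨h.memLp.comp_of_map hφ.aemeasurable, ?_, ?_⟩
  · rw [← integral_map hφ.aemeasurable h1, h.mean]
  · rw [← integral_map (f := fun θ => ‖N θ‖ ^ 2) hφ.aemeasurable (h1.norm.pow 2)]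
    exact h.var

/-- A variance is at most the second moment. The a priori bound `V` serves only for integrability
and is replaced by `l`; the gain is that a same-sample difference has a variance controlled by its
Lipschitz bound. -/
lemma IsNoise.of_bound {F : Type*} [NormedAddCommGroup F] [InnerProductSpace ℝ F]
    [CompleteSpace F] [IsProbabilityMeasure ν] {A : Θ → F} {a : F} {V l : ℝ}
    (h : IsNoise ν (fun θ => A θ - a) V) (hA : ∀ θ, ‖A θ‖ ^ 2 ≤ l) :
    IsNoise ν (fun θ => A θ - a) l := by
  refine ⟨h.memLp, h.mean, ?_⟩
  have hi : Integrable (fun θ => A θ - a) ν := h.memLp.integrable (by norm_num)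
  have h1 : ∀ θ, ‖A θ - a‖ ^ 2 = ‖A θ‖ ^ 2 - ‖a‖ ^ 2 - 2 * inner ℝ a (A θ - a) := by
    intro θ
    have : A θ = a + (A θ - a) := by abel
    have h2 := norm_add_sq_real a (A θ - a)
    rw [← this] at h2
    linarith
  have hin : ∫ θ, inner ℝ a (A θ - a) ∂ν = 0 := by
    rw [integral_inner hi, h.mean, inner_zero_right]
  have hle : ∀ θ, ‖A θ - a‖ ^ 2 ≤ l - 2 * inner ℝ a (A θ - a) := fun θ => by
    rw [h1]; linarith [hA θ, sq_nonneg ‖a‖]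
  have hint : Integrable (fun θ => 2 * inner ℝ a (A θ - a)) ν := (hi.const_inner a).const_mul 2
  refine (integral_mono h.memLp.integrable_sq_norm ((integrable_const l).sub hint) hle).trans ?_
  rw [integral_sub' (integrable_const l) hint, integral_const_mul, hin]
  simp

lemma IsNoise.mono {N : Θ → E} {V V' : ℝ} (h : IsNoise ν N V) (hV : V ≤ V') : IsNoise ν N V' :=
  ⟨h.memLp, h.mean, h.var.trans hV⟩

end Noise

/-! ### Measurability of the stochastic derivatives -/

section Measurability

variable {p q : ℕ} {Θ : Type*} [MeasurableSpace Θ]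

lemma measurable_of_inner {n : ℕ} {A : Θ → Vec n} (hA : ∀ u, Measurable fun θ => inner ℝ (A θ) u) :
    Measurable A := by
  have h1 : Measurable (fun θ => (A θ).ofLp) := by
    rw [measurable_pi_iff]
    intro i
    have := hA (EuclideanSpace.single i 1)
    simpa [EuclideanSpace.inner_single_right] using this
  exact (WithLp.measurable_toLp 2 _).comp h1

lemma tendsto_norm_natCast_atTop :
    Filter.Tendsto (fun n : ℕ => ‖(n : ℝ)‖) Filter.atTop Filter.atTop := by
  simpa using tendsto_natCast_atTop_atTop (R := ℝ)

/-- Only function values are assumed measurable in the sample. Directional derivatives are limits of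
difference quotients with increments 1/n, hence measurable as well. -/
lemma measurable_gradX {h : Θ → Vec p → Vec q → ℝ}
    (hh : ∀ θ, ContDiff ℝ 1 (Function.uncurry (h θ))) (hm : ∀ x y, Measurable fun θ => h θ x y)
    (x : Vec p) (y : Vec q) : Measurable fun θ => gradX (h θ) x y := by
  refine measurable_of_inner fun u => ?_
  refine measurable_of_tendsto_metrizable
    (f := fun (n : ℕ) θ => (n : ℝ) • (h θ (x + (n : ℝ)⁻¹ • u) y - h θ x y)) (fun n => ?_) ?_
  · exact ((hm _ _).sub (hm _ _)).const_smul (n : ℝ)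
  · rw [tendsto_pi_nhds]
    intro θ
    have := (hasGradientAt_iff_hasFDerivAt.mp (hasGradientAt_gradX (hh θ) x y)).lim u
      tendsto_norm_natCast_atTop
    simpa using this

lemma measurable_gradY {h : Θ → Vec p → Vec q → ℝ}
    (hh : ∀ θ, ContDiff ℝ 1 (Function.uncurry (h θ))) (hm : ∀ x y, Measurable fun θ => h θ x y)
    (x : Vec p) (y : Vec q) : Measurable fun θ => gradY (h θ) x y := by
  refine measurable_of_inner fun u => ?_
  refine measurable_of_tendsto_metrizable
    (f := fun (n : ℕ) θ => (n : ℝ) • (h θ x (y + (n : ℝ)⁻¹ • u) - h θ x y)) (fun n => ?_) ?_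
  · exact ((hm _ _).sub (hm _ _)).const_smul (n : ℝ)
  · rw [tendsto_pi_nhds]
    intro θ
    have := (hasGradientAt_iff_hasFDerivAt.mp (hasGradientAt_gradY (hh θ) x y)).lim u
      tendsto_norm_natCast_atTop
    simpa using this

lemma measurable_jacXY {h : Θ → Vec p → Vec q → ℝ}
    (hh : ∀ θ, ContDiff ℝ 2 (Function.uncurry (h θ))) (hm : ∀ x y, Measurable fun θ => h θ x y)
    (x : Vec p) (y v : Vec q) : Measurable fun θ => jacXY (h θ) x y v := by
  have h1 := measurable_gradX (fun θ => (hh θ).of_le (by norm_num)) hm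
  refine measurable_of_tendsto_metrizable
    (f := fun (n : ℕ) θ => (n : ℝ) • (gradX (h θ) x (y + (n : ℝ)⁻¹ • v) - gradX (h θ) x y))
    (fun n => ((h1 _ _).sub (h1 _ _)).const_smul (n : ℝ)) ?_
  rw [tendsto_pi_nhds]
  exact fun θ => (hasFDerivAt_jacXY (hh θ) x y).lim v tendsto_norm_natCast_atTop

lemma measurable_hessY {h : Θ → Vec p → Vec q → ℝ}
    (hh : ∀ θ, ContDiff ℝ 2 (Function.uncurry (h θ))) (hm : ∀ x y, Measurable fun θ => h θ x y)
    (x : Vec p) (y v : Vec q) : Measurable fun θ => hessY (h θ) x y v := by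
  have h1 := measurable_gradY (fun θ => (hh θ).of_le (by norm_num)) hm
  refine measurable_of_tendsto_metrizable
    (f := fun (n : ℕ) θ => (n : ℝ) • (gradY (h θ) x (y + (n : ℝ)⁻¹ • v) - gradY (h θ) x y))
    (fun n => ((h1 _ _).sub (h1 _ _)).const_smul (n : ℝ)) ?_
  rw [tendsto_pi_nhds]
  exact fun θ => (hasFDerivAt_hessY (hh θ) x y).lim v tendsto_norm_natCast_atTop

end Measurability

/-! ### The stochastic directions: joint measurability, noise, Lipschitz bounds -/

section Oracles

variable {p q : ℕ} {Ξ Z : Type*} [MeasurableSpace Ξ] [MeasurableSpace Z]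
variable {c : Setup} {B : Bilevel p q Ξ Z}

lemma Bilevel.Assumptions.contDiff_G_one (hB : B.Assumptions c.toConsts) (ζ : Z) :
    ContDiff ℝ 1 (Function.uncurry (B.G ζ)) :=
  (hB.regular.contDiff_G ζ).of_le (by norm_num)

/-- A Carathéodory argument: continuity in the point for each sample, and measurability in the
sample at each point. -/
lemma measurable_Dx (hB : B.Assumptions c.toConsts) :
    Measurable fun z : (Ξ × Z) × (Vec p × Vec q × Vec q) => B.Dx z.1 z.2.1 z.2.2.1 z.2.2.2 := by
  have h1 : Measurable (Function.uncurry
      fun (θ : Vec p × Vec q × Vec q) (s : Ξ × Z) => B.Dx s θ.1 θ.2.1 θ.2.2) := by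
    apply measurable_uncurry_of_continuous_of_measurable
    · intro s
      have h2 := (hB.upper_F s.1).lip_grad.gradX.continuous
      have h3 := (hB.lower_G s.2).lip_jac.continuous
      have h4 : Continuous fun θ : Vec p × Vec q × Vec q => (θ.1, θ.2.1) := by fun_prop
      have h5 : Continuous fun θ : Vec p × Vec q × Vec q => θ.2.2 := by fun_prop
      have h6 := h2.comp h4
      have h7 := (h3.comp h4).clm_apply h5
      simp only [Bilevel.Dx]
      exact h6.sub h7
    · rintro ⟨x, y, v⟩
      have h2 := measurable_gradX hB.regular.contDiff_F hB.wellPosed.measF x y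
      have h3 := measurable_jacXY hB.regular.contDiff_G hB.wellPosed.measG x y v
      have h4 : Measurable fun s : Ξ × Z => _ := h2.comp measurable_fst
      have h5 : Measurable fun s : Ξ × Z => _ := h3.comp measurable_snd
      simp only [Bilevel.Dx]
      exact h4.sub h5
  have h2 : Measurable fun z : (Ξ × Z) × (Vec p × Vec q × Vec q) => (z.2, z.1) :=
    measurable_snd.prodMk measurable_fst
  have h3 := h1.comp h2
  exact h3

lemma measurable_Dv (hB : B.Assumptions c.toConsts) :
    Measurable fun z : (Ξ × Z) × (Vec p × Vec q × Vec q) => B.Dv z.1 z.2.1 z.2.2.1 z.2.2.2 := by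
  have h1 : Measurable (Function.uncurry
      fun (θ : Vec p × Vec q × Vec q) (s : Ξ × Z) => B.Dv s θ.1 θ.2.1 θ.2.2) := by
    apply measurable_uncurry_of_continuous_of_measurable
    · intro s
      have h2 := (hB.upper_F s.1).lip_grad.gradY.continuous
      have h3 := (hB.lower_G s.2).lip_hess.continuous
      have h4 : Continuous fun θ : Vec p × Vec q × Vec q => (θ.1, θ.2.1) := by fun_prop
      have h5 : Continuous fun θ : Vec p × Vec q × Vec q => θ.2.2 := by fun_prop
      have h6 := h2.comp h4
      have h7 := (h3.comp h4).clm_apply h5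
      simp only [Bilevel.Dv]
      exact h7.sub h6
    · rintro ⟨x, y, v⟩
      have h2 := measurable_gradY hB.regular.contDiff_F hB.wellPosed.measF x y
      have h3 := measurable_hessY hB.regular.contDiff_G hB.wellPosed.measG x y v
      have h4 : Measurable fun s : Ξ × Z => _ := h2.comp measurable_fst
      have h5 : Measurable fun s : Ξ × Z => _ := h3.comp measurable_snd
      simp only [Bilevel.Dv]
      exact h5.sub h4
  have h2 : Measurable fun z : (Ξ × Z) × (Vec p × Vec q × Vec q) => (z.2, z.1) :=
    measurable_snd.prodMk measurable_fst
  have h3 := h1.comp h2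
  exact h3

lemma measurable_Dy (hB : B.Assumptions c.toConsts) :
    Measurable fun z : (Ξ × Z) × (Vec p × Vec q) => B.Dy z.1 z.2.1 z.2.2 := by
  have h1 : Measurable (Function.uncurry
      fun (θ : Vec p × Vec q) (s : Ξ × Z) => B.Dy s θ.1 θ.2) := by
    apply measurable_uncurry_of_continuous_of_measurable
    · intro s
      exact (hB.lower_G s.2).lip_grad.gradY.continuous
    · intro θ
      exact (measurable_gradY hB.contDiff_G_one hB.wellPosed.measG _ _).comp measurable_snd
  exact h1.comp measurable_swap

lemma continuous_dx (hB : B.Assumptions c.toConsts) :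
    Continuous fun θ : Vec p × Vec q × Vec q => B.dx θ.1 θ.2.1 θ.2.2 := by
  have h2 := hB.upper_f.lip_grad.gradX.continuous
  have h3 := hB.lower_g.lip_jac.continuous
  have h4 : Continuous fun θ : Vec p × Vec q × Vec q => (θ.1, θ.2.1) := by fun_prop
  exact (h2.comp h4).sub ((h3.comp h4).clm_apply (by fun_prop))

lemma continuous_dv (hB : B.Assumptions c.toConsts) :
    Continuous fun θ : Vec p × Vec q × Vec q => B.dv θ.1 θ.2.1 θ.2.2 := by
  have h2 := hB.upper_f.lip_grad.gradY.continuous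
  have h3 := hB.lower_g.lip_hess.continuous
  have h4 : Continuous fun θ : Vec p × Vec q × Vec q => (θ.1, θ.2.1) := by fun_prop
  exact ((h3.comp h4).clm_apply (by fun_prop)).sub (h2.comp h4)

lemma isNoise_gradX {Θ : Type*} [MeasurableSpace Θ] {ν : Measure Θ} [IsProbabilityMeasure ν]
    {H : Θ → Vec p → Vec q → ℝ} {h : Vec p → Vec q → ℝ} {x : Vec p} {y : Vec q} {s : ℝ}
    (hu : Unbiased ν (fun θ => fullGrad (H θ) x y) (fullGrad h x y))
    (hv : VarLe ν (fun θ => fullGrad (H θ) x y) (fullGrad h x y) s) :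
    IsNoise ν (fun θ => gradX (H θ) x y - gradX h x y) (s ^ 2) := by
  have := (hu.isNoise hv).clm (WithLp.fstL 2 ℝ (Vec p) (Vec q)) (r := 1) (fun a => by
    have := WithLp.prod_norm_sq_eq_of_L2 a
    rw [one_mul]
    refine le_of_sq_le_sq ?_ (norm_nonneg _)
    rw [this]
    simp)
  simpa [fullGrad] using this

lemma isNoise_gradY {Θ : Type*} [MeasurableSpace Θ] {ν : Measure Θ} [IsProbabilityMeasure ν]
    {H : Θ → Vec p → Vec q → ℝ} {h : Vec p → Vec q → ℝ} {x : Vec p} {y : Vec q} {s : ℝ}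
    (hu : Unbiased ν (fun θ => fullGrad (H θ) x y) (fullGrad h x y))
    (hv : VarLe ν (fun θ => fullGrad (H θ) x y) (fullGrad h x y) s) :
    IsNoise ν (fun θ => gradY (H θ) x y - gradY h x y) (s ^ 2) := by
  have := (hu.isNoise hv).clm (WithLp.sndL 2 ℝ (Vec p) (Vec q)) (r := 1) (fun a => by
    have := WithLp.prod_norm_sq_eq_of_L2 a
    rw [one_mul]
    refine le_of_sq_le_sq ?_ (norm_nonneg _)
    rw [this]
    simp)
  simpa [fullGrad] using this

lemma isNoise_apply {n m : ℕ} {Θ : Type*} [MeasurableSpace Θ] {ν : Measure Θ}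
    [IsProbabilityMeasure ν] {A : Θ → Vec n →L[ℝ] Vec m} {a : Vec n →L[ℝ] Vec m} {s : ℝ}
    (hu : Unbiased ν A a) (hv : VarLe ν A a s) (v : Vec n) :
    IsNoise ν (fun θ => A θ v - a v) (‖v‖ ^ 2 * s ^ 2) :=
  (hu.isNoise hv).clm (ContinuousLinearMap.apply ℝ (Vec m) v) (fun T => by
    rw [mul_comm]; exact T.le_opNorm v)

lemma isNoise_Dy {π : Measure (Ξ × Z)} (hB : B.Assumptions c.toConsts)
    (h2 : π.map Prod.snd = B.lawG) (x : Vec p) (y : Vec q) :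
    IsNoise π (fun s => B.Dy s x y - gradY B.g x y) (c.sg ^ 2) := by
  have := hB.wellPosed.probG
  have h4 := isNoise_gradY (hB.stochastic.unbiased_G x y) (hB.stochastic.var_G x y)
  rw [← h2] at h4
  exact h4.comp_map measurable_snd

variable {π : Measure (Ξ × Z)} [IsProbabilityMeasure π]

lemma isNoise_Dx (hB : B.Assumptions c.toConsts) (h1 : π.map Prod.fst = B.lawF)
    (h2 : π.map Prod.snd = B.lawG) (x : Vec p) (y v : Vec q) :
    IsNoise π (fun s => B.Dx s x y v - B.dx x y v)
      (2 * c.sf ^ 2 + 2 * (‖v‖ ^ 2 * c.sgxy ^ 2)) := by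
  have := hB.wellPosed.probF
  have := hB.wellPosed.probG
  have h3 := isNoise_gradX (hB.stochastic.unbiased_F x y) (hB.stochastic.var_F x y)
  have h4 := isNoise_apply (hB.stochastic.unbiased_jac x y) (hB.stochastic.var_jac x y) v
  rw [← h1] at h3
  rw [← h2] at h4
  have := (h3.comp_map measurable_fst).sub (h4.comp_map measurable_snd)
  refine ⟨?_, ?_, ?_⟩
  · convert! this.memLp using 2
    simp only [Bilevel.Dx, Bilevel.dx]; abel
  · convert! this.mean using 3
    simp only [Bilevel.Dx, Bilevel.dx]; abel
  · convert! this.var using 5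
    simp only [Bilevel.Dx, Bilevel.dx]; abel

lemma isNoise_Dv (hB : B.Assumptions c.toConsts) (h1 : π.map Prod.fst = B.lawF)
    (h2 : π.map Prod.snd = B.lawG) (x : Vec p) (y v : Vec q) :
    IsNoise π (fun s => B.Dv s x y v - B.dv x y v)
      (2 * (‖v‖ ^ 2 * c.sgyy ^ 2) + 2 * c.sf ^ 2) := by
  have := hB.wellPosed.probF
  have := hB.wellPosed.probG
  have h3 := isNoise_gradY (hB.stochastic.unbiased_F x y) (hB.stochastic.var_F x y)
  have h4 := isNoise_apply (hB.stochastic.unbiased_hess x y) (hB.stochastic.var_hess x y) v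
  rw [← h1] at h3
  rw [← h2] at h4
  have := (h4.comp_map measurable_snd).sub (h3.comp_map measurable_fst)
  refine ⟨?_, ?_, ?_⟩
  · convert! this.memLp using 2
    simp only [Bilevel.Dv, Bilevel.dv]; abel
  · convert! this.mean using 3
    simp only [Bilevel.Dv, Bilevel.dv]; abel
  · convert! this.var using 5
    simp only [Bilevel.Dv, Bilevel.dv]; abel

lemma sq_norm_Dy_sub_le (hB : B.Assumptions c.toConsts) (s : Ξ × Z) (x x' : Vec p) (y y' : Vec q) :
    ‖B.Dy s x y - B.Dy s x' y'‖ ^ 2 ≤ c.Lg ^ 2 * (‖x - x'‖ ^ 2 + ‖y - y'‖ ^ 2) := by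
  have h1 := (hB.lower_G s.2).lip_grad.gradY x x' y y'
  have h2 := pow_le_pow_left₀ (norm_nonneg _) h1 2
  rwa [mul_pow, Real.sq_sqrt (by positivity)] at h2

lemma sq_add_mul_le (hc : c.Valid) {l t r w : ℝ} (hl : 0 ≤ l) (hl' : l ≤ c.Lgg) (ht : 0 ≤ t)
    (ht' : t ≤ c.M) :
    ((c.Lf + l * t) * r + c.Lg * w) ^ 2 ≤ c.M1 * r ^ 2 + 2 * c.Lg ^ 2 * w ^ 2 := by
  have h16 := two_mul_sq_le_M1 hc hl hl' ht ht'
  have h18 := mul_le_mul_of_nonneg_right h16 (sq_nonneg r)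
  nlinarith [sq_nonneg ((c.Lf + l * t) * r - c.Lg * w)]

/-- The Jacobian difference is applied to `v'` and the Jacobian itself to `v - v'`, so only `v'` has
to lie in the ball. -/
lemma sq_norm_Dx_sub_le (hc : c.Valid) (hB : B.Assumptions c.toConsts) (s : Ξ × Z)
    (x x' : Vec p) (y y' v v' : Vec q) (hv' : ‖v'‖ ≤ c.M) :
    ‖B.Dx s x y v - B.Dx s x' y' v'‖ ^ 2 ≤
      c.M1 * (‖x - x'‖ ^ 2 + ‖y - y'‖ ^ 2) + 2 * c.Lg ^ 2 * ‖v - v'‖ ^ 2 := by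
  have h2 : B.Dx s x y v - B.Dx s x' y' v' =
      (gradX (B.F s.1) x y - gradX (B.F s.1) x' y') -
      (jacXY (B.G s.2) x y - jacXY (B.G s.2) x' y') v' -
      jacXY (B.G s.2) x y (v - v') := by
    simp only [Bilevel.Dx, map_sub, sub_apply]
    abel
  have h3 := (hB.upper_F s.1).lip_grad.gradX x x' y y'
  have h4 := (hB.lower_G s.2).lip_jac x x' y y'
  have h5 := (jacXY (B.G s.2) x y - jacXY (B.G s.2) x' y').le_of_opNorm_le h4 v'
  have h13 := (jacXY (B.G s.2) x y).le_of_opNorm_le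
    (norm_jacXY_le (hB.regular.contDiff_G s.2) hc.consts.Lg_nonneg (hB.lower_G s.2).lip_grad x y)
    (v - v')
  have h10 := norm_sub_le (gradX (B.F s.1) x y - gradX (B.F s.1) x' y')
    ((jacXY (B.G s.2) x y - jacXY (B.G s.2) x' y') v')
  have h15 := norm_sub_le ((gradX (B.F s.1) x y - gradX (B.F s.1) x' y') -
      (jacXY (B.G s.2) x y - jacXY (B.G s.2) x' y') v') (jacXY (B.G s.2) x y (v - v'))
  have h17 : ‖B.Dx s x y v - B.Dx s x' y' v'‖ ≤ (c.Lf + c.Lgxy * ‖v'‖) *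
      Real.sqrt (‖x - x'‖ ^ 2 + ‖y - y'‖ ^ 2) + c.Lg * ‖v - v'‖ := by
    rw [h2]; linarith
  refine (pow_le_pow_left₀ (norm_nonneg _) h17 2).trans ?_
  refine (sq_add_mul_le hc hc.consts.Lgxy_nonneg (le_max_left _ _) (norm_nonneg v') hv').trans ?_
  rw [Real.sq_sqrt (by positivity)]

lemma sq_norm_Dv_sub_le (hc : c.Valid) (hB : B.Assumptions c.toConsts) (s : Ξ × Z)
    (x x' : Vec p) (y y' v v' : Vec q) (hv' : ‖v'‖ ≤ c.M) :
    ‖B.Dv s x y v - B.Dv s x' y' v'‖ ^ 2 ≤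
      c.M1 * (‖x - x'‖ ^ 2 + ‖y - y'‖ ^ 2) + 2 * c.Lg ^ 2 * ‖v - v'‖ ^ 2 := by
  have h2 : B.Dv s x y v - B.Dv s x' y' v' =
      (hessY (B.G s.2) x y - hessY (B.G s.2) x' y') v' -
      (gradY (B.F s.1) x y - gradY (B.F s.1) x' y') +
      hessY (B.G s.2) x y (v - v') := by
    simp only [Bilevel.Dv, map_sub, sub_apply]
    abel
  have h3 := (hB.upper_F s.1).lip_grad.gradY x x' y y'
  have h4 := (hB.lower_G s.2).lip_hess x x' y y'
  have h5 := (hessY (B.G s.2) x y - hessY (B.G s.2) x' y').le_of_opNorm_le h4 v'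
  have h13 := (hessY (B.G s.2) x y).le_of_opNorm_le
    (norm_hessY_le (hB.regular.contDiff_G s.2) hc.consts.Lg_nonneg (hB.lower_G s.2).lip_grad x y)
    (v - v')
  have h10 := norm_sub_le ((hessY (B.G s.2) x y - hessY (B.G s.2) x' y') v')
    (gradY (B.F s.1) x y - gradY (B.F s.1) x' y')
  have h15 := norm_add_le ((hessY (B.G s.2) x y - hessY (B.G s.2) x' y') v' -
      (gradY (B.F s.1) x y - gradY (B.F s.1) x' y')) (hessY (B.G s.2) x y (v - v'))
  have h17 : ‖B.Dv s x y v - B.Dv s x' y' v'‖ ≤ (c.Lf + c.Lgyy * ‖v'‖) *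
      Real.sqrt (‖x - x'‖ ^ 2 + ‖y - y'‖ ^ 2) + c.Lg * ‖v - v'‖ := by
    rw [h2]; linarith
  refine (pow_le_pow_left₀ (norm_nonneg _) h17 2).trans ?_
  refine (sq_add_mul_le hc hc.consts.Lgyy_nonneg (le_max_right _ _) (norm_nonneg v') hv').trans ?_
  rw [Real.sq_sqrt (by positivity)]

end Oracles

end ALS

end

noncomputable section

namespace ALS

/-! ### Adding one noise that is centered given the past -/

section OneSample

variable {Ω 𝒴 𝒮 E : Type*} [MeasurableSpace Ω] [MeasurableSpace 𝒴] [MeasurableSpace 𝒮]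
  [NormedAddCommGroup E] [InnerProductSpace ℝ E] [CompleteSpace E] [MeasurableSpace E]
  [BorelSpace E] [SecondCountableTopology E] {P : Measure Ω} [IsProbabilityMeasure P]

/-- Adding to a function `w` of the past a noise that is centered given the past. -/
lemma memLp_add_noise {Y : Ω → 𝒴} {s : Ω → 𝒮} (hY : Measurable Y) (hs : Measurable s)
    (hind : IndepFun Y s P) {w : 𝒴 → E} (hw : Measurable w) {ψ : 𝒴 → 𝒮 → E}
    (hψ : Measurable (Function.uncurry ψ)) {b : 𝒴 → ℝ}
    (hn : ∀ y, IsNoise (P.map s) (ψ y) (b y))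
    (hw2 : MemLp (fun ω => w (Y ω)) 2 P) (hb2 : Integrable (fun ω => b (Y ω)) P) :
    MemLp (fun ω => w (Y ω) + ψ (Y ω) (s ω)) 2 P ∧
      ∫ ω, ‖w (Y ω) + ψ (Y ω) (s ω)‖ ^ 2 ∂P ≤ ∫ ω, ‖w (Y ω)‖ ^ 2 ∂P + ∫ ω, b (Y ω) ∂P := by
  have : IsProbabilityMeasure (P.map s) := Measure.isProbabilityMeasure_map hs.aemeasurable
  have hmeas : Measurable (fun z : 𝒴 × 𝒮 => w z.1 + ψ z.1 z.2) :=
    (hw.comp measurable_fst).add hψ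
  have hpair : Measurable fun ω => (Y ω, s ω) := hY.prodMk hs
  have hf : AEStronglyMeasurable (fun ω => w (Y ω) + ψ (Y ω) (s ω)) P :=
    (hmeas.comp hpair).aestronglyMeasurable
  have hb0 : ∀ y, 0 ≤ b y := fun y =>
    (integral_nonneg fun _ => sq_nonneg _).trans (hn y).var
  have hsum : Integrable (fun ω => ‖w (Y ω)‖ ^ 2 + b (Y ω)) P := hw2.integrable_sq_norm.add hb2
  have hmain : ∫⁻ ω, ENNReal.ofReal (‖w (Y ω) + ψ (Y ω) (s ω)‖ ^ 2) ∂P ≤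
      ENNReal.ofReal (∫ ω, (‖w (Y ω)‖ ^ 2 + b (Y ω)) ∂P) := by
    have hmeas2 : Measurable fun z : 𝒴 × 𝒮 => ENNReal.ofReal (‖w z.1 + ψ z.1 z.2‖ ^ 2) :=
      (hmeas.norm.pow_const 2).ennreal_ofReal
    -- By independence the joint law of past and sample is a product, so the past can be frozen.
    -- Lower integrals are used because integrability of the sum is part of the claim.
    rw [← lintegral_map (g := fun ω => (Y ω, s ω))
      (f := fun z : 𝒴 × 𝒮 => ENNReal.ofReal (‖w z.1 + ψ z.1 z.2‖ ^ 2)) hmeas2 hpair,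
      (indepFun_iff_map_prod_eq_prod_map_map hY.aemeasurable hs.aemeasurable).1 hind,
      lintegral_prod _ hmeas2.aemeasurable, lintegral_map hmeas2.lintegral_prod_right' hY,
      ofReal_integral_eq_lintegral_ofReal hsum
        (Filter.Eventually.of_forall fun ω => add_nonneg (sq_nonneg _) (hb0 _))]
    refine lintegral_mono fun ω => ?_
    set y := Y ω
    have h1 := hn y
    have h2 : MemLp (fun t => w y + ψ y t) 2 (P.map s) := (memLp_const (w y)).add h1.memLp
    rw [← ofReal_integral_eq_lintegral_ofReal h2.integrable_sq_norm
      (Filter.Eventually.of_forall fun _ => sq_nonneg _)]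
    refine ENNReal.ofReal_le_ofReal ?_
    have hi : Integrable (ψ y) (P.map s) := h1.memLp.integrable (by norm_num)
    have hin : Integrable (fun t => 2 * inner ℝ (w y) (ψ y t)) (P.map s) :=
      (hi.const_inner (w y)).const_mul 2
    have h3 : ∀ t, ‖w y + ψ y t‖ ^ 2 =
        (‖w y‖ ^ 2 + 2 * inner ℝ (w y) (ψ y t)) + ‖ψ y t‖ ^ 2 := fun t => norm_add_sq_real _ _
    simp_rw [h3]
    have h4 : Integrable (fun t => ‖w y‖ ^ 2 + 2 * inner ℝ (w y) (ψ y t)) (P.map s) :=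
      (integrable_const _).add hin
    -- The cross term vanishes because the noise is centered for every frozen value of the past.
    rw [integral_add h4 h1.memLp.integrable_sq_norm, integral_add (integrable_const _) hin,
      integral_const_mul, integral_inner hi, h1.mean]
    simp
    exact h1.var
  obtain ⟨h5, h6⟩ := integral_sq_norm_le_of_lintegral hf
    (integral_nonneg fun ω => add_nonneg (sq_nonneg _) (hb0 _)) hmain
  exact ⟨h5, h6.trans_eq (integral_add hw2.integrable_sq_norm hb2)⟩

end OneSample

/-! ### Batches, and the recursion for a momentum estimator -/

section Sampling

variable {p q : ℕ} {Ξ Z Ω : Type*} [MeasurableSpace Ξ] [MeasurableSpace Z]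

/-- The information carried by the samples at the slots in `A`. -/
@[reducible]
def sigmaOf (X : Slot → Ω → Ξ × Z) (A : Set Slot) : MeasurableSpace Ω :=
  ⨆ s ∈ A, MeasurableSpace.comap (X s) inferInstance

variable {X : Slot → Ω → Ξ × Z}

lemma measurable_sigmaOf {A : Set Slot} {s : Slot} (hs : s ∈ A) :
    Measurable[sigmaOf X A] (X s) := by
  rw [measurable_iff_comap_le]
  exact le_iSup₂_of_le s hs le_rfl

lemma sigmaOf_mono {A A' : Set Slot} (h : A ⊆ A') : sigmaOf X A ≤ sigmaOf X A' :=
  biSup_mono h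

lemma Bilevel.IsSampling.sigmaOf_le [mΩ : MeasurableSpace Ω] {B : Bilevel p q Ξ Z} {P : Measure Ω}
    (hX : B.IsSampling P X) (A : Set Slot) : sigmaOf X A ≤ mΩ :=
  iSup₂_le fun s _ => measurable_iff_comap_le.1 (hX.meas s)

/-- The past is encoded as the identity map into Ω with the smaller σ-algebra of the used slots. Any
quantity measurable for that σ-algebra can then play the role of a function of the past. -/
lemma Bilevel.IsSampling.indepFun [mΩ : MeasurableSpace Ω] {B : Bilevel p q Ξ Z} {P : Measure Ω}
    (hX : B.IsSampling P X) {A : Set Slot} {s : Slot} (hs : s ∉ A) :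
    @IndepFun Ω Ω (Ξ × Z) mΩ (sigmaOf X A) inferInstance id (X s) P := by
  have h1 := indep_iSup_of_disjoint (fun s => measurable_iff_comap_le.1 (hX.meas s))
    ((iIndepFun_iff_iIndep _ _ _).1 hX.indep) (Set.disjoint_singleton_right.2 hs)
  simp only [Set.mem_singleton_iff, iSup_iSup_eq_left] at h1
  refine (IndepFun_iff_Indep (mβ := sigmaOf X A) _ _ _).2 ?_
  rwa [MeasurableSpace.comap_id]

lemma Measurable.apply_sample {m m' : MeasurableSpace Ω} (h : m ≤ m') {𝒮 E : Type*}
    [MeasurableSpace 𝒮] [MeasurableSpace E] {ψ : Ω → 𝒮 → E} {s : Ω → 𝒮}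
    (hψ : @Measurable (Ω × 𝒮) E (m.prod inferInstance) inferInstance (Function.uncurry ψ))
    (hs : Measurable[m'] s) : Measurable[m'] fun ω => ψ ω (s ω) := by
  have h1 : @Measurable Ω (Ω × 𝒮) m' (m.prod inferInstance) (fun ω => (ω, s ω)) :=
    Measurable.prodMk (measurable_id'' h) hs
  exact hψ.comp h1

variable [mΩ : MeasurableSpace Ω] {B : Bilevel p q Ξ Z} {P : Measure Ω} [IsProbabilityMeasure P]

/-- Averaging independent centered noises over a batch divides their second moment by its size. -/
lemma memLp_add_batch (hX : B.IsSampling P X) {A : Set Slot} {σ : ℕ → Slot}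
    (hσ : Function.Injective σ) (hA : ∀ i, σ i ∉ A) {n : ℕ} {w : Ω → Vec n}
    (hw : Measurable[sigmaOf X A] w) {ψ : Ω → Ξ × Z → Vec n}
    (hψ : @Measurable (Ω × (Ξ × Z)) (Vec n) ((sigmaOf X A).prod inferInstance) inferInstance
      (Function.uncurry ψ)) {b : Ω → ℝ}
    (hn : ∀ ω i, IsNoise (P.map (X (σ i))) (ψ ω) (b ω)) (hw2 : MemLp w 2 P)
    (hb2 : Integrable b P) {S : ℕ} (hS : 0 < S) :
    MemLp (fun ω => w ω + (S : ℝ)⁻¹ • ∑ i ∈ Finset.range S, ψ ω (X (σ i) ω)) 2 P ∧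
      ∫ ω, ‖w ω + (S : ℝ)⁻¹ • ∑ i ∈ Finset.range S, ψ ω (X (σ i) ω)‖ ^ 2 ∂P ≤
        ∫ ω, ‖w ω‖ ^ 2 ∂P + (∫ ω, b ω ∂P) / S := by
  set r : ℝ := (S : ℝ)⁻¹
  -- The batch is revealed one sample at a time: the first `m` samples join the past, and sample `m`
  -- is independent of it, so each sample adds at most its own second moment.
  set As : ℕ → Set Slot := fun m => A ∪ σ '' Set.Iio m
  have hAs : ∀ m, A ⊆ As m := fun m => Set.subset_union_left
  have key : ∀ m : ℕ, Measurable[sigmaOf X (As m)]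
        (fun ω => w ω + r • ∑ i ∈ Finset.range m, ψ ω (X (σ i) ω)) ∧
      MemLp (fun ω => w ω + r • ∑ i ∈ Finset.range m, ψ ω (X (σ i) ω)) 2 P ∧
      ∫ ω, ‖w ω + r • ∑ i ∈ Finset.range m, ψ ω (X (σ i) ω)‖ ^ 2 ∂P ≤
        ∫ ω, ‖w ω‖ ^ 2 ∂P + m * (r ^ 2 * ∫ ω, b ω ∂P) := by
    intro m
    induction m with
    | zero =>
      refine ⟨?_, ?_, ?_⟩
      · simpa using hw.mono (sigmaOf_mono (hAs 0)) le_rfl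
      · simpa using hw2
      · simp
    | succ m ih =>
      obtain ⟨ih1, ih2, ih3⟩ := ih
      set W := fun ω => w ω + r • ∑ i ∈ Finset.range m, ψ ω (X (σ i) ω)
      have hW : ∀ ω, w ω + r • ∑ i ∈ Finset.range (m + 1), ψ ω (X (σ i) ω) =
          W ω + r • ψ ω (X (σ m) ω) := by
        intro ω
        simp only [W, Finset.sum_range_succ, smul_add, add_assoc]
      have hnot : σ m ∉ As m := by
        rintro (h | ⟨i, hi, h⟩)
        · exact hA m h
        · exact (ne_of_lt hi) (hσ h)
      have hmem : σ m ∈ As (m + 1) := Or.inr ⟨m, Nat.lt_succ_self m, rfl⟩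
      have hsub : As m ⊆ As (m + 1) :=
        Set.union_subset_union_right A (Set.image_mono (Set.Iio_subset_Iio (Nat.le_succ m)))
      have hψ' : @Measurable (Ω × (Ξ × Z)) (Vec n) ((sigmaOf X (As m)).prod inferInstance)
          inferInstance (Function.uncurry fun ω s => r • ψ ω s) := by
        have h1 : (sigmaOf X A).prod (inferInstance : MeasurableSpace (Ξ × Z)) ≤
            (sigmaOf X (As m)).prod inferInstance :=
          sup_le_sup (MeasurableSpace.comap_mono (sigmaOf_mono (hAs m))) le_rfl
        exact (hψ.mono h1 le_rfl).const_smul r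
      obtain ⟨h2, h3⟩ := @memLp_add_noise Ω Ω (Ξ × Z) (Vec n) mΩ (sigmaOf X (As m)) inferInstance
        inferInstance inferInstance inferInstance inferInstance inferInstance inferInstance P
        inferInstance id (X (σ m)) (measurable_id'' (hX.sigmaOf_le _)) (hX.meas _)
        (hX.indepFun hnot) W ih1 (fun ω s => r • ψ ω s) hψ' (fun ω => r ^ 2 * b ω)
        (fun ω => (hn ω m).smul r) ih2 (hb2.const_mul _)
      simp_rw [hW]
      refine ⟨?_, h2, ?_⟩
      · refine (ih1.mono (sigmaOf_mono hsub) le_rfl).add ?_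
        exact (Measurable.apply_sample (sigmaOf_mono (hAs (m + 1))) hψ
          (measurable_sigmaOf hmem)).const_smul r
      · refine h3.trans ?_
        simp only [id]
        rw [integral_const_mul]
        push_cast
        linarith
  obtain ⟨-, h1, h2⟩ := key S
  refine ⟨h1, h2.trans_eq ?_⟩
  have : (S : ℝ) ≠ 0 := by positivity
  simp only [r]
  field_simp

/-- The error of a recursive momentum estimator after one update. -/
lemma memLp_momentum_update (hX : B.IsSampling P X) {A : Set Slot} {σ : ℕ → Slot}
    (hσ : Function.Injective σ) (hA : ∀ i, σ i ∉ A) {n : ℕ} {Θ : Type*} [MeasurableSpace Θ]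
    {D : Ξ × Z → Θ → Vec n} {d : Θ → Vec n}
    (hD : Measurable fun z : (Ξ × Z) × Θ => D z.1 z.2) (hd : Measurable d)
    {θ θ' : Ω → Θ} (hθ : Measurable[sigmaOf X A] θ) (hθ' : Measurable[sigmaOf X A] θ')
    {D₀ : Ω → Vec n} (hD₀ : Measurable[sigmaOf X A] D₀) {τ V : ℝ} (hτ0 : 0 ≤ τ) (hτ1 : τ ≤ 1)
    (hV : ∀ ω i, IsNoise (P.map (X (σ i))) (fun s => D s (θ ω) - d (θ ω)) V)
    (hV' : ∀ ω i, IsNoise (P.map (X (σ i))) (fun s => D s (θ' ω) - d (θ' ω)) V)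
    {l : Ω → ℝ} (hl : ∀ ω s, ‖D s (θ' ω) - D s (θ ω)‖ ^ 2 ≤ l ω) (hl2 : Integrable l P)
    (he : MemLp (fun ω => D₀ ω - d (θ ω)) 2 P) {S : ℕ} (hS : 0 < S) :
    MemLp (fun ω => batch S (fun i => X (σ i) ω) (fun s => D s (θ' ω)) +
        (1 - τ) • (D₀ ω - batch S (fun i => X (σ i) ω) (fun s => D s (θ ω))) - d (θ' ω)) 2 P ∧
      ∫ ω, ‖batch S (fun i => X (σ i) ω) (fun s => D s (θ' ω)) +
        (1 - τ) • (D₀ ω - batch S (fun i => X (σ i) ω) (fun s => D s (θ ω))) - d (θ' ω)‖ ^ 2 ∂P ≤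
        (1 - τ) * ∫ ω, ‖D₀ ω - d (θ ω)‖ ^ 2 ∂P + (2 * τ ^ 2 * V + 2 * ∫ ω, l ω ∂P) / S := by
  have hprob : ∀ i, IsProbabilityMeasure (P.map (X (σ i))) := fun i =>
    Measure.isProbabilityMeasure_map (hX.meas _).aemeasurable
  -- The new error is (1 − τ) times the old error plus the batch average of ψ.
  set ψ : Ω → Ξ × Z → Vec n := fun ω s =>
    (D s (θ' ω) - d (θ' ω)) - (1 - τ) • (D s (θ ω) - d (θ ω))
  have hψ : @Measurable (Ω × (Ξ × Z)) (Vec n) ((sigmaOf X A).prod inferInstance) inferInstance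
      (Function.uncurry ψ) := by
    let _ : MeasurableSpace Ω := sigmaOf X A
    have h1 : Measurable fun z : Ω × (Ξ × Z) => D z.2 (θ' z.1) - d (θ' z.1) :=
      (hD.comp (measurable_snd.prodMk (hθ'.comp measurable_fst))).sub
        (hd.comp (hθ'.comp measurable_fst))
    have h2 : Measurable fun z : Ω × (Ξ × Z) => D z.2 (θ z.1) - d (θ z.1) :=
      (hD.comp (measurable_snd.prodMk (hθ.comp measurable_fst))).sub
        (hd.comp (hθ.comp measurable_fst))
    exact h1.sub (h2.const_smul (1 - τ))
  have hw : Measurable[sigmaOf X A] fun ω => (1 - τ) • (D₀ ω - d (θ ω)) :=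
    (hD₀.sub (hd.comp hθ)).const_smul (1 - τ)
  have hn : ∀ ω i, IsNoise (P.map (X (σ i))) (ψ ω) (2 * τ ^ 2 * V + 2 * l ω) := by
    intro ω i
    have h1 := (hV' ω i).sub (hV ω i)
    -- The same sample is evaluated at both points, so this part of ψ scales with the displacement
    -- and not with the noise level `V`. Only the remaining part carries `V`, multiplied by τ.
    have h2 : IsNoise (P.map (X (σ i)))
        (fun s => (D s (θ' ω) - D s (θ ω)) - (d (θ' ω) - d (θ ω))) (l ω) := by
      refine IsNoise.of_bound (V := 2 * V + 2 * V) ?_ (hl ω)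
      have h3 : (fun s => (D s (θ' ω) - D s (θ ω)) - (d (θ' ω) - d (θ ω))) =
        fun s => (D s (θ' ω) - d (θ' ω)) - (D s (θ ω) - d (θ ω)) := by
        ext1 s; abel
      rw [h3]; exact h1
    have h4 := ((hV' ω i).smul τ).add (h2.smul (1 - τ))
    have h5 : ψ ω = fun s => τ • (D s (θ' ω) - d (θ' ω)) +
        (1 - τ) • ((D s (θ' ω) - D s (θ ω)) - (d (θ' ω) - d (θ ω))) := by
      ext1 s; simp only [ψ]; module
    rw [h5]
    refine h4.mono ?_
    have h6 : 0 ≤ l ω := (integral_nonneg fun _ => sq_nonneg _).trans h2.var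
    have h7 : (1 - τ) ^ 2 * l ω ≤ 1 * l ω :=
      mul_le_mul_of_nonneg_right (pow_le_one₀ (by linarith) (by linarith)) h6
    linarith
  obtain ⟨h1, h2⟩ := memLp_add_batch hX hσ hA hw hψ hn (he.const_smul (1 - τ))
    ((integrable_const _).add (hl2.const_mul 2)) hS
  have hSne : (S : ℝ) ≠ 0 := by positivity
  have heq : ∀ ω, (1 - τ) • (D₀ ω - d (θ ω)) +
      (S : ℝ)⁻¹ • ∑ i ∈ Finset.range S, ψ ω (X (σ i) ω) =
      batch S (fun i => X (σ i) ω) (fun s => D s (θ' ω)) +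
        (1 - τ) • (D₀ ω - batch S (fun i => X (σ i) ω) (fun s => D s (θ ω))) - d (θ' ω) := by
    intro ω
    simp only [ψ, batch, Finset.sum_sub_distrib, ← Finset.smul_sum, Finset.sum_const,
      Finset.card_range, ← Nat.cast_smul_eq_nsmul ℝ, smul_sub, smul_smul, inv_mul_cancel₀ hSne,
      one_smul]
    rw [mul_left_comm, inv_mul_cancel₀ hSne, mul_one, mul_comm (S : ℝ)⁻¹]
    abel
  simp_rw [heq] at h1 h2
  refine ⟨h1, h2.trans ?_⟩
  -- This uses (1 − τ)² ≤ 1 − τ for 0 ≤ τ ≤ 1.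
  have h3 : ∫ ω, ‖(1 - τ) • (D₀ ω - d (θ ω))‖ ^ 2 ∂P ≤
      (1 - τ) * ∫ ω, ‖D₀ ω - d (θ ω)‖ ^ 2 ∂P := by
    simp_rw [norm_smul, mul_pow, Real.norm_eq_abs, sq_abs]
    rw [integral_const_mul]
    refine mul_le_mul_of_nonneg_right ?_ (integral_nonneg fun _ => sq_nonneg _)
    nlinarith
  rw [integral_add (integrable_const _) (hl2.const_mul 2), integral_const_mul 2]
  simp only [integral_const, probReal_univ, smul_eq_mul, one_mul]
  exact add_le_add_left h3 _

/-- The error of an average over a batch drawn at a deterministic point. -/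
lemma memLp_batch_sub (hX : B.IsSampling P X) {σ : ℕ → Slot} (hσ : Function.Injective σ) {n : ℕ}
    {D : Ξ × Z → Vec n} {d : Vec n} (hD : Measurable D) {V : ℝ}
    (hV : ∀ i, IsNoise (P.map (X (σ i))) (fun s => D s - d) V) {S : ℕ} (hS : 0 < S) :
    MemLp (fun ω => batch S (fun i => X (σ i) ω) D - d) 2 P ∧
      ∫ ω, ‖batch S (fun i => X (σ i) ω) D - d‖ ^ 2 ∂P ≤ V / S := by
  have hψ : @Measurable (Ω × (Ξ × Z)) (Vec n) ((sigmaOf X ∅).prod inferInstance) inferInstance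
      (Function.uncurry fun (_ : Ω) s => D s - d) := by
    let _ : MeasurableSpace Ω := sigmaOf X ∅
    exact (hD.comp measurable_snd).sub measurable_const
  obtain ⟨h1, h2⟩ := memLp_add_batch hX hσ (A := ∅) (fun i => Set.notMem_empty _)
    (w := fun _ => (0 : Vec n)) measurable_const hψ (b := fun _ => V) (fun _ i => hV i)
    (memLp_const 0) (integrable_const V) hS
  have hSne : (S : ℝ) ≠ 0 := by positivity
  have heq : ∀ ω, (0 : Vec n) + (S : ℝ)⁻¹ • ∑ i ∈ Finset.range S, (D (X (σ i) ω) - d) =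
      batch S (fun i => X (σ i) ω) D - d := by
    intro ω
    simp only [batch, Finset.sum_sub_distrib, Finset.sum_const,
      Finset.card_range, ← Nat.cast_smul_eq_nsmul ℝ, smul_sub, smul_smul, inv_mul_cancel₀ hSne,
      one_smul, zero_add]
  simp_rw [heq] at h1 h2
  refine ⟨h1, h2.trans ?_⟩
  simp

end Sampling

end ALS

end

noncomputable section

namespace ALS

/-! ### Projection onto the ball -/

section Projection

variable {q : ℕ} {M : ℝ}

lemma norm_projBall_le (hM : 0 ≤ M) (a : Vec q) : ‖projBall M a‖ ≤ M := by
  unfold projBall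
  split_ifs with h
  · exact h
  · have ha : 0 < ‖a‖ := hM.trans_lt (not_le.1 h)
    rw [norm_smul, Real.norm_eq_abs, abs_of_nonneg (by positivity), div_mul_cancel₀ _ ha.ne']

/-- If a lies outside the ball, a − Pa has nonnegative inner product with Pa − b for every b in the
ball. Expanding ‖a − b‖² around Pa then gives the bound. -/
lemma norm_projBall_sub_le (hM : 0 ≤ M) (a : Vec q) {b : Vec q} (hb : ‖b‖ ≤ M) :
    ‖projBall M a - b‖ ≤ ‖a - b‖ := by
  unfold projBall
  split_ifs with h
  · exact le_rfl
  · have ha : 0 < ‖a‖ := hM.trans_lt (not_le.1 h)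
    have h1 : 0 ≤ 1 - M / ‖a‖ := by
      rw [sub_nonneg, div_le_one ha]; exact (not_le.1 h).le
    have h2 : inner ℝ a b ≤ ‖a‖ * M :=
      (real_inner_le_norm a b).trans (mul_le_mul_of_nonneg_left hb ha.le)
    have h3 : a - b = (a - (M / ‖a‖) • a) + ((M / ‖a‖) • a - b) := by abel
    have h4 := norm_add_sq_real (a - (M / ‖a‖) • a) ((M / ‖a‖) • a - b)
    rw [← h3] at h4
    have h5 : inner ℝ (a - (M / ‖a‖) • a) ((M / ‖a‖) • a - b) =
        (1 - M / ‖a‖) * (‖a‖ * M - inner ℝ a b) := by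
      have : a - (M / ‖a‖) • a = (1 - M / ‖a‖) • a := by module
      rw [this, inner_smul_left, inner_sub_right, inner_smul_right, real_inner_self_eq_norm_sq]
      simp only [conj_trivial]
      field_simp
    have h6 : 0 ≤ (1 - M / ‖a‖) * (‖a‖ * M - inner ℝ a b) := mul_nonneg h1 (by linarith)
    refine le_of_sq_le_sq ?_ (norm_nonneg _)
    nlinarith [sq_nonneg ‖a - (M / ‖a‖) • a‖]

lemma measurable_projBall (M : ℝ) : Measurable (projBall M : Vec q → Vec q) := by
  unfold projBall
  refine Measurable.ite (measurableSet_le measurable_norm measurable_const) measurable_id ?_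
  exact (measurable_const.div measurable_norm).smul measurable_id

end Projection

/-! ### The iteration without restarts, and its cost -/

section Chain

variable {p q : ℕ} {Ξ Z : Type*} [MeasurableSpace Ξ] [MeasurableSpace Z]

/-- One outer iteration without recomputation of the estimators. -/
def Bilevel.advance (B : Bilevel p q Ξ Z) (P : Params) (ω : Slot → Ξ × Z) (k : ℕ)
    (st : OuterState p q) : OuterState p q :=
  let xn := st.x - P.alpha • st.Dx
  let a := B.loopY P ω k xn ⟨st.x, st.y, st.Dy, st.cost⟩ P.T
  let b := B.loopV P ω k xn a.y ⟨st.x, st.y, st.v, st.Dx, st.Dv, a.cost⟩ P.J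
  ⟨xn, a.y, b.v, b.Dx, a.D, b.Dv, b.cost⟩

/-- The outer states with initialized estimators that are never recomputed afterwards. -/
def Bilevel.chain (B : Bilevel p q Ξ Z) (P : Params) (x0 : Vec p) (y0 v0 : Vec q)
    (ω : Slot → Ξ × Z) : ℕ → OuterState p q
  | 0 => B.refresh P ω 0 (B.run P x0 y0 v0 ω 0)
  | k + 1 => B.advance P ω k (B.chain P x0 y0 v0 ω k)

/-- The point `x_{k+1}`. -/
def Bilevel.xnext (B : Bilevel p q Ξ Z) (P : Params) (x0 : Vec p) (y0 v0 : Vec q)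
    (ω : Slot → Ξ × Z) (k : ℕ) : Vec p :=
  (B.chain P x0 y0 v0 ω k).x - P.alpha • (B.chain P x0 y0 v0 ω k).Dx

/-- The states of the inner loop on `y` along the chain. -/
def Bilevel.ySt (B : Bilevel p q Ξ Z) (P : Params) (x0 : Vec p) (y0 v0 : Vec q)
    (ω : Slot → Ξ × Z) (k t : ℕ) : YState p q :=
  B.loopY P ω k (B.xnext P x0 y0 v0 ω k) ⟨(B.chain P x0 y0 v0 ω k).x, (B.chain P x0 y0 v0 ω k).y,
    (B.chain P x0 y0 v0 ω k).Dy, (B.chain P x0 y0 v0 ω k).cost⟩ t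

/-- The states of the inner loop on `v` along the chain. -/
def Bilevel.vSt (B : Bilevel p q Ξ Z) (P : Params) (x0 : Vec p) (y0 v0 : Vec q)
    (ω : Slot → Ξ × Z) (k j : ℕ) : VState p q :=
  B.loopV P ω k (B.xnext P x0 y0 v0 ω k) (B.ySt P x0 y0 v0 ω k P.T).y
    ⟨(B.chain P x0 y0 v0 ω k).x, (B.chain P x0 y0 v0 ω k).y, (B.chain P x0 y0 v0 ω k).v,
    (B.chain P x0 y0 v0 ω k).Dx, (B.chain P x0 y0 v0 ω k).Dv, (B.ySt P x0 y0 v0 ω k P.T).cost⟩ j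

variable (B : Bilevel p q Ξ Z) (P : Params) (x0 : Vec p) (y0 v0 : Vec q) (ω : Slot → Ξ × Z)

lemma chain_succ (k : ℕ) : B.chain P x0 y0 v0 ω (k + 1) =
    ⟨B.xnext P x0 y0 v0 ω k, (B.ySt P x0 y0 v0 ω k P.T).y, (B.vSt P x0 y0 v0 ω k P.J).v,
      (B.vSt P x0 y0 v0 ω k P.J).Dx, (B.ySt P x0 y0 v0 ω k P.T).D,
      (B.vSt P x0 y0 v0 ω k P.J).Dv, (B.vSt P x0 y0 v0 ω k P.J).cost⟩ := rfl

lemma ySt_succ (k t : ℕ) : B.ySt P x0 y0 v0 ω k (t + 1) =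
    B.stepY P (B.xnext P x0 y0 v0 ω k) (fun i => ω (Slot.stepY k t i))
      (B.ySt P x0 y0 v0 ω k t) := rfl

/-- Among the indices below the period `q1`, only 0 is a multiple of it, so the estimators are
computed from large batches exactly once. -/
lemma refresh_run_eq_chain {k : ℕ} (hk : k < P.q1) :
    B.refresh P ω k (B.run P x0 y0 v0 ω k) = B.chain P x0 y0 v0 ω k := by
  induction k with
  | zero => rfl
  | succ k ih =>
    have h1 : (k + 1) % P.q1 ≠ 0 := by rw [Nat.mod_eq_of_lt hk]; omega
    have h2 : B.run P x0 y0 v0 ω (k + 1) =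
        B.advance P ω k (B.refresh P ω k (B.run P x0 y0 v0 ω k)) := rfl
    rw [Bilevel.refresh, if_neg h1, h2, ih (by omega)]
    rfl

lemma run_x_eq_chain_x {k : ℕ} (hk : k < P.q1) :
    (B.run P x0 y0 v0 ω k).x = (B.chain P x0 y0 v0 ω k).x := by
  rw [← refresh_run_eq_chain B P x0 y0 v0 ω hk, Bilevel.refresh]
  split_ifs <;> rfl

/-! ### The cost -/

lemma OracleCount.total_add (a b : OracleCount) : (a.add b).total = a.total + b.total := by
  simp only [OracleCount.add, OracleCount.total]; ring

lemma total_loopY (k : ℕ) (xn : Vec p) (init : YState p q) (t : ℕ) :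
    (B.loopY P ω k xn init t).cost.total = init.cost.total + 2 * P.S2 * t := by
  induction t with
  | zero => rfl
  | succ t ih =>
    simp only [Bilevel.loopY, Bilevel.stepY, OracleCount.total_add, ih]
    simp only [OracleCount.evalY, OracleCount.total]
    ring

lemma total_loopV (k : ℕ) (xn : Vec p) (yn : Vec q) (init : VState p q) (j : ℕ) :
    (B.loopV P ω k xn yn init j).cost.total = init.cost.total + 8 * P.S2 * j := by
  induction j with
  | zero => rfl
  | succ j ih =>
    simp only [Bilevel.loopV, Bilevel.stepV, OracleCount.total_add, ih]
    simp only [OracleCount.evalX, OracleCount.evalV, OracleCount.total]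
    ring

/-- An initial sample costs 2 + 1 + 2 evaluations. An inner step evaluates every direction at two
points: 2 per sample for y, and 4 + 4 for the two directions updated with v. -/
lemma total_chain (k : ℕ) : (B.chain P x0 y0 v0 ω k).cost.total =
    5 * P.S1 + k * (P.S2 * (2 * P.T + 8 * P.J)) := by
  induction k with
  | zero =>
    simp only [Bilevel.chain, Bilevel.refresh, Bilevel.run, Nat.zero_mod, if_true,
      OracleCount.total_add]
    simp only [OracleCount.evalX, OracleCount.evalV, OracleCount.evalY, OracleCount.zero,
      OracleCount.total]
    ring
  | succ k ih =>
    rw [chain_succ, Bilevel.vSt, total_loopV, Bilevel.ySt, total_loopY, ih]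
    ring

lemma total_run (hq : 0 < P.q1) : (B.run P x0 y0 v0 ω P.q1).cost.total =
    5 * P.S1 + P.q1 * (P.S2 * (2 * P.T + 8 * P.J)) := by
  obtain ⟨k, hk⟩ : ∃ k, P.q1 = k + 1 := ⟨P.q1 - 1, by omega⟩
  have h1 : B.run P x0 y0 v0 ω (k + 1) =
        B.advance P ω k (B.refresh P ω k (B.run P x0 y0 v0 ω k)) := rfl
  have h2 := total_chain B P x0 y0 v0 ω (k + 1)
  rw [hk, h1, refresh_run_eq_chain B P x0 y0 v0 ω (by omega)]
  exact h2

variable {B P x0 y0 v0 ω}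

/-- Every v is the output of a projection, except the starting vector and the copies of an earlier v
that open an inner loop. -/
lemma norm_vSt_le (hM : 0 ≤ P.M) (hv0 : ‖v0‖ ≤ P.M) (k j : ℕ) :
    ‖(B.vSt P x0 y0 v0 ω k j).v‖ ≤ P.M := by
  cases j with
  | succ j => exact norm_projBall_le hM _
  | zero =>
    induction k with
    | zero => exact hv0
    | succ k ih =>
      have : (B.vSt P x0 y0 v0 ω (k + 1) 0).v = (B.vSt P x0 y0 v0 ω k P.J).v := rfl
      rw [this]
      cases P.J with
      | zero => exact ih
      | succ j => exact norm_projBall_le hM _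

end Chain

/-! ### Measurability of the iterates in terms of the samples used -/

section Measurability

variable {p q : ℕ} {Ξ Z : Type*} [MeasurableSpace Ξ] [MeasurableSpace Z]

/-- All components of a random outer state are measurable. -/
structure MeasurableO {Ω : Type*} [mΩ : MeasurableSpace Ω] (st : Ω → OuterState p q) : Prop where
  x : Measurable fun ω => (st ω).x
  y : Measurable fun ω => (st ω).y
  v : Measurable fun ω => (st ω).v
  Dx : Measurable fun ω => (st ω).Dx
  Dy : Measurable fun ω => (st ω).Dy
  Dv : Measurable fun ω => (st ω).Dv

/-- All components of a random state of the inner loop on `y` are measurable. -/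
structure MeasurableY {Ω : Type*} [mΩ : MeasurableSpace Ω] (st : Ω → YState p q) : Prop where
  x : Measurable fun ω => (st ω).x
  y : Measurable fun ω => (st ω).y
  D : Measurable fun ω => (st ω).D

/-- All components of a random state of the inner loop on `v` are measurable. -/
structure MeasurableV {Ω : Type*} [mΩ : MeasurableSpace Ω] (st : Ω → VState p q) : Prop where
  x : Measurable fun ω => (st ω).x
  y : Measurable fun ω => (st ω).y
  v : Measurable fun ω => (st ω).v
  Dx : Measurable fun ω => (st ω).Dx
  Dv : Measurable fun ω => (st ω).Dv

variable {c : Setup} {B : Bilevel p q Ξ Z} {P : Params}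
variable {Ω : Type*} [mΩ : MeasurableSpace Ω]

lemma measurable_batch {n : ℕ} {Θ : Type*} [MeasurableSpace Θ] {D : Ξ × Z → Θ → Vec n}
    (hD : Measurable fun z : (Ξ × Z) × Θ => D z.1 z.2) {θ : Ω → Θ} (hθ : Measurable θ)
    {smp : ℕ → Ω → Ξ × Z} (hs : ∀ i, Measurable (smp i)) (S : ℕ) :
    Measurable fun ω => batch S (fun i => smp i ω) (fun s => D s (θ ω)) := by
  have h1 : Measurable fun ω => ∑ i ∈ Finset.range S, D (smp i ω) (θ ω) :=
    Finset.measurable_fun_sum _ fun i _ => hD.comp ((hs i).prodMk hθ)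
  exact h1.const_smul (S : ℝ)⁻¹

lemma measurable_sub_smul {n : ℕ} {f g : Ω → Vec n} (hf : Measurable f) (hg : Measurable g)
    (r : ℝ) : Measurable fun ω => f ω - r • g ω :=
  hf.sub (hg.const_smul r)

lemma MeasurableY.step (hB : B.Assumptions c.toConsts) {xn : Ω → Vec p} (hxn : Measurable xn)
    {smp : ℕ → Ω → Ξ × Z} (hs : ∀ i, Measurable (smp i)) {st : Ω → YState p q}
    (h : MeasurableY st) :
    MeasurableY fun ω => B.stepY P (xn ω) (fun i => smp i ω) (st ω) := by
  have hy : Measurable fun ω => (st ω).y - (P.lam1 * P.beta) • (st ω).D :=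
    measurable_sub_smul h.y h.D _
  refine ⟨hxn, hy, ?_⟩
  have h1 := measurable_batch (D := fun s (θ : Vec p × Vec q) => B.Dy s θ.1 θ.2)
    (measurable_Dy hB) (hxn.prodMk hy) hs P.S2
  have h2 := measurable_batch (D := fun s (θ : Vec p × Vec q) => B.Dy s θ.1 θ.2)
    (measurable_Dy hB) (h.x.prodMk h.y) hs P.S2
  exact h1.add ((h.D.sub h2).const_smul (1 - P.tauy))

lemma MeasurableV.step (hB : B.Assumptions c.toConsts) {xn : Ω → Vec p} (hxn : Measurable xn)
    {yn : Ω → Vec q} (hyn : Measurable yn) {smpX smpV : ℕ → Ω → Ξ × Z}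
    (hsX : ∀ i, Measurable (smpX i)) (hsV : ∀ i, Measurable (smpV i)) {st : Ω → VState p q}
    (h : MeasurableV st) :
    MeasurableV fun ω => B.stepV P (xn ω) (yn ω) (fun i => smpX i ω) (fun i => smpV i ω)
      (st ω) := by
  have hv : Measurable fun ω => projBall P.M ((st ω).v - (P.lam2 * P.eta) • (st ω).Dv) :=
    (measurable_projBall P.M).comp (measurable_sub_smul h.v h.Dv _)
  refine ⟨hxn, hyn, hv, ?_, ?_⟩
  · have h1 := measurable_batch
      (D := fun s (θ : Vec p × Vec q × Vec q) => B.Dx s θ.1 θ.2.1 θ.2.2)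
      (measurable_Dx hB) (hxn.prodMk (hyn.prodMk hv)) hsX P.S2
    have h2 := measurable_batch
      (D := fun s (θ : Vec p × Vec q × Vec q) => B.Dx s θ.1 θ.2.1 θ.2.2)
      (measurable_Dx hB) (h.x.prodMk (h.y.prodMk h.v)) hsX P.S2
    exact h1.add ((h.Dx.sub h2).const_smul (1 - P.taux))
  · have h1 := measurable_batch
      (D := fun s (θ : Vec p × Vec q × Vec q) => B.Dv s θ.1 θ.2.1 θ.2.2)
      (measurable_Dv hB) (hxn.prodMk (hyn.prodMk hv)) hsV P.S2
    have h2 := measurable_batch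
      (D := fun s (θ : Vec p × Vec q × Vec q) => B.Dv s θ.1 θ.2.1 θ.2.2)
      (measurable_Dv hB) (h.x.prodMk (h.y.prodMk h.v)) hsV P.S2
    exact h1.add ((h.Dv.sub h2).const_smul (1 - P.tauv))

/-- Slots used before inner iteration `t` on `y` of outer iteration `k`. -/
def slotsY (k t : ℕ) : Set Slot := {s | match s with
  | .initX _ _ => True
  | .initY _ _ => True
  | .initV _ _ => True
  | .stepY k' t' _ => k' < k ∨ (k' = k ∧ t' < t)
  | .stepX k' _ _ => k' < k
  | .stepV k' _ _ => k' < k}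

/-- Slots used before inner iteration `j` on `v` of outer iteration `k`. -/
def slotsV (k j : ℕ) : Set Slot := {s | match s with
  | .initX _ _ => True
  | .initY _ _ => True
  | .initV _ _ => True
  | .stepY k' _ _ => k' ≤ k
  | .stepX k' j' _ => k' < k ∨ (k' = k ∧ j' < j)
  | .stepV k' j' _ => k' < k ∨ (k' = k ∧ j' < j)}

lemma slotsY_mono (k : ℕ) {t t' : ℕ} (h : t ≤ t') : slotsY k t ⊆ slotsY k t' := by
  rintro (_ | _ | _ | _ | _ | _) hs <;> simp only [slotsY, Set.mem_ofPred_eq] at hs ⊢ <;> omega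

lemma slotsV_mono (k : ℕ) {j j' : ℕ} (h : j ≤ j') : slotsV k j ⊆ slotsV k j' := by
  rintro (_ | _ | _ | _ | _ | _) hs <;> simp only [slotsV, Set.mem_ofPred_eq] at hs ⊢ <;> omega

lemma slotsY_subset_slotsV (k t j : ℕ) : slotsY k t ⊆ slotsV k j := by
  rintro (_ | _ | _ | _ | _ | _) hs <;>
    simp only [slotsV, slotsY, Set.mem_ofPred_eq] at hs ⊢ <;> omega

lemma slotsV_subset_slotsY (k j : ℕ) : slotsV k j ⊆ slotsY (k + 1) 0 := by
  rintro (_ | _ | _ | _ | _ | _) hs <;>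
    simp only [slotsV, slotsY, Set.mem_ofPred_eq] at hs ⊢ <;> omega

variable {x0 : Vec p} {y0 v0 : Vec q} {X : Slot → Ω → Ξ × Z}

/-- The σ-algebra on Ω is arbitrary and only the slots already used must be measurable for it.
Taking the σ-algebra generated by these slots shows that the iterates depend on the past only;
taking the ambient one gives plain measurability. -/
lemma MeasurableO.ySt (hB : B.Assumptions c.toConsts) {k : ℕ}
    (h : MeasurableO fun ω => B.chain P x0 y0 v0 (fun s => X s ω) k) {t : ℕ}
    (hX : ∀ s ∈ slotsY k t, Measurable (X s)) :
    MeasurableY fun ω => B.ySt P x0 y0 v0 (fun s => X s ω) k t := by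
  induction t with
  | zero => exact ⟨h.x, h.y, h.Dy⟩
  | succ t ih =>
    refine MeasurableY.step hB (measurable_sub_smul h.x h.Dx _) (fun i => hX _ ?_)
      (ih fun s hs => hX s (slotsY_mono k (Nat.le_succ t) hs))
    exact Or.inr ⟨rfl, Nat.lt_succ_self t⟩

lemma MeasurableO.vSt (hB : B.Assumptions c.toConsts) {k : ℕ}
    (h : MeasurableO fun ω => B.chain P x0 y0 v0 (fun s => X s ω) k) {j : ℕ}
    (hX : ∀ s ∈ slotsV k j, Measurable (X s)) :
    MeasurableV fun ω => B.vSt P x0 y0 v0 (fun s => X s ω) k j := by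
  induction j with
  | zero => exact ⟨h.x, h.y, h.v, h.Dx, h.Dv⟩
  | succ j ih =>
    have hy := h.ySt hB (t := P.T) fun s hs => hX s (slotsY_subset_slotsV _ _ _ hs)
    refine MeasurableV.step hB (measurable_sub_smul h.x h.Dx _) hy.y (fun i => hX _ ?_)
      (fun i => hX _ ?_) (ih fun s hs => hX s (slotsV_mono k (Nat.le_succ j) hs))
    · exact Or.inr ⟨rfl, Nat.lt_succ_self j⟩
    · exact Or.inr ⟨rfl, Nat.lt_succ_self j⟩

lemma measurableO_chain (hB : B.Assumptions c.toConsts) {k : ℕ}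
    (hX : ∀ s ∈ slotsY k 0, Measurable (X s)) :
    MeasurableO fun ω => B.chain P x0 y0 v0 (fun s => X s ω) k := by
  induction k with
  | zero =>
    refine ⟨?_, ?_, ?_, ?_, ?_, ?_⟩ <;>
      simp only [Bilevel.chain, Bilevel.refresh, Nat.zero_mod, if_true, Bilevel.run]
    · exact measurable_const
    · exact measurable_const
    · exact measurable_const
    · exact measurable_batch (D := fun s (θ : Vec p × Vec q × Vec q) => B.Dx s θ.1 θ.2.1 θ.2.2)
        (measurable_Dx hB) (measurable_const (a := (x0, y0, v0))) (fun i => hX (Slot.initX 0 i) trivial) P.S1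
    · exact measurable_batch (D := fun s (θ : Vec p × Vec q) => B.Dy s θ.1 θ.2)
        (measurable_Dy hB) (measurable_const (a := (x0, y0))) (fun i => hX (Slot.initY 0 i) trivial) P.S1
    · exact measurable_batch (D := fun s (θ : Vec p × Vec q × Vec q) => B.Dv s θ.1 θ.2.1 θ.2.2)
        (measurable_Dv hB) (measurable_const (a := (x0, y0, v0))) (fun i => hX (Slot.initV 0 i) trivial) P.S1
  | succ k ih =>
    have h := ih fun s hs =>
      hX s (slotsV_subset_slotsY k 0 (slotsY_subset_slotsV k 0 0 hs))
    have hy := h.ySt hB (t := P.T) fun s hs =>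
      hX s (slotsV_subset_slotsY k 0 (slotsY_subset_slotsV k _ 0 hs))
    have hv := h.vSt hB (j := P.J) fun s hs => hX s (slotsV_subset_slotsY k _ hs)
    exact ⟨measurable_sub_smul h.x h.Dx _, hy.y, hv.v, hv.Dx, hy.D, hv.Dv⟩

end Measurability

end ALS

end

noncomputable section

namespace ALS

/-! ### Estimator errors and displacements of the iterates -/

section Errors

variable {p q : ℕ} {Ξ Z : Type*} [MeasurableSpace Ξ] [MeasurableSpace Z]

/-- Error of the estimator of `∇_y g`. -/
def Bilevel.errY (B : Bilevel p q Ξ Z) (st : YState p q) : Vec q := st.D - gradY B.g st.x st.y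

/-- Error of the estimator of `d_x`. -/
def Bilevel.errX (B : Bilevel p q Ξ Z) (st : VState p q) : Vec p := st.Dx - B.dx st.x st.y st.v

/-- Error of the estimator of `d_v`. -/
def Bilevel.errV (B : Bilevel p q Ξ Z) (st : VState p q) : Vec q := st.Dv - B.dv st.x st.y st.v

/-- Parameters for which the momentum recursions contract. -/
structure Params.Admissible (Q : Params) (c : Setup) : Prop where
  M_eq : Q.M = c.M
  T_pos : 0 < Q.T
  J_pos : 0 < Q.J
  S1_pos : 0 < Q.S1
  S2_pos : 0 < Q.S2
  taux_nonneg : 0 ≤ Q.taux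
  taux_le_one : Q.taux ≤ 1
  tauy_nonneg : 0 ≤ Q.tauy
  tauy_le_one : Q.tauy ≤ 1
  tauv_nonneg : 0 ≤ Q.tauv
  tauv_le_one : Q.tauv ≤ 1

variable (B : Bilevel p q Ξ Z) (Q : Params) (x0 : Vec p) (y0 v0 : Vec q) (ω : Slot → Ξ × Z)

lemma ySt_T_x (hT : 0 < Q.T) (k : ℕ) :
    (B.ySt Q x0 y0 v0 ω k Q.T).x = B.xnext Q x0 y0 v0 ω k := by
  obtain ⟨n, hn⟩ : ∃ n, Q.T = n + 1 := ⟨Q.T - 1, by omega⟩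
  rw [hn]; rfl

lemma vSt_J_x (hJ : 0 < Q.J) (k : ℕ) :
    (B.vSt Q x0 y0 v0 ω k Q.J).x = B.xnext Q x0 y0 v0 ω k := by
  obtain ⟨n, hn⟩ : ∃ n, Q.J = n + 1 := ⟨Q.J - 1, by omega⟩
  rw [hn]; rfl

lemma vSt_J_y (hJ : 0 < Q.J) (k : ℕ) :
    (B.vSt Q x0 y0 v0 ω k Q.J).y = (B.ySt Q x0 y0 v0 ω k Q.T).y := by
  obtain ⟨n, hn⟩ : ∃ n, Q.J = n + 1 := ⟨Q.J - 1, by omega⟩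
  rw [hn]; rfl

/-- Since T > 0, the last inner state already sits at (x_{k+1}, y_{k+1}), so the error is handed
unchanged to the next outer iteration and the recursions chain. -/
lemma errY_succ_zero (hT : 0 < Q.T) (k : ℕ) :
    B.errY (B.ySt Q x0 y0 v0 ω (k + 1) 0) = B.errY (B.ySt Q x0 y0 v0 ω k Q.T) := by
  simp only [Bilevel.errY, ySt_T_x B Q x0 y0 v0 ω hT]
  rfl

lemma errX_succ_zero (hJ : 0 < Q.J) (k : ℕ) :
    B.errX (B.vSt Q x0 y0 v0 ω (k + 1) 0) = B.errX (B.vSt Q x0 y0 v0 ω k Q.J) := by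
  simp only [Bilevel.errX, vSt_J_x B Q x0 y0 v0 ω hJ, vSt_J_y B Q x0 y0 v0 ω hJ]
  rfl

lemma errV_succ_zero (hJ : 0 < Q.J) (k : ℕ) :
    B.errV (B.vSt Q x0 y0 v0 ω (k + 1) 0) = B.errV (B.vSt Q x0 y0 v0 ω k Q.J) := by
  simp only [Bilevel.errV, vSt_J_x B Q x0 y0 v0 ω hJ, vSt_J_y B Q x0 y0 v0 ω hJ]
  rfl

lemma ySt_succ_y_sub (k t : ℕ) : (B.ySt Q x0 y0 v0 ω k (t + 1)).y - (B.ySt Q x0 y0 v0 ω k t).y =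
    -((Q.lam1 * Q.beta) • (B.ySt Q x0 y0 v0 ω k t).D) := by
  rw [ySt_succ]; simp only [Bilevel.stepY]; abel

/-- The outer point moves only in the first inner step. -/
lemma sq_norm_xnext_sub_ySt_le (k t : ℕ) :
    ‖B.xnext Q x0 y0 v0 ω k - (B.ySt Q x0 y0 v0 ω k t).x‖ ^ 2 ≤
      if t = 0 then Q.alpha ^ 2 * ‖(B.chain Q x0 y0 v0 ω k).Dx‖ ^ 2 else 0 := by
  cases t with
  | zero =>
    have h1 : (B.ySt Q x0 y0 v0 ω k 0).x = (B.chain Q x0 y0 v0 ω k).x := rfl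
    rw [if_pos rfl, h1, Bilevel.xnext, sub_sub_cancel_left, norm_neg, norm_smul, mul_pow,
      Real.norm_eq_abs, sq_abs]
  | succ t =>
    have h1 : (B.ySt Q x0 y0 v0 ω k (t + 1)).x = B.xnext Q x0 y0 v0 ω k := rfl
    rw [h1, sub_self]; simp

lemma sq_norm_sub_vSt_le (k j : ℕ) :
    ‖B.xnext Q x0 y0 v0 ω k - (B.vSt Q x0 y0 v0 ω k j).x‖ ^ 2 +
        ‖(B.ySt Q x0 y0 v0 ω k Q.T).y - (B.vSt Q x0 y0 v0 ω k j).y‖ ^ 2 ≤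
      if j = 0 then Q.alpha ^ 2 * ‖(B.chain Q x0 y0 v0 ω k).Dx‖ ^ 2 +
        ‖(B.ySt Q x0 y0 v0 ω k Q.T).y - (B.chain Q x0 y0 v0 ω k).y‖ ^ 2 else 0 := by
  cases j with
  | zero =>
    have h1 : (B.vSt Q x0 y0 v0 ω k 0).x = (B.chain Q x0 y0 v0 ω k).x := rfl
    have h2 : (B.vSt Q x0 y0 v0 ω k 0).y = (B.chain Q x0 y0 v0 ω k).y := rfl
    rw [if_pos rfl, h1, h2, Bilevel.xnext, sub_sub_cancel_left, norm_neg, norm_smul, mul_pow,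
      Real.norm_eq_abs, sq_abs]
  | succ t =>
    have h1 : (B.vSt Q x0 y0 v0 ω k (t + 1)).x = B.xnext Q x0 y0 v0 ω k := rfl
    have h2 : (B.vSt Q x0 y0 v0 ω k (t + 1)).y = (B.ySt Q x0 y0 v0 ω k Q.T).y := rfl
    rw [h1, h2, sub_self, sub_self]; simp

lemma sq_norm_sum_range_le {E : Type*} [SeminormedAddCommGroup E] (n : ℕ) (a : ℕ → E) :
    ‖∑ i ∈ Finset.range n, a i‖ ^ 2 ≤ n * ∑ i ∈ Finset.range n, ‖a i‖ ^ 2 := by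
  have h1 := pow_le_pow_left₀ (norm_nonneg _) (norm_sum_le (Finset.range n) a) 2
  have h2 := sq_sum_le_card_mul_sum_sq (s := Finset.range n) (f := fun i => ‖a i‖)
  rw [Finset.card_range] at h2
  exact h1.trans h2

/-- Cauchy–Schwarz on the T increments. This total displacement is what the first step of the v-loop
sees, since it jumps from y_k to y_{k+1}. -/
lemma sq_norm_ySt_sub_le (k : ℕ) :
    ‖(B.ySt Q x0 y0 v0 ω k Q.T).y - (B.chain Q x0 y0 v0 ω k).y‖ ^ 2 ≤
      Q.T * ((Q.lam1 * Q.beta) ^ 2 *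
        ∑ t ∈ Finset.range Q.T, ‖(B.ySt Q x0 y0 v0 ω k t).D‖ ^ 2) := by
  have h1 : (B.ySt Q x0 y0 v0 ω k Q.T).y - (B.chain Q x0 y0 v0 ω k).y =
      ∑ t ∈ Finset.range Q.T, ((B.ySt Q x0 y0 v0 ω k (t + 1)).y - (B.ySt Q x0 y0 v0 ω k t).y) := by
    rw [Finset.sum_range_sub (fun t => (B.ySt Q x0 y0 v0 ω k t).y)]
    rfl
  rw [h1, Finset.mul_sum]
  refine (sq_norm_sum_range_le _ _).trans (le_of_eq ?_)
  congr 1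
  refine Finset.sum_congr rfl fun t _ => ?_
  rw [ySt_succ_y_sub, norm_neg, norm_smul, mul_pow, Real.norm_eq_abs, sq_abs]

variable {B Q x0 y0 v0 ω}

/-- The old v lies in the ball, so projecting does not lengthen the step away from it. -/
lemma norm_vSt_succ_sub_le (hM : 0 ≤ Q.M) (hv0 : ‖v0‖ ≤ Q.M) (k j : ℕ) :
    ‖(B.vSt Q x0 y0 v0 ω k (j + 1)).v - (B.vSt Q x0 y0 v0 ω k j).v‖ ^ 2 ≤
      (Q.lam2 * Q.eta) ^ 2 * ‖(B.vSt Q x0 y0 v0 ω k j).Dv‖ ^ 2 := by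
  have h1 := norm_projBall_sub_le hM
    ((B.vSt Q x0 y0 v0 ω k j).v - (Q.lam2 * Q.eta) • (B.vSt Q x0 y0 v0 ω k j).Dv)
    (norm_vSt_le (B := B) (x0 := x0) (y0 := y0) (ω := ω) hM hv0 k j)
  rw [sub_sub_cancel_left, norm_neg, norm_smul] at h1
  have h2 := pow_le_pow_left₀ (norm_nonneg _) h1 2
  rwa [mul_pow, Real.norm_eq_abs, sq_abs] at h2

end Errors

/-! ### Sample laws and one inner step of the error recursions -/

section Sampling

variable {p q : ℕ} {Ξ Z : Type*} [MeasurableSpace Ξ] [MeasurableSpace Z] {c : Setup}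
  {B : Bilevel p q Ξ Z} {Q : Params} {x0 : Vec p} {y0 v0 : Vec q}
  {Ω : Type*} [mΩ : MeasurableSpace Ω] {P : Measure Ω} {X : Slot → Ω → Ξ × Z}

lemma memLp_of_sub {E : Type*} [NormedAddCommGroup E] {f g : Ω → E}
    (h : MemLp (fun ω => f ω - g ω) 2 P) (hg : MemLp g 2 P) : MemLp f 2 P := by
  have h1 : f = (fun ω => f ω - g ω) + g := by ext1 ω; simp
  rw [h1]
  exact h.add hg

lemma Bilevel.IsSampling.map_fst (hX : B.IsSampling P X) (s : Slot) :
    (P.map (X s)).map Prod.fst = B.lawF := by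
  rw [Measure.map_map measurable_fst (hX.meas s)]
  exact hX.law_fst s

lemma Bilevel.IsSampling.map_snd (hX : B.IsSampling P X) (s : Slot) :
    (P.map (X s)).map Prod.snd = B.lawG := by
  rw [Measure.map_map measurable_snd (hX.meas s)]
  exact hX.law_snd s

lemma Bilevel.IsSampling.measurableO (hX : B.IsSampling P X) (hB : B.Assumptions c.toConsts)
    (k : ℕ) : MeasurableO fun ω => B.chain Q x0 y0 v0 (fun s => X s ω) k :=
  measurableO_chain hB fun s _ => hX.meas s

lemma Bilevel.IsSampling.measurableV (hX : B.IsSampling P X) (hB : B.Assumptions c.toConsts)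
    (k j : ℕ) : MeasurableV fun ω => B.vSt Q x0 y0 v0 (fun s => X s ω) k j :=
  (hX.measurableO hB k).vSt hB fun s _ => hX.meas s

end Sampling

section Moments

variable {p q : ℕ} {Ξ Z : Type*} [MeasurableSpace Ξ] [MeasurableSpace Z] {c : Setup}
  {B : Bilevel p q Ξ Z} {Q : Params} {x0 : Vec p} {y0 v0 : Vec q}
  {Ω : Type*} [mΩ : MeasurableSpace Ω] {P : Measure Ω} [IsProbabilityMeasure P]
  {X : Slot → Ω → Ξ × Z}

/-- A random state of the inner loop on `y` is square integrable. -/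
structure Bilevel.SqIntY (B : Bilevel p q Ξ Z) (P : Measure Ω) (st : Ω → YState p q) : Prop where
  x : MemLp (fun ω => (st ω).x) 2 P
  y : MemLp (fun ω => (st ω).y) 2 P
  err : MemLp (fun ω => B.errY (st ω)) 2 P

/-- A random state of the inner loop on `v` is square integrable. -/
structure Bilevel.SqIntV (B : Bilevel p q Ξ Z) (P : Measure Ω) (st : Ω → VState p q) : Prop where
  x : MemLp (fun ω => (st ω).x) 2 P
  y : MemLp (fun ω => (st ω).y) 2 P
  errX : MemLp (fun ω => B.errX (st ω)) 2 P
  errV : MemLp (fun ω => B.errV (st ω)) 2 P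

lemma memLp_gradY (hB : B.Assumptions c.toConsts) {x : Ω → Vec p} {y : Ω → Vec q}
    (hx : MemLp x 2 P) (hy : MemLp y 2 P) : MemLp (fun ω => gradY B.g (x ω) (y ω)) 2 P := by
  have h1 : MemLp (fun ω => gradY B.g (x ω) (y ω) - gradY B.g 0 0) 2 P := by
    have h2 : MemLp (fun ω => c.Lg * (‖x ω‖ + ‖y ω‖)) 2 P := (hx.norm.add hy.norm).const_mul c.Lg
    refine h2.mono' ?_ (Filter.Eventually.of_forall fun ω => ?_)
    · exact (hB.lower_g.lip_grad.gradY.continuous.comp_aestronglyMeasurable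
        (hx.1.prodMk hy.1)).sub aestronglyMeasurable_const
    · have h3 := hB.lower_g.lip_grad.gradY (x ω) 0 (y ω) 0
      rw [sub_zero, sub_zero] at h3
      refine h3.trans ?_
      -- The sign of L_g is not among the hypotheses here. If L_g is negative, the Lipschitz bound
      -- itself forces both norms to vanish.
      have h4 : 0 ≤ c.Lg ∨ c.Lg < 0 := le_or_gt 0 c.Lg
      rcases h4 with h4 | h4
      · exact mul_le_mul_of_nonneg_left (sqrt_add_sq_le (norm_nonneg _) (norm_nonneg _)) h4
      · have h5 := (norm_nonneg _).trans h3
        have h6 : Real.sqrt (‖x ω‖ ^ 2 + ‖y ω‖ ^ 2) = 0 := by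
          have := Real.sqrt_nonneg (‖x ω‖ ^ 2 + ‖y ω‖ ^ 2)
          nlinarith
        rw [Real.sqrt_eq_zero (by positivity)] at h6
        have h7 : ‖x ω‖ = 0 := by nlinarith [sq_nonneg ‖x ω‖, sq_nonneg ‖y ω‖]
        have h8 : ‖y ω‖ = 0 := by nlinarith [sq_nonneg ‖x ω‖, sq_nonneg ‖y ω‖]
        simp [h7, h8]
  exact memLp_of_sub h1 (memLp_const _)

lemma Bilevel.SqIntY.D (hB : B.Assumptions c.toConsts) {st : Ω → YState p q}
    (h : B.SqIntY P st) : MemLp (fun ω => (st ω).D) 2 P :=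
  memLp_of_sub h.err (memLp_gradY hB h.x h.y)

lemma memLp_of_bounded {n : ℕ} {A : Ω → Vec n} (hA : Measurable A) {b : ℝ} (h : ∀ ω, ‖A ω‖ ≤ b) :
    MemLp A 2 P :=
  MemLp.of_bound hA.aestronglyMeasurable b (Filter.Eventually.of_forall h)

lemma Bilevel.SqIntV.Dx (hc : c.Valid) (hB : B.Assumptions c.toConsts) {st : Ω → VState p q}
    (h : B.SqIntV P st) (hm : MeasurableV st) (hv : ∀ ω, ‖(st ω).v‖ ≤ c.M) :
    MemLp (fun ω => (st ω).Dx) 2 P := by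
  have h1 := (continuous_dx hB).measurable.comp (hm.x.prodMk (hm.y.prodMk hm.v))
  exact memLp_of_sub h.errX (memLp_of_bounded h1 fun ω => norm_dx_le hc hB _ _ _ (hv ω))

lemma Bilevel.SqIntV.Dv (hc : c.Valid) (hB : B.Assumptions c.toConsts) {st : Ω → VState p q}
    (h : B.SqIntV P st) (hm : MeasurableV st) (hv : ∀ ω, ‖(st ω).v‖ ≤ c.M) :
    MemLp (fun ω => (st ω).Dv) 2 P := by
  have h1 := (continuous_dv hB).measurable.comp (hm.x.prodMk (hm.y.prodMk hm.v))
  exact memLp_of_sub h.errV (memLp_of_bounded h1 fun ω => norm_dv_le hc hB _ _ _ (hv ω))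

/-- Bound on the variances of `D_x` and `D_v`. -/
def Setup.VX (c : Setup) : ℝ := 2 * ((1 + c.M ^ 2) * c.sigmaSq)

lemma var_le_VX {v : Vec q} (hv : ‖v‖ ≤ c.M) {s : ℝ} (hs : c.sf ^ 2 + s ^ 2 ≤ c.sigmaSq) :
    2 * c.sf ^ 2 + 2 * (‖v‖ ^ 2 * s ^ 2) ≤ c.VX := by
  have h1 := pow_le_pow_left₀ (norm_nonneg v) hv 2
  unfold Setup.VX
  nlinarith [sq_nonneg c.sf, sq_nonneg s, sq_nonneg c.M, mul_le_mul_of_nonneg_right h1 (sq_nonneg s),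
    mul_le_mul_of_nonneg_left hs (sq_nonneg c.M), mul_nonneg (sq_nonneg c.M) (sq_nonneg c.sf)]

lemma isNoise_Dx_VX (hX : B.IsSampling P X) (hB : B.Assumptions c.toConsts) (s : Slot)
    (x : Vec p) (y : Vec q) {v : Vec q} (hv : ‖v‖ ≤ c.M) :
    IsNoise (P.map (X s)) (fun s => B.Dx s x y v - B.dx x y v) c.VX := by
  have : IsProbabilityMeasure (P.map (X s)) :=
    Measure.isProbabilityMeasure_map (hX.meas _).aemeasurable
  refine (isNoise_Dx hB (hX.map_fst s) (hX.map_snd s) x y v).mono (var_le_VX hv ?_)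
  unfold Setup.sigmaSq
  nlinarith [sq_nonneg c.sg, sq_nonneg c.sgyy]

lemma isNoise_Dv_VX (hX : B.IsSampling P X) (hB : B.Assumptions c.toConsts) (s : Slot)
    (x : Vec p) (y : Vec q) {v : Vec q} (hv : ‖v‖ ≤ c.M) :
    IsNoise (P.map (X s)) (fun s => B.Dv s x y v - B.dv x y v) c.VX := by
  have : IsProbabilityMeasure (P.map (X s)) :=
    Measure.isProbabilityMeasure_map (hX.meas _).aemeasurable
  refine (isNoise_Dv hB (hX.map_fst s) (hX.map_snd s) x y v).mono ?_
  rw [add_comm]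
  refine var_le_VX hv ?_
  unfold Setup.sigmaSq
  nlinarith [sq_nonneg c.sg, sq_nonneg c.sgxy]

lemma step_errY (hB : B.Assumptions c.toConsts) (hX : B.IsSampling P X) (hQ : Q.Admissible c)
    {k t : ℕ} (hxn : MemLp (fun ω => B.xnext Q x0 y0 v0 (fun s => X s ω) k) 2 P)
    (h : B.SqIntY P fun ω => B.ySt Q x0 y0 v0 (fun s => X s ω) k t) :
    (B.SqIntY P fun ω => B.ySt Q x0 y0 v0 (fun s => X s ω) k (t + 1)) ∧
    ∫ ω, ‖B.errY (B.ySt Q x0 y0 v0 (fun s => X s ω) k (t + 1))‖ ^ 2 ∂P ≤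
      (1 - Q.tauy) * ∫ ω, ‖B.errY (B.ySt Q x0 y0 v0 (fun s => X s ω) k t)‖ ^ 2 ∂P +
      (2 * Q.tauy ^ 2 * c.sg ^ 2 + 2 * ∫ ω, c.Lg ^ 2 *
        (‖B.xnext Q x0 y0 v0 (fun s => X s ω) k - (B.ySt Q x0 y0 v0 (fun s => X s ω) k t).x‖ ^ 2 +
        (Q.lam1 * Q.beta) ^ 2 * ‖(B.ySt Q x0 y0 v0 (fun s => X s ω) k t).D‖ ^ 2) ∂P) / Q.S2 := by
  set A := slotsY k t
  have hO : MeasurableO (mΩ := sigmaOf X A) fun ω => B.chain Q x0 y0 v0 (fun s => X s ω) k :=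
    measurableO_chain (mΩ := sigmaOf X A) hB fun s hs =>
      measurable_sigmaOf (slotsY_mono k (Nat.zero_le t) hs)
  have hY := MeasurableO.ySt (mΩ := sigmaOf X A) hB hO (t := t) fun s hs => measurable_sigmaOf hs
  have hxm := measurable_sub_smul (mΩ := sigmaOf X A) (MeasurableO.x (mΩ := sigmaOf X A) hO) (MeasurableO.Dx (mΩ := sigmaOf X A) hO) Q.alpha
  have hym := measurable_sub_smul (mΩ := sigmaOf X A) (MeasurableY.y (mΩ := sigmaOf X A) hY) (MeasurableY.D (mΩ := sigmaOf X A) hY) (Q.lam1 * Q.beta)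
  have hσ : Function.Injective (Slot.stepY k t) := fun i j hij => by injection hij
  have hA : ∀ i, Slot.stepY k t i ∉ A := fun i hi => by
    rcases hi with h1 | ⟨_, h1⟩ <;> omega
  have hD2 := h.D hB
  have hl2 : Integrable (fun ω => c.Lg ^ 2 *
        (‖B.xnext Q x0 y0 v0 (fun s => X s ω) k - (B.ySt Q x0 y0 v0 (fun s => X s ω) k t).x‖ ^ 2 +
        (Q.lam1 * Q.beta) ^ 2 * ‖(B.ySt Q x0 y0 v0 (fun s => X s ω) k t).D‖ ^ 2)) P :=
    ((hxn.sub h.x).integrable_sq_norm.add (hD2.integrable_sq_norm.const_mul _)).const_mul _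
  obtain ⟨h1, h2⟩ := memLp_momentum_update hX hσ hA
    (D := fun s (θ : Vec p × Vec q) => B.Dy s θ.1 θ.2) (d := fun θ => gradY B.g θ.1 θ.2)
    (measurable_Dy hB) (hB.lower_g.lip_grad.gradY.continuous.measurable)
    (Measurable.prodMk (MeasurableY.x (mΩ := sigmaOf X A) hY) (MeasurableY.y (mΩ := sigmaOf X A) hY)) (Measurable.prodMk hxm hym) (MeasurableY.D (mΩ := sigmaOf X A) hY)
    hQ.tauy_nonneg hQ.tauy_le_one (V := c.sg ^ 2)
    (fun ω i => isNoise_Dy hB (hX.map_snd _) _ _) (fun ω i => isNoise_Dy hB (hX.map_snd _) _ _)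
    (fun ω s => (sq_norm_Dy_sub_le hB s _ _ _ _).trans_eq (by
      rw [sub_sub_cancel_left, norm_neg, norm_smul, mul_pow, Real.norm_eq_abs, sq_abs]
      rfl)) hl2 h.err hQ.S2_pos
  exact ⟨⟨hxn, h.y.sub (hD2.const_smul (Q.lam1 * Q.beta)), h1⟩, h2⟩

lemma integrable_lip_V (hc : c.Valid) (hB : B.Assumptions c.toConsts) (hX : B.IsSampling P X)
    (hQ : Q.Admissible c) (hv0 : ‖v0‖ ≤ c.M) {k j : ℕ}
    (hxn : MemLp (fun ω => B.xnext Q x0 y0 v0 (fun s => X s ω) k) 2 P)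
    (hyn : MemLp (fun ω => (B.ySt Q x0 y0 v0 (fun s => X s ω) k Q.T).y) 2 P)
    (h : B.SqIntV P fun ω => B.vSt Q x0 y0 v0 (fun s => X s ω) k j) :
    Integrable (fun ω => c.M1 *
        (‖B.xnext Q x0 y0 v0 (fun s => X s ω) k - (B.vSt Q x0 y0 v0 (fun s => X s ω) k j).x‖ ^ 2 +
        ‖(B.ySt Q x0 y0 v0 (fun s => X s ω) k Q.T).y -
          (B.vSt Q x0 y0 v0 (fun s => X s ω) k j).y‖ ^ 2) + 2 * c.Lg ^ 2 *
        ((Q.lam2 * Q.eta) ^ 2 * ‖(B.vSt Q x0 y0 v0 (fun s => X s ω) k j).Dv‖ ^ 2)) P := by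
  have hv : ∀ ω, ‖(B.vSt Q x0 y0 v0 (fun s => X s ω) k j).v‖ ≤ c.M := fun ω => by
    rw [← hQ.M_eq]
    exact norm_vSt_le (hQ.M_eq ▸ hc.M_nonneg) (hQ.M_eq ▸ hv0) k j
  have h1 := h.Dv hc hB (hX.measurableV hB k j) hv
  exact (((hxn.sub h.x).integrable_sq_norm.add (hyn.sub h.y).integrable_sq_norm).const_mul _).add
    ((h1.integrable_sq_norm.const_mul _).const_mul _)

/-- Both batches of the step are disjoint from the slots in `slotsV k j`, so the two estimators have
the same past and the same drift bound. They are treated together because square integrability of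
the next state concerns both errors. -/
lemma step_errX (hc : c.Valid) (hB : B.Assumptions c.toConsts) (hX : B.IsSampling P X)
    (hQ : Q.Admissible c) (hv0 : ‖v0‖ ≤ c.M) {k j : ℕ}
    (hxn : MemLp (fun ω => B.xnext Q x0 y0 v0 (fun s => X s ω) k) 2 P)
    (hyn : MemLp (fun ω => (B.ySt Q x0 y0 v0 (fun s => X s ω) k Q.T).y) 2 P)
    (h : B.SqIntV P fun ω => B.vSt Q x0 y0 v0 (fun s => X s ω) k j) :
    (B.SqIntV P fun ω => B.vSt Q x0 y0 v0 (fun s => X s ω) k (j + 1)) ∧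
    ∫ ω, ‖B.errX (B.vSt Q x0 y0 v0 (fun s => X s ω) k (j + 1))‖ ^ 2 ∂P ≤
      (1 - Q.taux) * ∫ ω, ‖B.errX (B.vSt Q x0 y0 v0 (fun s => X s ω) k j)‖ ^ 2 ∂P +
      (2 * Q.taux ^ 2 * c.VX + 2 * ∫ ω, (c.M1 *
        (‖B.xnext Q x0 y0 v0 (fun s => X s ω) k - (B.vSt Q x0 y0 v0 (fun s => X s ω) k j).x‖ ^ 2 +
        ‖(B.ySt Q x0 y0 v0 (fun s => X s ω) k Q.T).y -
          (B.vSt Q x0 y0 v0 (fun s => X s ω) k j).y‖ ^ 2) + 2 * c.Lg ^ 2 *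
        ((Q.lam2 * Q.eta) ^ 2 * ‖(B.vSt Q x0 y0 v0 (fun s => X s ω) k j).Dv‖ ^ 2)) ∂P) / Q.S2 ∧
    ∫ ω, ‖B.errV (B.vSt Q x0 y0 v0 (fun s => X s ω) k (j + 1))‖ ^ 2 ∂P ≤
      (1 - Q.tauv) * ∫ ω, ‖B.errV (B.vSt Q x0 y0 v0 (fun s => X s ω) k j)‖ ^ 2 ∂P +
      (2 * Q.tauv ^ 2 * c.VX + 2 * ∫ ω, (c.M1 *
        (‖B.xnext Q x0 y0 v0 (fun s => X s ω) k - (B.vSt Q x0 y0 v0 (fun s => X s ω) k j).x‖ ^ 2 +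
        ‖(B.ySt Q x0 y0 v0 (fun s => X s ω) k Q.T).y -
          (B.vSt Q x0 y0 v0 (fun s => X s ω) k j).y‖ ^ 2) + 2 * c.Lg ^ 2 *
        ((Q.lam2 * Q.eta) ^ 2 * ‖(B.vSt Q x0 y0 v0 (fun s => X s ω) k j).Dv‖ ^ 2)) ∂P) / Q.S2 := by
  have hM0 : 0 ≤ Q.M := hQ.M_eq ▸ hc.M_nonneg
  have hv0' : ‖v0‖ ≤ Q.M := hQ.M_eq ▸ hv0
  set A := slotsV k j
  have hO : MeasurableO (mΩ := sigmaOf X A) fun ω => B.chain Q x0 y0 v0 (fun s => X s ω) k :=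
    measurableO_chain (mΩ := sigmaOf X A) hB fun s hs =>
      measurable_sigmaOf (slotsY_subset_slotsV _ _ _ hs)
  have hY := MeasurableO.ySt (mΩ := sigmaOf X A) hB hO (t := Q.T) fun s hs =>
    measurable_sigmaOf (slotsY_subset_slotsV _ _ _ hs)
  have hV := MeasurableO.vSt (mΩ := sigmaOf X A) hB hO (j := j) fun s hs => measurable_sigmaOf hs
  have hxm := measurable_sub_smul (mΩ := sigmaOf X A) (MeasurableO.x (mΩ := sigmaOf X A) hO) (MeasurableO.Dx (mΩ := sigmaOf X A) hO) Q.alpha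
  have hvm := (measurable_projBall Q.M).comp
    (measurable_sub_smul (mΩ := sigmaOf X A) (MeasurableV.v (mΩ := sigmaOf X A) hV) (MeasurableV.Dv (mΩ := sigmaOf X A) hV) (Q.lam2 * Q.eta))
  have hv : ∀ j ω, ‖(B.vSt Q x0 y0 v0 (fun s => X s ω) k j).v‖ ≤ c.M := fun j ω => by
    rw [← hQ.M_eq]
    exact norm_vSt_le hM0 hv0' k j
  have hl2 := integrable_lip_V hc hB hX hQ hv0 hxn hyn h
  have hlip : ∀ ω, ‖(B.vSt Q x0 y0 v0 (fun s => X s ω) k (j + 1)).v -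
      (B.vSt Q x0 y0 v0 (fun s => X s ω) k j).v‖ ^ 2 ≤ (Q.lam2 * Q.eta) ^ 2 *
        ‖(B.vSt Q x0 y0 v0 (fun s => X s ω) k j).Dv‖ ^ 2 :=
    fun ω => norm_vSt_succ_sub_le hM0 hv0' k j
  have hσX : Function.Injective (Slot.stepX k j) := fun i j hij => by injection hij
  have hAX : ∀ i, Slot.stepX k j i ∉ A := fun i hi => by
    rcases hi with h1 | ⟨_, h1⟩ <;> omega
  have hσV : Function.Injective (Slot.stepV k j) := fun i j hij => by injection hij
  have hAV : ∀ i, Slot.stepV k j i ∉ A := fun i hi => by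
    rcases hi with h1 | ⟨_, h1⟩ <;> omega
  obtain ⟨h1, h2⟩ := memLp_momentum_update hX hσX hAX
    (D := fun s (θ : Vec p × Vec q × Vec q) => B.Dx s θ.1 θ.2.1 θ.2.2)
    (d := fun θ => B.dx θ.1 θ.2.1 θ.2.2)
    (measurable_Dx hB) (continuous_dx hB).measurable
    (Measurable.prodMk (MeasurableV.x (mΩ := sigmaOf X A) hV) (Measurable.prodMk (MeasurableV.y (mΩ := sigmaOf X A) hV) (MeasurableV.v (mΩ := sigmaOf X A) hV)))
    (Measurable.prodMk hxm (Measurable.prodMk (MeasurableY.y (mΩ := sigmaOf X A) hY) hvm)) (MeasurableV.Dx (mΩ := sigmaOf X A) hV)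
    hQ.taux_nonneg hQ.taux_le_one (V := c.VX)
    (fun ω i => isNoise_Dx_VX hX hB _ _ _ (hv j ω))
    (fun ω i => isNoise_Dx_VX hX hB _ _ _ (hv (j + 1) ω))
    (fun ω s => (sq_norm_Dx_sub_le hc hB s _ _ _ _ _ _ (hv j ω)).trans
      (add_le_add_right (mul_le_mul_of_nonneg_left (hlip ω) (by positivity)) _))
    hl2 h.errX hQ.S2_pos
  obtain ⟨h3, h4⟩ := memLp_momentum_update hX hσV hAV
    (D := fun s (θ : Vec p × Vec q × Vec q) => B.Dv s θ.1 θ.2.1 θ.2.2)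
    (d := fun θ => B.dv θ.1 θ.2.1 θ.2.2)
    (measurable_Dv hB) (continuous_dv hB).measurable
    (Measurable.prodMk (MeasurableV.x (mΩ := sigmaOf X A) hV) (Measurable.prodMk (MeasurableV.y (mΩ := sigmaOf X A) hV) (MeasurableV.v (mΩ := sigmaOf X A) hV)))
    (Measurable.prodMk hxm (Measurable.prodMk (MeasurableY.y (mΩ := sigmaOf X A) hY) hvm)) (MeasurableV.Dv (mΩ := sigmaOf X A) hV)
    hQ.tauv_nonneg hQ.tauv_le_one (V := c.VX)
    (fun ω i => isNoise_Dv_VX hX hB _ _ _ (hv j ω))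
    (fun ω i => isNoise_Dv_VX hX hB _ _ _ (hv (j + 1) ω))
    (fun ω s => (sq_norm_Dv_sub_le hc hB s _ _ _ _ _ _ (hv j ω)).trans
      (add_le_add_right (mul_le_mul_of_nonneg_left (hlip ω) (by positivity)) _))
    hl2 h.errV hQ.S2_pos
  exact ⟨⟨hxn, hyn, h1, h3⟩, h2, h4⟩

end Moments

end ALS

end

noncomputable section

namespace ALS

/-! ### Summation of scalar error recursions -/

section RealSums

/-- Telescoping keeps τ times the sum of the errors on the left. After weighting, this is what
cancels the errors appearing in the potential. -/
lemma add_mul_sum_le_of_step {e s : ℕ → ℝ} {τ : ℝ} {n : ℕ}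
    (h : ∀ i < n, e (i + 1) ≤ (1 - τ) * e i + s i) :
    e n + τ * ∑ i ∈ Finset.range n, e i ≤ e 0 + ∑ i ∈ Finset.range n, s i := by
  induction n with
  | zero => simp
  | succ n ih =>
    rw [Finset.sum_range_succ, Finset.sum_range_succ]
    have h1 := h n (Nat.lt_succ_self n)
    have h2 := ih fun i hi => h i (hi.trans (Nat.lt_succ_self n))
    linarith

lemma sum_range_ite_zero_le {a : ℝ} (ha : 0 ≤ a) (n : ℕ) :
    ∑ i ∈ Finset.range n, (if i = 0 then a else 0) ≤ a := by
  rw [Finset.sum_ite_eq' (Finset.range n) 0 (fun _ => a)]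
  split_ifs
  · exact le_rfl
  · exact ha

/-- Here `u` is the displacement of the outer variables, nonzero only at the first inner step, so
its bound `a` enters once and not `n` times; `w` comes from the variable moving inside the loop. -/
lemma add_mul_sum_le_of_drift {Ω : Type*} [MeasurableSpace Ω] {P : Measure Ω} {e : ℕ → ℝ} {τ V S A L r a : ℝ} {u w : ℕ → Ω → ℝ} {n : ℕ}
    (hu : ∀ j, Integrable (u j) P) (hw : ∀ j, Integrable (w j) P) (ha : 0 ≤ a)
    (hua : ∀ j, ∫ ω, u j ω ∂P ≤ if j = 0 then a else 0) (hS : 0 < S) (hA : 0 ≤ A)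
    (h : ∀ j, e (j + 1) ≤ (1 - τ) * e j +
      (2 * τ ^ 2 * V + 2 * ∫ ω, (A * u j ω + L * (r * w j ω)) ∂P) / S) :
    e n + τ * ∑ j ∈ Finset.range n, e j ≤ e 0 + 2 / S * (n * (τ ^ 2 * V) +
      (A * a + L * (r * ∑ j ∈ Finset.range n, ∫ ω, w j ω ∂P))) := by
  have h1 : ∀ j < n, e (j + 1) ≤ (1 - τ) * e j + 2 / S * (τ ^ 2 * V +
      (A * (if j = 0 then a else 0) + L * (r * ∫ ω, w j ω ∂P))) := fun j _ => by
    refine (h j).trans (add_le_add_right ?_ _)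
    rw [integral_add ((hu j).const_mul _) (((hw j).const_mul _).const_mul _),
      integral_const_mul, integral_const_mul, integral_const_mul, div_mul_eq_mul_div]
    have := mul_le_mul_of_nonneg_left (hua j) hA
    gcongr ?_ / S
    linarith
  refine (add_mul_sum_le_of_step h1).trans (add_le_add_right ?_ _)
  rw [← Finset.mul_sum, Finset.sum_add_distrib, Finset.sum_const, Finset.card_range,
    nsmul_eq_mul, Finset.sum_add_distrib, ← Finset.mul_sum, ← Finset.mul_sum, ← Finset.mul_sum]
  have h2 := sum_range_ite_zero_le ha n
  gcongr

end RealSums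

/-! ### Square integrability along the chain and accumulated errors -/

section Moments

variable {p q : ℕ} {Ξ Z : Type*} [MeasurableSpace Ξ] [MeasurableSpace Z] {c : Setup}
  {B : Bilevel p q Ξ Z} {Q : Params} {x0 : Vec p} {y0 v0 : Vec q}
  {Ω : Type*} [mΩ : MeasurableSpace Ω] {P : Measure Ω} [IsProbabilityMeasure P]
  {X : Slot → Ω → Ξ × Z}

lemma memLp_chain_Dx (hc : c.Valid) (hB : B.Assumptions c.toConsts) (hX : B.IsSampling P X)
    (hQ : Q.Admissible c) (hv0 : ‖v0‖ ≤ c.M) {k : ℕ}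
    (h : B.SqIntV P fun ω => B.vSt Q x0 y0 v0 (fun s => X s ω) k 0) :
    MemLp (fun ω => (B.chain Q x0 y0 v0 (fun s => X s ω) k).Dx) 2 P :=
  h.Dx hc hB (hX.measurableV hB k 0) fun ω => by
    rw [← hQ.M_eq]
    exact norm_vSt_le (hQ.M_eq ▸ hc.M_nonneg) (hQ.M_eq ▸ hv0) k 0

lemma memLp_vSt_Dv (hc : c.Valid) (hB : B.Assumptions c.toConsts) (hX : B.IsSampling P X)
    (hQ : Q.Admissible c) (hv0 : ‖v0‖ ≤ c.M) {k j : ℕ}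
    (h : B.SqIntV P fun ω => B.vSt Q x0 y0 v0 (fun s => X s ω) k j) :
    MemLp (fun ω => (B.vSt Q x0 y0 v0 (fun s => X s ω) k j).Dv) 2 P :=
  h.Dv hc hB (hX.measurableV hB k j) fun ω => by
    rw [← hQ.M_eq]
    exact norm_vSt_le (hQ.M_eq ▸ hc.M_nonneg) (hQ.M_eq ▸ hv0) k j

lemma memLp_xnext (hc : c.Valid) (hB : B.Assumptions c.toConsts) (hX : B.IsSampling P X)
    (hQ : Q.Admissible c) (hv0 : ‖v0‖ ≤ c.M) {k : ℕ}
    (h : B.SqIntV P fun ω => B.vSt Q x0 y0 v0 (fun s => X s ω) k 0) :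
    MemLp (fun ω => B.xnext Q x0 y0 v0 (fun s => X s ω) k) 2 P :=
  h.x.sub ((memLp_chain_Dx hc hB hX hQ hv0 h).const_smul Q.alpha)

lemma sqIntY_of_zero (hB : B.Assumptions c.toConsts) (hX : B.IsSampling P X)
    (hQ : Q.Admissible c) {k : ℕ}
    (hxn : MemLp (fun ω => B.xnext Q x0 y0 v0 (fun s => X s ω) k) 2 P)
    (h : B.SqIntY P fun ω => B.ySt Q x0 y0 v0 (fun s => X s ω) k 0) (t : ℕ) :
    B.SqIntY P fun ω => B.ySt Q x0 y0 v0 (fun s => X s ω) k t := by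
  induction t with
  | zero => exact h
  | succ t ih => exact (step_errY hB hX hQ hxn ih).1

lemma sqIntV_of_zero (hc : c.Valid) (hB : B.Assumptions c.toConsts) (hX : B.IsSampling P X)
    (hQ : Q.Admissible c) (hv0 : ‖v0‖ ≤ c.M) {k : ℕ}
    (hxn : MemLp (fun ω => B.xnext Q x0 y0 v0 (fun s => X s ω) k) 2 P)
    (hyn : MemLp (fun ω => (B.ySt Q x0 y0 v0 (fun s => X s ω) k Q.T).y) 2 P)
    (h : B.SqIntV P fun ω => B.vSt Q x0 y0 v0 (fun s => X s ω) k 0) (j : ℕ) :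
    B.SqIntV P fun ω => B.vSt Q x0 y0 v0 (fun s => X s ω) k j := by
  induction j with
  | zero => exact h
  | succ j ih => exact (step_errX hc hB hX hQ hv0 hxn hyn ih).1

lemma init_errX (hB : B.Assumptions c.toConsts) (hX : B.IsSampling P X)
    (hQ : Q.Admissible c) (hv0 : ‖v0‖ ≤ c.M) :
    MemLp (fun ω => B.errX (B.vSt Q x0 y0 v0 (fun s => X s ω) 0 0)) 2 P ∧
    ∫ ω, ‖B.errX (B.vSt Q x0 y0 v0 (fun s => X s ω) 0 0)‖ ^ 2 ∂P ≤ c.VX / Q.S1 := by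
  have h0 : ∀ ω, B.errX (B.vSt Q x0 y0 v0 (fun s => X s ω) 0 0) =
      batch Q.S1 (fun i => X (Slot.initX 0 i) ω) (fun s => B.Dx s x0 y0 v0) - B.dx x0 y0 v0 := by
    intro ω
    simp only [Bilevel.errX, Bilevel.vSt, Bilevel.loopV, Bilevel.chain, Bilevel.refresh,
      Bilevel.run, Nat.zero_mod, if_true]
  simp_rw [h0]
  have hm := (measurable_Dx hB).comp ((measurable_id (α := Ξ × Z)).prodMk
    (measurable_const (a := (x0, y0, v0))))
  exact memLp_batch_sub hX (D := fun s => B.Dx s x0 y0 v0) (σ := Slot.initX 0) (fun i j hij => by injection hij) hm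
    (fun i => isNoise_Dx_VX hX hB _ _ _ hv0) hQ.S1_pos

lemma init_errV (hB : B.Assumptions c.toConsts) (hX : B.IsSampling P X)
    (hQ : Q.Admissible c) (hv0 : ‖v0‖ ≤ c.M) :
    MemLp (fun ω => B.errV (B.vSt Q x0 y0 v0 (fun s => X s ω) 0 0)) 2 P ∧
    ∫ ω, ‖B.errV (B.vSt Q x0 y0 v0 (fun s => X s ω) 0 0)‖ ^ 2 ∂P ≤ c.VX / Q.S1 := by
  have h0 : ∀ ω, B.errV (B.vSt Q x0 y0 v0 (fun s => X s ω) 0 0) =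
      batch Q.S1 (fun i => X (Slot.initV 0 i) ω) (fun s => B.Dv s x0 y0 v0) - B.dv x0 y0 v0 := by
    intro ω
    simp only [Bilevel.errV, Bilevel.vSt, Bilevel.loopV, Bilevel.chain, Bilevel.refresh,
      Bilevel.run, Nat.zero_mod, if_true]
  simp_rw [h0]
  have hm := (measurable_Dv hB).comp ((measurable_id (α := Ξ × Z)).prodMk
    (measurable_const (a := (x0, y0, v0))))
  exact memLp_batch_sub hX (D := fun s => B.Dv s x0 y0 v0) (σ := Slot.initV 0) (fun i j hij => by injection hij) hm
    (fun i => isNoise_Dv_VX hX hB _ _ _ hv0) hQ.S1_pos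

lemma init_errY (hB : B.Assumptions c.toConsts) (hX : B.IsSampling P X)
    (hQ : Q.Admissible c) :
    MemLp (fun ω => B.errY (B.ySt Q x0 y0 v0 (fun s => X s ω) 0 0)) 2 P ∧
    ∫ ω, ‖B.errY (B.ySt Q x0 y0 v0 (fun s => X s ω) 0 0)‖ ^ 2 ∂P ≤ c.sg ^ 2 / Q.S1 := by
  have h0 : ∀ ω, B.errY (B.ySt Q x0 y0 v0 (fun s => X s ω) 0 0) =
      batch Q.S1 (fun i => X (Slot.initY 0 i) ω) (fun s => B.Dy s x0 y0) - gradY B.g x0 y0 := by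
    intro ω
    simp only [Bilevel.errY, Bilevel.ySt, Bilevel.loopY, Bilevel.chain, Bilevel.refresh,
      Bilevel.run, Nat.zero_mod, if_true]
  simp_rw [h0]
  have hm := (measurable_Dy hB).comp ((measurable_id (α := Ξ × Z)).prodMk
    (measurable_const (a := (x0, y0))))
  exact memLp_batch_sub hX (D := fun s => B.Dy s x0 y0) (σ := Slot.initY 0) (fun i j hij => by injection hij) hm
    (fun i => isNoise_Dy hB (hX.map_snd _) _ _) hQ.S1_pos

/-- Induction over the outer iterations; within one iteration the y-loop comes first, because the
v-loop is run at y_{k+1}. -/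
lemma sqInt_zero (hc : c.Valid) (hB : B.Assumptions c.toConsts) (hX : B.IsSampling P X)
    (hQ : Q.Admissible c) (hv0 : ‖v0‖ ≤ c.M) (k : ℕ) :
    (B.SqIntY P fun ω => B.ySt Q x0 y0 v0 (fun s => X s ω) k 0) ∧
    (B.SqIntV P fun ω => B.vSt Q x0 y0 v0 (fun s => X s ω) k 0) := by
  induction k with
  | zero =>
    have hx : ∀ ω, (B.chain Q x0 y0 v0 (fun s => X s ω) 0).x = x0 := fun ω => by
      simp only [Bilevel.chain, Bilevel.refresh, Bilevel.run, Nat.zero_mod, if_true]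
    have hy : ∀ ω, (B.chain Q x0 y0 v0 (fun s => X s ω) 0).y = y0 := fun ω => by
      simp only [Bilevel.chain, Bilevel.refresh, Bilevel.run, Nat.zero_mod, if_true]
    have hx' : MemLp (fun ω => (B.chain Q x0 y0 v0 (fun s => X s ω) 0).x) 2 P := by
      simp_rw [hx]; exact memLp_const _
    have hy' : MemLp (fun ω => (B.chain Q x0 y0 v0 (fun s => X s ω) 0).y) 2 P := by
      simp_rw [hy]; exact memLp_const _
    exact ⟨⟨hx', hy', (init_errY hB hX hQ).1⟩,
      ⟨hx', hy', (init_errX hB hX hQ hv0).1, (init_errV hB hX hQ hv0).1⟩⟩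
  | succ k ih =>
    obtain ⟨ihY, ihV⟩ := ih
    have hxn := memLp_xnext hc hB hX hQ hv0 ihV
    have hY := sqIntY_of_zero hB hX hQ hxn ihY Q.T
    have hV := sqIntV_of_zero hc hB hX hQ hv0 hxn hY.y ihV Q.J
    refine ⟨⟨hxn, hY.y, ?_⟩, ⟨hxn, hY.y, ?_, ?_⟩⟩
    · simp_rw [errY_succ_zero B Q x0 y0 v0 _ hQ.T_pos]; exact hY.err
    · simp_rw [errX_succ_zero B Q x0 y0 v0 _ hQ.J_pos]; exact hV.errX
    · simp_rw [errV_succ_zero B Q x0 y0 v0 _ hQ.J_pos]; exact hV.errV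

lemma memLp_xnext' (hc : c.Valid) (hB : B.Assumptions c.toConsts) (hX : B.IsSampling P X)
    (hQ : Q.Admissible c) (hv0 : ‖v0‖ ≤ c.M) (k : ℕ) :
    MemLp (fun ω => B.xnext Q x0 y0 v0 (fun s => X s ω) k) 2 P :=
  memLp_xnext hc hB hX hQ hv0 (sqInt_zero hc hB hX hQ hv0 k).2

lemma sqIntY (hc : c.Valid) (hB : B.Assumptions c.toConsts) (hX : B.IsSampling P X)
    (hQ : Q.Admissible c) (hv0 : ‖v0‖ ≤ c.M) (k t : ℕ) :
    B.SqIntY P fun ω => B.ySt Q x0 y0 v0 (fun s => X s ω) k t :=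
  sqIntY_of_zero hB hX hQ (memLp_xnext' hc hB hX hQ hv0 k) (sqInt_zero hc hB hX hQ hv0 k).1 t

lemma sqIntV (hc : c.Valid) (hB : B.Assumptions c.toConsts) (hX : B.IsSampling P X)
    (hQ : Q.Admissible c) (hv0 : ‖v0‖ ≤ c.M) (k j : ℕ) :
    B.SqIntV P fun ω => B.vSt Q x0 y0 v0 (fun s => X s ω) k j :=
  sqIntV_of_zero hc hB hX hQ hv0 (memLp_xnext' hc hB hX hQ hv0 k)
    (sqIntY hc hB hX hQ hv0 k Q.T).y (sqInt_zero hc hB hX hQ hv0 k).2 j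

/-- Accumulated error of the estimator of `∇_y g` over one inner loop. -/
lemma sum_errY_le (hc : c.Valid) (hB : B.Assumptions c.toConsts) (hX : B.IsSampling P X)
    (hQ : Q.Admissible c) (hv0 : ‖v0‖ ≤ c.M) (k : ℕ) :
    ∫ ω, ‖B.errY (B.ySt Q x0 y0 v0 (fun s => X s ω) k Q.T)‖ ^ 2 ∂P +
      Q.tauy * ∑ t ∈ Finset.range Q.T,
        ∫ ω, ‖B.errY (B.ySt Q x0 y0 v0 (fun s => X s ω) k t)‖ ^ 2 ∂P ≤
    ∫ ω, ‖B.errY (B.ySt Q x0 y0 v0 (fun s => X s ω) k 0)‖ ^ 2 ∂P +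
      2 / Q.S2 * (Q.T * (Q.tauy ^ 2 * c.sg ^ 2) + (c.Lg ^ 2 * (Q.alpha ^ 2 *
        ∫ ω, ‖(B.chain Q x0 y0 v0 (fun s => X s ω) k).Dx‖ ^ 2 ∂P) + c.Lg ^ 2 *
        ((Q.lam1 * Q.beta) ^ 2 * ∑ t ∈ Finset.range Q.T,
          ∫ ω, ‖(B.ySt Q x0 y0 v0 (fun s => X s ω) k t).D‖ ^ 2 ∂P))) := by
  have hxn := memLp_xnext' (x0 := x0) (y0 := y0) hc hB hX hQ hv0 k
  have hY := sqIntY (x0 := x0) (y0 := y0) hc hB hX hQ hv0 k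
  have hDx := (memLp_chain_Dx hc hB hX hQ hv0
    (sqIntV (x0 := x0) (y0 := y0) hc hB hX hQ hv0 k 0)).integrable_sq_norm
  have hu : ∀ t, Integrable (fun ω => ‖B.xnext Q x0 y0 v0 (fun s => X s ω) k -
      (B.ySt Q x0 y0 v0 (fun s => X s ω) k t).x‖ ^ 2) P :=
    fun t => (hxn.sub (hY t).x).integrable_sq_norm
  refine add_mul_sum_le_of_drift
    (e := fun t => ∫ ω, ‖B.errY (B.ySt Q x0 y0 v0 (fun s => X s ω) k t)‖ ^ 2 ∂P)
    (w := fun t ω => ‖(B.ySt Q x0 y0 v0 (fun s => X s ω) k t).D‖ ^ 2) hu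
    (fun t => ((hY t).D hB).integrable_sq_norm)
    (mul_nonneg (sq_nonneg _) (integral_nonneg fun _ => sq_nonneg _)) (fun t => ?_)
    (by exact_mod_cast hQ.S2_pos) (sq_nonneg _) fun t => ?_
  · have h := fun ω => sq_norm_xnext_sub_ySt_le B Q x0 y0 v0 (fun s => X s ω) k t
    by_cases ht : t = 0
    · simp only [if_pos ht] at h ⊢
      rw [← integral_const_mul]
      exact integral_mono (hu t) (hDx.const_mul _) h
    · simp only [if_neg ht] at h ⊢
      exact integral_nonpos h
  · have := (step_errY hB hX hQ hxn (hY t)).2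
    simpa only [mul_add] using this

lemma integral_drift_le (hc : c.Valid) (hB : B.Assumptions c.toConsts) (hX : B.IsSampling P X)
    (hQ : Q.Admissible c) (hv0 : ‖v0‖ ≤ c.M) (k : ℕ) :
    ∫ ω, (Q.alpha ^ 2 * ‖(B.chain Q x0 y0 v0 (fun s => X s ω) k).Dx‖ ^ 2 +
        ‖(B.ySt Q x0 y0 v0 (fun s => X s ω) k Q.T).y -
          (B.chain Q x0 y0 v0 (fun s => X s ω) k).y‖ ^ 2) ∂P ≤
      Q.alpha ^ 2 * ∫ ω, ‖(B.chain Q x0 y0 v0 (fun s => X s ω) k).Dx‖ ^ 2 ∂P +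
        Q.T * ((Q.lam1 * Q.beta) ^ 2 * ∑ t ∈ Finset.range Q.T,
          ∫ ω, ‖(B.ySt Q x0 y0 v0 (fun s => X s ω) k t).D‖ ^ 2 ∂P) := by
  have hY := sqIntY (x0 := x0) (y0 := y0) hc hB hX hQ hv0 k
  have hDx := (memLp_chain_Dx hc hB hX hQ hv0
    (sqIntV (x0 := x0) (y0 := y0) hc hB hX hQ hv0 k 0)).integrable_sq_norm
  have hD := fun t => ((hY t).D hB).integrable_sq_norm
  have h0 : Integrable (fun ω => ‖(B.ySt Q x0 y0 v0 (fun s => X s ω) k Q.T).y -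
      (B.chain Q x0 y0 v0 (fun s => X s ω) k).y‖ ^ 2) P :=
    ((hY Q.T).y.sub (hY 0).y).integrable_sq_norm
  have hs := integrable_finsetSum (Finset.range Q.T) fun t _ => hD t
  rw [integral_add (hDx.const_mul _) h0, integral_const_mul,
    ← integral_finsetSum _ fun t _ => hD t]
  have h1 := integral_mono h0 ((hs.const_mul ((Q.lam1 * Q.beta) ^ 2)).const_mul (Q.T : ℝ))
    fun ω => sq_norm_ySt_sub_le B Q x0 y0 v0 (fun s => X s ω) k
  rw [integral_const_mul, integral_const_mul] at h1
  exact add_le_add_right h1 _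

lemma integral_drift_vSt_le (hc : c.Valid) (hB : B.Assumptions c.toConsts)
    (hX : B.IsSampling P X) (hQ : Q.Admissible c) (hv0 : ‖v0‖ ≤ c.M) (k j : ℕ) :
    ∫ ω, (‖B.xnext Q x0 y0 v0 (fun s => X s ω) k -
          (B.vSt Q x0 y0 v0 (fun s => X s ω) k j).x‖ ^ 2 +
        ‖(B.ySt Q x0 y0 v0 (fun s => X s ω) k Q.T).y -
          (B.vSt Q x0 y0 v0 (fun s => X s ω) k j).y‖ ^ 2) ∂P ≤
      if j = 0 then Q.alpha ^ 2 * ∫ ω, ‖(B.chain Q x0 y0 v0 (fun s => X s ω) k).Dx‖ ^ 2 ∂P +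
        Q.T * ((Q.lam1 * Q.beta) ^ 2 * ∑ t ∈ Finset.range Q.T,
          ∫ ω, ‖(B.ySt Q x0 y0 v0 (fun s => X s ω) k t).D‖ ^ 2 ∂P) else 0 := by
  have h := fun ω => sq_norm_sub_vSt_le B Q x0 y0 v0 (fun s => X s ω) k j
  by_cases hj : j = 0
  · have hxn := memLp_xnext' (x0 := x0) (y0 := y0) hc hB hX hQ hv0 k
    have hY := sqIntY (x0 := x0) (y0 := y0) hc hB hX hQ hv0 k
    have hV := sqIntV (x0 := x0) (y0 := y0) hc hB hX hQ hv0 k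
    have hDx := (memLp_chain_Dx hc hB hX hQ hv0 (hV 0)).integrable_sq_norm
    have h0 : Integrable (fun ω => ‖(B.ySt Q x0 y0 v0 (fun s => X s ω) k Q.T).y -
        (B.chain Q x0 y0 v0 (fun s => X s ω) k).y‖ ^ 2) P :=
      ((hY Q.T).y.sub (hY 0).y).integrable_sq_norm
    simp only [if_pos hj] at h ⊢
    have h1 := (hxn.sub (hV j).x).integrable_sq_norm
    have h2 := ((hY Q.T).y.sub (hV j).y).integrable_sq_norm
    exact (integral_mono (h1.add h2) ((hDx.const_mul _).add h0) h).trans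
      (integral_drift_le hc hB hX hQ hv0 k)
  · simp only [if_neg hj] at h ⊢
    exact integral_nonpos h

/-- Accumulated errors of the estimators of `d_x` and `d_v` over one inner loop. -/
lemma sum_errX_le (hc : c.Valid) (hB : B.Assumptions c.toConsts) (hX : B.IsSampling P X)
    (hQ : Q.Admissible c) (hv0 : ‖v0‖ ≤ c.M) (k : ℕ) :
    (∫ ω, ‖B.errX (B.vSt Q x0 y0 v0 (fun s => X s ω) k Q.J)‖ ^ 2 ∂P +
      Q.taux * ∑ j ∈ Finset.range Q.J,
        ∫ ω, ‖B.errX (B.vSt Q x0 y0 v0 (fun s => X s ω) k j)‖ ^ 2 ∂P ≤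
    ∫ ω, ‖B.errX (B.vSt Q x0 y0 v0 (fun s => X s ω) k 0)‖ ^ 2 ∂P +
      2 / Q.S2 * (Q.J * (Q.taux ^ 2 * c.VX) + (c.M1 * (Q.alpha ^ 2 *
        ∫ ω, ‖(B.chain Q x0 y0 v0 (fun s => X s ω) k).Dx‖ ^ 2 ∂P +
        Q.T * ((Q.lam1 * Q.beta) ^ 2 * ∑ t ∈ Finset.range Q.T,
          ∫ ω, ‖(B.ySt Q x0 y0 v0 (fun s => X s ω) k t).D‖ ^ 2 ∂P)) +
        2 * c.Lg ^ 2 * ((Q.lam2 * Q.eta) ^ 2 * ∑ j ∈ Finset.range Q.J,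
          ∫ ω, ‖(B.vSt Q x0 y0 v0 (fun s => X s ω) k j).Dv‖ ^ 2 ∂P)))) ∧
    (∫ ω, ‖B.errV (B.vSt Q x0 y0 v0 (fun s => X s ω) k Q.J)‖ ^ 2 ∂P +
      Q.tauv * ∑ j ∈ Finset.range Q.J,
        ∫ ω, ‖B.errV (B.vSt Q x0 y0 v0 (fun s => X s ω) k j)‖ ^ 2 ∂P ≤
    ∫ ω, ‖B.errV (B.vSt Q x0 y0 v0 (fun s => X s ω) k 0)‖ ^ 2 ∂P +
      2 / Q.S2 * (Q.J * (Q.tauv ^ 2 * c.VX) + (c.M1 * (Q.alpha ^ 2 *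
        ∫ ω, ‖(B.chain Q x0 y0 v0 (fun s => X s ω) k).Dx‖ ^ 2 ∂P +
        Q.T * ((Q.lam1 * Q.beta) ^ 2 * ∑ t ∈ Finset.range Q.T,
          ∫ ω, ‖(B.ySt Q x0 y0 v0 (fun s => X s ω) k t).D‖ ^ 2 ∂P)) +
        2 * c.Lg ^ 2 * ((Q.lam2 * Q.eta) ^ 2 * ∑ j ∈ Finset.range Q.J,
          ∫ ω, ‖(B.vSt Q x0 y0 v0 (fun s => X s ω) k j).Dv‖ ^ 2 ∂P)))) := by
  have hxn := memLp_xnext' (x0 := x0) (y0 := y0) hc hB hX hQ hv0 k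
  have hY := sqIntY (x0 := x0) (y0 := y0) hc hB hX hQ hv0 k
  have hV := sqIntV (x0 := x0) (y0 := y0) hc hB hX hQ hv0 k
  have hyn := (hY Q.T).y
  have hS : (0 : ℝ) < Q.S2 := by exact_mod_cast hQ.S2_pos
  have hu : ∀ j, Integrable (fun ω => ‖B.xnext Q x0 y0 v0 (fun s => X s ω) k -
      (B.vSt Q x0 y0 v0 (fun s => X s ω) k j).x‖ ^ 2 +
      ‖(B.ySt Q x0 y0 v0 (fun s => X s ω) k Q.T).y -
        (B.vSt Q x0 y0 v0 (fun s => X s ω) k j).y‖ ^ 2) P := fun j =>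
    ((hxn.sub (hV j).x).integrable_sq_norm).add ((hyn.sub (hV j).y).integrable_sq_norm)
  have hw : ∀ j, Integrable (fun ω => ‖(B.vSt Q x0 y0 v0 (fun s => X s ω) k j).Dv‖ ^ 2) P :=
    fun j => (memLp_vSt_Dv hc hB hX hQ hv0 (hV j)).integrable_sq_norm
  have ha : 0 ≤ Q.alpha ^ 2 * ∫ ω, ‖(B.chain Q x0 y0 v0 (fun s => X s ω) k).Dx‖ ^ 2 ∂P +
      Q.T * ((Q.lam1 * Q.beta) ^ 2 * ∑ t ∈ Finset.range Q.T,
        ∫ ω, ‖(B.ySt Q x0 y0 v0 (fun s => X s ω) k t).D‖ ^ 2 ∂P) :=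
    add_nonneg (mul_nonneg (sq_nonneg _) (integral_nonneg fun _ => sq_nonneg _))
      (mul_nonneg (Nat.cast_nonneg _) (mul_nonneg (sq_nonneg _)
        (Finset.sum_nonneg fun _ _ => integral_nonneg fun _ => sq_nonneg _)))
  have hd := integral_drift_vSt_le (x0 := x0) (y0 := y0) hc hB hX hQ hv0 k
  exact ⟨add_mul_sum_le_of_drift
      (e := fun j => ∫ ω, ‖B.errX (B.vSt Q x0 y0 v0 (fun s => X s ω) k j)‖ ^ 2 ∂P)
      hu hw ha hd hS c.M1_nonneg fun j => (step_errX hc hB hX hQ hv0 hxn hyn (hV j)).2.1,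
    add_mul_sum_le_of_drift
      (e := fun j => ∫ ω, ‖B.errV (B.vSt Q x0 y0 v0 (fun s => X s ω) k j)‖ ^ 2 ∂P)
      hu hw ha hd hS c.M1_nonneg fun j => (step_errX hc hB hX hQ hv0 hxn hyn (hV j)).2.2⟩

end Moments

end ALS

end

noncomputable section

namespace ALS

/-- Step sizes for which the three potentials decrease along the iterations. -/
structure Params.StepSizes (Q : Params) (c : Setup) : Prop where
  mu_le : c.mu ≤ c.Lg
  alpha_pos : 0 < Q.alpha
  gam_pos : 0 < Q.lam1 * Q.beta
  gam_le : Q.lam1 * Q.beta ≤ 1 / (2 * (c.Lg + c.mu))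
  rho_pos : 0 < Q.lam2 * Q.eta
  rho_le : Q.lam2 * Q.eta ≤ 1 / (2 * (c.Lg + c.mu))
  alpha_gam : (96 * c.Cy ^ 2 + 8 * c.M1) * Q.alpha ≤ Q.lam1 * Q.beta * c.mu
  rho_gam : 128 * c.M1 * Q.J * (Q.lam2 * Q.eta) ≤ Q.lam1 * Q.beta * c.mu ^ 2
  alpha_rho : 48 * (c.Lg ^ 2 + c.Cv ^ 2) * Q.alpha ≤ Q.lam2 * Q.eta * c.mu
  alpha_smooth : Q.alpha * ((c.Lg + c.mu) * c.Cv) ≤ 1 / 192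

/-! ### Decrease of the potential along a sample path -/

section Pathwise

variable {p q : ℕ} {Ξ Z : Type*} [MeasurableSpace Ξ] [MeasurableSpace Z] {c : Setup}
  {B : Bilevel p q Ξ Z} {Q : Params}

lemma step_size_le {g L m : ℝ} (hm : 0 < m) (hmL : m ≤ L) (h : g ≤ 1 / (2 * (L + m))) :
    g ≤ 1 / (2 * L) ∧ g * m ≤ 1 / 4 := by
  have hL : 0 < L := hm.trans_le hmL
  refine ⟨h.trans (one_div_le_one_div_of_le (by positivity) (by linarith)), ?_⟩
  rw [le_div_iff₀ (by positivity)] at h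
  rcases le_or_gt g 0 with hg | hg
  · nlinarith
  · nlinarith

lemma sq_norm_gradY_step_le (hc : c.Valid) (hB : B.Assumptions c.toConsts)
    {g : ℝ} (hmL : c.mu ≤ c.Lg) (hg : 0 < g) (hgL : g ≤ 1 / (2 * (c.Lg + c.mu)))
    (x : Vec p) (y D : Vec q) :
    ‖y - g • D - B.ystar x‖ ^ 2 ≤ (1 - g * c.mu / 2) * ‖y - B.ystar x‖ ^ 2 -
      g / (4 * c.Lg) * ‖D‖ ^ 2 + 5 * g / c.mu * ‖D - gradY B.g x y‖ ^ 2 := by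
  have hm := hc.mu_pos
  have hL : 0 < c.Lg := hm.trans_le hmL
  have h1 := inner_gradY_sub_ge hB.contDiff_g_one (hB.regular.strong_g x) y (B.ystar x)
  have h2 := cocoercive_gradY hB.contDiff_g_one hm.le (hB.regular.strong_g x) hL
    hB.lower_g.lip_grad y (B.ystar x)
  rw [gradY_ystar hc hB, sub_zero] at h1 h2
  have h3 := norm_sub_smul_sq_le hm hL hg.le (step_size_le hm hmL hgL).1 hmL (D := D) h1 h2
  rwa [sub_right_comm] at h3

/-- The step is an inexact gradient step for the Hessian at y*(x). The total error splits into that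
of the estimator and the bias of using y instead of y*(x), whence the term with `M1`. -/
lemma sq_norm_projBall_step_le (hc : c.Valid) (hB : B.Assumptions c.toConsts)
    {g : ℝ} (hmL : c.mu ≤ c.Lg) (hg : 0 < g) (hgL : g ≤ 1 / (2 * (c.Lg + c.mu)))
    (x : Vec p) (y v D : Vec q) (hv : ‖v‖ ≤ c.M) :
    ‖projBall c.M (v - g • D) - B.vstar x‖ ^ 2 ≤
      (1 - g * c.mu / 2) * ‖v - B.vstar x‖ ^ 2 - g / (4 * c.Lg) * ‖D‖ ^ 2 +
      5 * g / c.mu * (2 * ‖D - B.dv x y v‖ ^ 2 + c.M1 * ‖y - B.ystar x‖ ^ 2) := by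
  have hm := hc.mu_pos
  have hL : 0 < c.Lg := hm.trans_le hmL
  have h1 := inner_hessY_ge hB.regular.contDiff_g (hB.regular.strong_g x) (B.ystar x)
    (v - B.vstar x)
  have h2 := cocoercive_hessY hB.regular.contDiff_g hm.le (hB.regular.strong_g x) hL
    hB.lower_g.lip_grad (B.ystar x) (v - B.vstar x)
  have h3 := norm_sub_smul_sq_le hm hL hg.le (step_size_le hm hmL hgL).1 hmL (D := D) h1 h2
  have h4 := pow_le_pow_left₀ (norm_nonneg _)
    (norm_projBall_sub_le hc.M_nonneg (v - g • D) (norm_vstar_le hc hB x)) 2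
  rw [sub_right_comm] at h4
  refine h4.trans (h3.trans (add_le_add_right ?_ _))
  have h5 := sq_norm_dv_sub_hessY_le hc hB x y v hv
  have h6 := sq_norm_add_le (D - B.dv x y v)
    (B.dv x y v - hessY B.g x (B.ystar x) (v - B.vstar x))
  rw [sub_add_sub_cancel] at h6
  refine mul_le_mul_of_nonneg_left ?_ (by positivity)
  linarith

/-- Polarization of the inner product in the descent lemma produces −α/2 ‖∇Φ‖² − α/2 ‖D‖² + α/2 ‖D −
∇Φ‖². The last term splits into the estimator error and the bias from y and v. -/
lemma Phi_step_le (hc : c.Valid) (hB : B.Assumptions c.toConsts) {α : ℝ} (hα : 0 < α)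
    (x D : Vec p) (y v : Vec q) (hv : ‖v‖ ≤ c.M) :
    B.Phi (x - α • D) ≤ B.Phi x - α / 2 * ‖B.gradPhi x‖ ^ 2 -
      (α / 2 - (c.Lg + c.mu) * c.Cv * α ^ 2 / 2) * ‖D‖ ^ 2 + α * ‖D - B.dx x y v‖ ^ 2 +
      α * c.M1 * ‖y - B.ystar x‖ ^ 2 + 2 * α * c.Lg ^ 2 * ‖v - B.vstar x‖ ^ 2 := by
  have h1 := Phi_descent hc hB x (x - α • D)
  have h2 := norm_sub_sq_real D (B.gradPhi x)
  have h3 := sq_norm_dx_sub_gradPhi_le hc hB x y v hv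
  have h4 := sq_norm_add_le (D - B.dx x y v) (B.dx x y v - B.gradPhi x)
  rw [sub_add_sub_cancel] at h4
  rw [sub_sub_cancel_left, norm_neg, norm_smul, inner_neg_right, inner_smul_right,
    real_inner_comm, mul_pow, Real.norm_eq_abs, sq_abs] at h1
  have h5 : α * ‖D - B.gradPhi x‖ ^ 2 ≤ α * (2 * ‖D - B.dx x y v‖ ^ 2 + 2 *
      (c.M1 * ‖y - B.ystar x‖ ^ 2 + 2 * c.Lg ^ 2 * ‖v - B.vstar x‖ ^ 2)) :=
    mul_le_mul_of_nonneg_left (by linarith) hα.le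
  rw [h2] at h5
  linarith

/-- A contraction step followed by a shift of the target. -/
lemma shift_contraction_le {s m a b r : ℝ} (hs : 0 < s) (hs4 : s ≤ 1 / 4) (ha : 0 ≤ a)
    (hb : 0 ≤ b) (hr : 0 ≤ r) (h : m ≤ (1 - s / 2) * a - b + r) :
    (1 + s / 4) * m ≤ (1 - s / 4) * a - b + 17 / 16 * r := by
  have h1 : (1 + s / 4) * m ≤ (1 + s / 4) * ((1 - s / 2) * a - b + r) :=
    mul_le_mul_of_nonneg_left h (by linarith)
  nlinarith [mul_nonneg hs.le hb, mul_nonneg (sub_nonneg.2 hs4) hr, mul_nonneg hs.le ha,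
    mul_nonneg (mul_nonneg hs.le hs.le) ha]

variable {x0 : Vec p} {y0 v0 : Vec q} {ω : Slot → Ξ × Z}

/-- The first inner step uses the estimator at the old x and contracts towards y*(x_k); moving the
target to y*(x_{k+1}) costs half of this contraction. Later steps already aim at the new target;
their contraction is dropped and only −‖D‖² is kept. -/
lemma sq_norm_ySt_sub_ystar_le (hc : c.Valid) (hB : B.Assumptions c.toConsts)
    (hQ : Q.StepSizes c) (k n : ℕ) :
    ‖(B.ySt Q x0 y0 v0 ω k (n + 1)).y - B.ystar (B.xnext Q x0 y0 v0 ω k)‖ ^ 2 ≤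
      (1 - Q.lam1 * Q.beta * c.mu / 4) *
        ‖(B.chain Q x0 y0 v0 ω k).y - B.ystar (B.chain Q x0 y0 v0 ω k).x‖ ^ 2 -
      Q.lam1 * Q.beta / (4 * c.Lg) *
        ∑ t ∈ Finset.range (n + 1), ‖(B.ySt Q x0 y0 v0 ω k t).D‖ ^ 2 +
      6 * (Q.lam1 * Q.beta) / c.mu *
        ∑ t ∈ Finset.range (n + 1), ‖B.errY (B.ySt Q x0 y0 v0 ω k t)‖ ^ 2 +
      Q.alpha / 12 * ‖(B.chain Q x0 y0 v0 ω k).Dx‖ ^ 2 := by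
  have hm := hc.mu_pos
  have hL : 0 < c.Lg := hm.trans_le hQ.mu_le
  have hg := hQ.gam_pos
  have hα := hQ.alpha_pos
  obtain ⟨-, hs4⟩ := step_size_le hm hQ.mu_le hQ.gam_le
  have hs : 0 < Q.lam1 * Q.beta * c.mu := mul_pos hg hm
  induction n with
  | zero =>
    set st := B.chain Q x0 y0 v0 ω k
    have e1 : (B.ySt Q x0 y0 v0 ω k (0 + 1)).y = st.y - (Q.lam1 * Q.beta) • st.Dy := rfl
    have e2 : B.errY (B.ySt Q x0 y0 v0 ω k 0) = st.Dy - gradY B.g st.x st.y := rfl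
    have e3 : (B.ySt Q x0 y0 v0 ω k 0).D = st.Dy := rfl
    rw [zero_add, Finset.sum_range_one, Finset.sum_range_one, ← zero_add 1, e1, e2, e3]
    have h1 := sq_norm_gradY_step_le hc hB hQ.mu_le hg hQ.gam_le st.x st.y st.Dy
    -- With this θ the shift costs 8 C_y² α²/(γμ) ‖D^x‖², where γ = λ₁β. This is at most α/12 ‖D^x‖²
    -- because 96 C_y² α ≤ γμ.
    have h2 := sq_dist_shift_le (u := st.y - (Q.lam1 * Q.beta) • st.Dy) (w := B.ystar st.x)
      (z := B.ystar (B.xnext Q x0 y0 v0 ω k)) (θ := Q.lam1 * Q.beta * c.mu / 4) (by positivity)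
      (by linarith)
    have h3 := shift_contraction_le hs hs4 (sq_nonneg _)
      (by positivity : 0 ≤ Q.lam1 * Q.beta / (4 * c.Lg) * ‖st.Dy‖ ^ 2) (by positivity) h1
    have h4 : ‖B.ystar st.x - B.ystar (B.xnext Q x0 y0 v0 ω k)‖ ^ 2 ≤
        c.Cy ^ 2 * (Q.alpha ^ 2 * ‖st.Dx‖ ^ 2) := by
      have := pow_le_pow_left₀ (norm_nonneg _)
        (norm_ystar_sub_le hc hB st.x (B.xnext Q x0 y0 v0 ω k)) 2
      have e : st.x - B.xnext Q x0 y0 v0 ω k = Q.alpha • st.Dx := sub_sub_cancel _ _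
      rwa [e, norm_smul, mul_pow, mul_pow, Real.norm_eq_abs, sq_abs] at this
    have h5 : 2 / (Q.lam1 * Q.beta * c.mu / 4) *
        ‖B.ystar st.x - B.ystar (B.xnext Q x0 y0 v0 ω k)‖ ^ 2 ≤
        Q.alpha / 12 * ‖st.Dx‖ ^ 2 := by
      have h6 : 96 * c.Cy ^ 2 * Q.alpha ≤ Q.lam1 * Q.beta * c.mu := by
        have := hQ.alpha_gam
        nlinarith [mul_nonneg c.M1_nonneg hα.le]
      rw [div_mul_eq_mul_div, div_le_iff₀ (by positivity)]
      nlinarith [mul_le_mul_of_nonneg_right h6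
        (by positivity : 0 ≤ Q.alpha * ‖st.Dx‖ ^ 2)]
    have h7 : 0 ≤ Q.lam1 * Q.beta / c.mu * ‖st.Dy - gradY B.g st.x st.y‖ ^ 2 := by positivity
    have h8 : 17 / 16 * (5 * (Q.lam1 * Q.beta) / c.mu * ‖st.Dy - gradY B.g st.x st.y‖ ^ 2) ≤
        6 * (Q.lam1 * Q.beta) / c.mu * ‖st.Dy - gradY B.g st.x st.y‖ ^ 2 := by
      have e : ∀ r X : ℝ, r * (Q.lam1 * Q.beta) / c.mu * X = r * (Q.lam1 * Q.beta / c.mu * X) :=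
        fun r X => by ring
      rw [e, e]; linarith
    linarith
  | succ n ih =>
    set st := B.ySt Q x0 y0 v0 ω k (n + 1) with hst
    have e1 : (B.ySt Q x0 y0 v0 ω k (n + 1 + 1)).y = st.y - (Q.lam1 * Q.beta) • st.D := rfl
    have e2 : B.errY st = st.D - gradY B.g (B.xnext Q x0 y0 v0 ω k) st.y := rfl
    rw [Finset.sum_range_succ _ (n + 1), Finset.sum_range_succ _ (n + 1), e1, ← hst, e2]
    have h1 := sq_norm_gradY_step_le hc hB hQ.mu_le hg hQ.gam_le (B.xnext Q x0 y0 v0 ω k) st.y st.D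
    have h2 : 0 ≤ Q.lam1 * Q.beta * c.mu / 2 *
      ‖st.y - B.ystar (B.xnext Q x0 y0 v0 ω k)‖ ^ 2 := by positivity
    have h7 : 0 ≤ Q.lam1 * Q.beta / c.mu *
      ‖st.D - gradY B.g (B.xnext Q x0 y0 v0 ω k) st.y‖ ^ 2 := by positivity
    have e : ∀ r X : ℝ, r * (Q.lam1 * Q.beta) / c.mu * X = r * (Q.lam1 * Q.beta / c.mu * X) :=
      fun r X => by ring
    rw [e] at h1 ih ⊢
    rw [mul_add (Q.lam1 * Q.beta / c.mu)]
    linarith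

/-- Same scheme as for y. The bias of the first step is measured at (x_k, y_k) and that of the other
`n` steps at (x_{k+1}, y_{k+1}), hence the two different y-errors. -/
lemma sq_norm_vSt_sub_vstar_le (hc : c.Valid) (hB : B.Assumptions c.toConsts)
    (hQ : Q.StepSizes c) (hM : Q.M = c.M) (hv0 : ‖v0‖ ≤ c.M) (k n : ℕ) :
    ‖(B.vSt Q x0 y0 v0 ω k (n + 1)).v - B.vstar (B.xnext Q x0 y0 v0 ω k)‖ ^ 2 ≤
      (1 - Q.lam2 * Q.eta * c.mu / 4) *
        ‖(B.chain Q x0 y0 v0 ω k).v - B.vstar (B.chain Q x0 y0 v0 ω k).x‖ ^ 2 -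
      Q.lam2 * Q.eta / (4 * c.Lg) *
        ∑ j ∈ Finset.range (n + 1), ‖(B.vSt Q x0 y0 v0 ω k j).Dv‖ ^ 2 +
      12 * (Q.lam2 * Q.eta) / c.mu *
        ∑ j ∈ Finset.range (n + 1), ‖B.errV (B.vSt Q x0 y0 v0 ω k j)‖ ^ 2 +
      6 * (Q.lam2 * Q.eta) * c.M1 / c.mu *
        (‖(B.chain Q x0 y0 v0 ω k).y - B.ystar (B.chain Q x0 y0 v0 ω k).x‖ ^ 2 +
        n * ‖(B.ySt Q x0 y0 v0 ω k Q.T).y - B.ystar (B.xnext Q x0 y0 v0 ω k)‖ ^ 2) +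
      Q.alpha / 6 * ‖(B.chain Q x0 y0 v0 ω k).Dx‖ ^ 2 := by
  have hm := hc.mu_pos
  have hL : 0 < c.Lg := hm.trans_le hQ.mu_le
  have hM1 := c.M1_nonneg
  have hg := hQ.rho_pos
  have hα := hQ.alpha_pos
  have hv : ∀ j, ‖(B.vSt Q x0 y0 v0 ω k j).v‖ ≤ c.M := fun j => by
    rw [← hM]
    exact norm_vSt_le (hM ▸ hc.M_nonneg) (hM ▸ hv0) k j
  obtain ⟨-, hs4⟩ := step_size_le hm hQ.mu_le hQ.rho_le
  have hs : 0 < Q.lam2 * Q.eta * c.mu := mul_pos hg hm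
  induction n with
  | zero =>
    set st := B.chain Q x0 y0 v0 ω k
    have e1 : (B.vSt Q x0 y0 v0 ω k (0 + 1)).v = projBall c.M (st.v - (Q.lam2 * Q.eta) • st.Dv) := by
      rw [← hM]; rfl
    have e2 : B.errV (B.vSt Q x0 y0 v0 ω k 0) = st.Dv - B.dv st.x st.y st.v := rfl
    have e3 : (B.vSt Q x0 y0 v0 ω k 0).Dv = st.Dv := rfl
    rw [zero_add, Finset.sum_range_one, Finset.sum_range_one, ← zero_add 1, e1, e2, e3,
      Nat.cast_zero, zero_mul, add_zero]
    have h1 := sq_norm_projBall_step_le hc hB hQ.mu_le hg hQ.rho_le st.x st.y st.v st.Dv (hv 0)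
    have h2 := sq_dist_shift_le (u := projBall c.M (st.v - (Q.lam2 * Q.eta) • st.Dv))
      (w := B.vstar st.x) (z := B.vstar (B.xnext Q x0 y0 v0 ω k))
      (θ := Q.lam2 * Q.eta * c.mu / 4) (by positivity) (by linarith)
    have h3 := shift_contraction_le hs hs4 (sq_nonneg _)
      (by positivity : 0 ≤ Q.lam2 * Q.eta / (4 * c.Lg) * ‖st.Dv‖ ^ 2) (by positivity) h1
    have h4 : ‖B.vstar st.x - B.vstar (B.xnext Q x0 y0 v0 ω k)‖ ^ 2 ≤
        c.Cv ^ 2 * (Q.alpha ^ 2 * ‖st.Dx‖ ^ 2) := by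
      have := pow_le_pow_left₀ (norm_nonneg _)
        (norm_vstar_sub_le hc hB st.x (B.xnext Q x0 y0 v0 ω k)) 2
      have e : st.x - B.xnext Q x0 y0 v0 ω k = Q.alpha • st.Dx := sub_sub_cancel _ _
      rwa [e, norm_smul, mul_pow, mul_pow, Real.norm_eq_abs, sq_abs] at this
    have h5 : 2 / (Q.lam2 * Q.eta * c.mu / 4) *
        ‖B.vstar st.x - B.vstar (B.xnext Q x0 y0 v0 ω k)‖ ^ 2 ≤
        Q.alpha / 6 * ‖st.Dx‖ ^ 2 := by
      have h6 : 48 * c.Cv ^ 2 * Q.alpha ≤ Q.lam2 * Q.eta * c.mu := by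
        have := hQ.alpha_rho
        nlinarith [mul_nonneg (sq_nonneg c.Lg) hα.le]
      rw [div_mul_eq_mul_div, div_le_iff₀ (by positivity)]
      nlinarith [mul_le_mul_of_nonneg_right h6
        (by positivity : 0 ≤ Q.alpha * ‖st.Dx‖ ^ 2)]
    have h7 : 0 ≤ Q.lam2 * Q.eta / c.mu * ‖st.Dv - B.dv st.x st.y st.v‖ ^ 2 := by positivity
    have h8 : 0 ≤ Q.lam2 * Q.eta / c.mu * (c.M1 * ‖st.y - B.ystar st.x‖ ^ 2) := by positivity
    have e4 : 17 / 16 * (5 * (Q.lam2 * Q.eta) / c.mu * (2 * ‖st.Dv - B.dv st.x st.y st.v‖ ^ 2 +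
        c.M1 * ‖st.y - B.ystar st.x‖ ^ 2)) =
        85 / 8 * (Q.lam2 * Q.eta / c.mu * ‖st.Dv - B.dv st.x st.y st.v‖ ^ 2) +
        85 / 16 * (Q.lam2 * Q.eta / c.mu * (c.M1 * ‖st.y - B.ystar st.x‖ ^ 2)) := by ring
    have e5 : 12 * (Q.lam2 * Q.eta) / c.mu * ‖st.Dv - B.dv st.x st.y st.v‖ ^ 2 =
      12 * (Q.lam2 * Q.eta / c.mu * ‖st.Dv - B.dv st.x st.y st.v‖ ^ 2) := by ring
    have e6 : 6 * (Q.lam2 * Q.eta) * c.M1 / c.mu * ‖st.y - B.ystar st.x‖ ^ 2 =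
      6 * (Q.lam2 * Q.eta / c.mu * (c.M1 * ‖st.y - B.ystar st.x‖ ^ 2)) := by ring
    linarith
  | succ n ih =>
    set st := B.vSt Q x0 y0 v0 ω k (n + 1) with hst
    set x' := B.xnext Q x0 y0 v0 ω k
    set y' := (B.ySt Q x0 y0 v0 ω k Q.T).y
    have e1 : (B.vSt Q x0 y0 v0 ω k (n + 1 + 1)).v =
        projBall c.M (st.v - (Q.lam2 * Q.eta) • st.Dv) := by
      rw [← hM]; rfl
    have e2 : B.errV st = st.Dv - B.dv x' y' st.v := rfl
    rw [Finset.sum_range_succ _ (n + 1), Finset.sum_range_succ _ (n + 1), e1, ← hst, e2]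
    have h1 := sq_norm_projBall_step_le hc hB hQ.mu_le hg hQ.rho_le x' y' st.v st.Dv (hv (n + 1))
    have h2 : 0 ≤ Q.lam2 * Q.eta * c.mu / 2 * ‖st.v - B.vstar x'‖ ^ 2 := by positivity
    have h7 : 0 ≤ Q.lam2 * Q.eta / c.mu * ‖st.Dv - B.dv x' y' st.v‖ ^ 2 := by positivity
    have h8 : 0 ≤ Q.lam2 * Q.eta / c.mu * (c.M1 * ‖y' - B.ystar x'‖ ^ 2) := by positivity
    have e4 : 5 * (Q.lam2 * Q.eta) / c.mu * (2 * ‖st.Dv - B.dv x' y' st.v‖ ^ 2 +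
        c.M1 * ‖y' - B.ystar x'‖ ^ 2) =
        10 * (Q.lam2 * Q.eta / c.mu * ‖st.Dv - B.dv x' y' st.v‖ ^ 2) +
        5 * (Q.lam2 * Q.eta / c.mu * (c.M1 * ‖y' - B.ystar x'‖ ^ 2)) := by ring
    have e5 : ∀ A : ℝ, 12 * (Q.lam2 * Q.eta) / c.mu * (A + ‖st.Dv - B.dv x' y' st.v‖ ^ 2) =
      12 * (Q.lam2 * Q.eta) / c.mu * A +
        12 * (Q.lam2 * Q.eta / c.mu * ‖st.Dv - B.dv x' y' st.v‖ ^ 2) := fun A => by ring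
    have e6 : ∀ A : ℝ, 6 * (Q.lam2 * Q.eta) * c.M1 / c.mu *
        (A + (n + 1 : ℕ) * ‖y' - B.ystar x'‖ ^ 2) =
      6 * (Q.lam2 * Q.eta) * c.M1 / c.mu * (A + n * ‖y' - B.ystar x'‖ ^ 2) +
      6 * (Q.lam2 * Q.eta / c.mu * (c.M1 * ‖y' - B.ystar x'‖ ^ 2)) := fun A => by
        push_cast; ring
    rw [e5, e6, mul_add]
    linarith

/-- The potential `Φ + ‖y - y*(x)‖² + ‖v - v*(x)‖²`. -/
def Bilevel.potential (B : Bilevel p q Ξ Z) (st : OuterState p q) : ℝ :=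
  B.Phi st.x + ‖st.y - B.ystar st.x‖ ^ 2 + ‖st.v - B.vstar st.x‖ ^ 2

/-- A budget computation. The gain γμ/4 on dy covers α M1 ≤ γμ/8 from Φ and two couplings from v,
each at most 6γμ/128. The gain ρμ/4 on dv covers 2αL² ≤ ρμ/24. Of the α/2 on D, the target shifts
take α/12 + α/6 and smoothness and coupling very little, so α/5 survives. -/
lemma combine_potentials {α γ ρ μ L M1 Lt F F' dy dy' dv dv' G D eX eY eV SY SV n J : ℝ}
    (hα : 0 < α) (hμ : 0 < μ) (hγ : 0 < γ) (hρ : 0 < ρ) (hγ4 : γ * μ ≤ 1 / 4)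
    (hM1 : 0 ≤ M1) (hJ : n + 1 = J) (hn : 0 ≤ n) (hdy : 0 ≤ dy) (hdv : 0 ≤ dv) (hD : 0 ≤ D)
    (heY : 0 ≤ eY) (hSY : 0 ≤ SY) (hL : 0 < L)
    (h1 : 8 * M1 * α ≤ γ * μ) (h2 : 128 * M1 * J * ρ ≤ γ * μ ^ 2)
    (h3 : 48 * L ^ 2 * α ≤ ρ * μ) (h4 : α * Lt ≤ 1 / 192)
    (hF : F' ≤ F - α / 2 * G - (α / 2 - Lt * α ^ 2 / 2) * D + α * eX + α * M1 * dy +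
      2 * α * L ^ 2 * dv)
    (hy : dy' ≤ (1 - γ * μ / 4) * dy - γ / (4 * L) * SY + 6 * γ / μ * eY + α / 12 * D)
    (hv : dv' ≤ (1 - ρ * μ / 4) * dv - ρ / (4 * L) * SV + 12 * ρ / μ * eV +
      6 * ρ * M1 / μ * (dy + n * dy') + α / 6 * D) :
    F' + dy' + dv' + α / 2 * G + α / 5 * D + γ / (4 * L) * SY + ρ / (4 * L) * SV ≤
      F + dy + dv + α * eX + 7 * γ / μ * eY + 12 * ρ / μ * eV := by
  set κ := 6 * ρ * M1 / μ with hκ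
  have hκ0 : 0 ≤ κ := by positivity
  have hκJ : κ * J ≤ 6 / 128 * (γ * μ) := by
    rw [hκ, div_mul_eq_mul_div, div_le_iff₀ hμ]
    linarith
  have hκ1 : κ ≤ 6 / 128 * (γ * μ) := by
    have : κ * 1 ≤ κ * J := mul_le_mul_of_nonneg_left (by linarith) hκ0
    linarith
  -- The v-inequality contains dy' itself, so the y-inequality is used once more with the small
  -- factor κn; this raises the coefficient 6 of the y-errors to at most 7.
  have hκn : κ * n ≤ 6 / 128 * (γ * μ) :=
    (mul_le_mul_of_nonneg_left (by linarith) hκ0).trans hκJ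
  have hκn0 : 0 ≤ κ * n := mul_nonneg hκ0 hn
  have hκn' : κ * n ≤ 1 / 64 := by linarith
  have hγμ : 0 < γ * μ := mul_pos hγ hμ
  set E := γ / μ * eY with hE
  have hE0 : 0 ≤ E := by positivity
  set R := γ / (4 * L) * SY with hR
  have hR0 : 0 ≤ R := by positivity
  have e1 : 6 * γ / μ * eY = 6 * E := by rw [hE]; ring
  have e2 : 7 * γ / μ * eY = 7 * E := by rw [hE]; ring
  rw [e1] at hy
  rw [e2]
  have hy2 := mul_le_mul_of_nonneg_left hy hκn0
  have b1 : κ * n * E ≤ 1 / 64 * E := mul_le_mul_of_nonneg_right hκn' hE0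
  have hαD : 0 ≤ α * D := mul_nonneg hα.le hD
  have b2 : κ * n * (α * D) ≤ 1 / 64 * (α * D) := mul_le_mul_of_nonneg_right hκn' hαD
  have b3 : 0 ≤ κ * n * R := mul_nonneg hκn0 hR0
  have b4 : κ * n * dy ≤ 6 / 128 * (γ * μ) * dy := mul_le_mul_of_nonneg_right hκn hdy
  have b5 : κ * dy ≤ 6 / 128 * (γ * μ) * dy := mul_le_mul_of_nonneg_right hκ1 hdy
  have b6 : 0 ≤ κ * n * (γ * μ) * dy := mul_nonneg (mul_nonneg hκn0 hγμ.le) hdy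
  have b7 : 8 * M1 * α * dy ≤ γ * μ * dy := mul_le_mul_of_nonneg_right h1 hdy
  have b8 : 48 * L ^ 2 * α * dv ≤ ρ * μ * dv := mul_le_mul_of_nonneg_right h3 hdv
  have b9 : α * Lt * (α * D) ≤ 1 / 192 * (α * D) := mul_le_mul_of_nonneg_right h4 hαD
  have b10 : 0 ≤ γ * μ * dy := mul_nonneg hγμ.le hdy
  have b11 : 0 ≤ ρ * μ * dv := by positivity
  have e3 : κ * n * ((1 - γ * μ / 4) * dy - R + 6 * E + α / 12 * D) =
    κ * n * dy - κ * n * (γ * μ) * dy / 4 - κ * n * R + 6 * (κ * n * E) +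
      κ * n * (α * D) / 12 := by ring
  rw [e3] at hy2
  have e4 : κ * (dy + n * dy') = κ * dy + κ * n * dy' := by ring
  rw [e4] at hv
  have e5 : (α / 2 - Lt * α ^ 2 / 2) * D = α * D / 2 - α * Lt * (α * D) / 2 := by ring
  rw [e5] at hF
  linarith

lemma potential_step_le (hc : c.Valid) (hB : B.Assumptions c.toConsts)
    (hQ : Q.StepSizes c) (hM : Q.M = c.M) (hT : 0 < Q.T) (hJ : 0 < Q.J) (hv0 : ‖v0‖ ≤ c.M)
    (k : ℕ) :
    B.potential (B.chain Q x0 y0 v0 ω (k + 1)) +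
      Q.alpha / 2 * ‖B.gradPhi (B.chain Q x0 y0 v0 ω k).x‖ ^ 2 +
      Q.alpha / 5 * ‖(B.chain Q x0 y0 v0 ω k).Dx‖ ^ 2 +
      Q.lam1 * Q.beta / (4 * c.Lg) *
        ∑ t ∈ Finset.range Q.T, ‖(B.ySt Q x0 y0 v0 ω k t).D‖ ^ 2 +
      Q.lam2 * Q.eta / (4 * c.Lg) *
        ∑ j ∈ Finset.range Q.J, ‖(B.vSt Q x0 y0 v0 ω k j).Dv‖ ^ 2 ≤
    B.potential (B.chain Q x0 y0 v0 ω k) +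
      Q.alpha * ‖B.errX (B.vSt Q x0 y0 v0 ω k 0)‖ ^ 2 +
      7 * (Q.lam1 * Q.beta) / c.mu *
        ∑ t ∈ Finset.range Q.T, ‖B.errY (B.ySt Q x0 y0 v0 ω k t)‖ ^ 2 +
      12 * (Q.lam2 * Q.eta) / c.mu *
        ∑ j ∈ Finset.range Q.J, ‖B.errV (B.vSt Q x0 y0 v0 ω k j)‖ ^ 2 := by
  obtain ⟨n, hn⟩ : ∃ n, Q.T = n + 1 := ⟨Q.T - 1, by omega⟩
  obtain ⟨m, hm⟩ : ∃ m, Q.J = m + 1 := ⟨Q.J - 1, by omega⟩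
  have hv : ‖(B.chain Q x0 y0 v0 ω k).v‖ ≤ c.M := by
    rw [← hM]
    exact norm_vSt_le (j := 0) (hM ▸ hc.M_nonneg) (hM ▸ hv0) k
  have hF := Phi_step_le hc hB hQ.alpha_pos (B.chain Q x0 y0 v0 ω k).x
    (B.chain Q x0 y0 v0 ω k).Dx (B.chain Q x0 y0 v0 ω k).y (B.chain Q x0 y0 v0 ω k).v hv
  have hy := sq_norm_ySt_sub_ystar_le (x0 := x0) (y0 := y0) (v0 := v0) (ω := ω) hc hB hQ k n
  have hvv := sq_norm_vSt_sub_vstar_le (x0 := x0) (y0 := y0) (ω := ω) hc hB hQ hM hv0 k m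
  rw [← hn] at hy
  rw [← hm] at hvv
  have hμ := hc.mu_pos
  have hα := hQ.alpha_pos
  have hM1 := c.M1_nonneg
  refine combine_potentials (n := m) (J := Q.J) hα hμ hQ.gam_pos hQ.rho_pos
    (step_size_le hμ hQ.mu_le hQ.gam_le).2 c.M1_nonneg (by rw [hm]; push_cast; rfl)
    (Nat.cast_nonneg _) (sq_nonneg _) (sq_nonneg _) (sq_nonneg _)
    (Finset.sum_nonneg fun _ _ => sq_nonneg _) (Finset.sum_nonneg fun _ _ => sq_nonneg _)
    (hμ.trans_le hQ.mu_le) ?_ hQ.rho_gam ?_ hQ.alpha_smooth hF hy hvv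
  · have := hQ.alpha_gam
    nlinarith [mul_nonneg (sq_nonneg c.Cy) hα.le]
  · have := hQ.alpha_rho
    nlinarith [mul_nonneg (sq_nonneg c.Cv) hα.le]

end Pathwise

end ALS

end

noncomputable section

namespace ALS

/-! ### Combining potential and estimator errors -/

section Combination

lemma integral_add_sums_le {Ω : Type*} [MeasurableSpace Ω] {P : Measure Ω}
    {u u' g d e : Ω → ℝ} {sy sv ey ev : ℕ → Ω → ℝ} {a₁ a₂ a₃ a₄ b₁ b₂ b₃ : ℝ} {T J : ℕ}
    (hu : Integrable u P) (hu' : Integrable u' P) (hg : Integrable g P) (hd : Integrable d P)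
    (he : Integrable e P) (hsy : ∀ t, Integrable (sy t) P) (hsv : ∀ t, Integrable (sv t) P)
    (hey : ∀ t, Integrable (ey t) P) (hev : ∀ t, Integrable (ev t) P)
    (h : ∀ ω, u' ω + a₁ * g ω + a₂ * d ω + a₃ * ∑ t ∈ Finset.range T, sy t ω +
        a₄ * ∑ j ∈ Finset.range J, sv j ω ≤ u ω + b₁ * e ω +
        b₂ * ∑ t ∈ Finset.range T, ey t ω + b₃ * ∑ j ∈ Finset.range J, ev j ω) :
    ∫ ω, u' ω ∂P + a₁ * ∫ ω, g ω ∂P + a₂ * ∫ ω, d ω ∂P +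
        a₃ * ∑ t ∈ Finset.range T, ∫ ω, sy t ω ∂P + a₄ * ∑ j ∈ Finset.range J, ∫ ω, sv j ω ∂P ≤
      ∫ ω, u ω ∂P + b₁ * ∫ ω, e ω ∂P + b₂ * ∑ t ∈ Finset.range T, ∫ ω, ey t ω ∂P +
        b₃ * ∑ j ∈ Finset.range J, ∫ ω, ev j ω ∂P := by
  have i1 := hu'.add (hg.const_mul a₁)
  have i2 := i1.add (hd.const_mul a₂)
  have s1 := (integrable_finsetSum (Finset.range T) fun t _ => hsy t).const_mul a₃
  have s2 := (integrable_finsetSum (Finset.range J) fun t _ => hsv t).const_mul a₄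
  have s3 := (integrable_finsetSum (Finset.range T) fun t _ => hey t).const_mul b₂
  have s4 := (integrable_finsetSum (Finset.range J) fun t _ => hev t).const_mul b₃
  have j1 := hu.add (he.const_mul b₁)
  have h1 := integral_mono ((i2.add s1).add s2) ((j1.add s3).add s4) h
  rw [integral_add' (i2.add s1) s2, integral_add' i2 s1, integral_add' i1 (hd.const_mul a₂),
    integral_add' hu' (hg.const_mul a₁), integral_add' (j1.add s3) s4, integral_add' j1 s3,
    integral_add' hu (he.const_mul b₁)] at h1
  simp only [integral_const_mul] at h1
  rwa [integral_finsetSum _ fun t _ => hsy t, integral_finsetSum _ fun t _ => hsv t,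
    integral_finsetSum _ fun t _ => hey t, integral_finsetSum _ fun t _ => hev t] at h1

/-- The error recursions are multiplied by their weights and added to the potential inequality.
Weight times τ dominates each error coefficient, and the three drift conditions let the negative
terms in D, SY, SV absorb all displacement. Only the τ²-noise is left. -/
lemma weighted_step_le {α g₁ g₂ b₂ b₃ a₃ a₄ wx wy wv τx τy τv S M1 L Vx Vy Vv T
    pot pot' G D SY SV ex ex' EX ey ey' EY ev ev' EV : ℝ}
    (hwx0 : 0 ≤ wx) (hwy0 : 0 ≤ wy) (hwv0 : 0 ≤ wv)
    (hwx : α ≤ wx * τx) (hwy : b₂ ≤ wy * τy) (hwv : b₃ ≤ wv * τv)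
    (hexX : ex ≤ EX) (hEX : 0 ≤ EX) (hEY : 0 ≤ EY) (hEV : 0 ≤ EV)
    (hα : 0 ≤ α) (hD0 : 0 ≤ D) (hSY0 : 0 ≤ SY) (hSV0 : 0 ≤ SV)
    (hD : 2 / S * (α ^ 2 * ((wx + wv) * M1 + wy * L ^ 2)) ≤ α / 5)
    (hY : 2 / S * (g₁ ^ 2 * ((wx + wv) * (M1 * T) + wy * L ^ 2)) ≤ a₃)
    (hV : 2 / S * (g₂ ^ 2 * ((wx + wv) * (2 * L ^ 2))) ≤ a₄)
    (hpot : pot' + α / 2 * G + α / 5 * D + a₃ * SY + a₄ * SV ≤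
      pot + α * ex + b₂ * EY + b₃ * EV)
    (hx : ex' + τx * EX ≤ ex + 2 / S * (Vx + (M1 * (α ^ 2 * D + T * (g₁ ^ 2 * SY)) +
      2 * L ^ 2 * (g₂ ^ 2 * SV))))
    (hy : ey' + τy * EY ≤ ey + 2 / S * (Vy + (L ^ 2 * (α ^ 2 * D) + L ^ 2 * (g₁ ^ 2 * SY))))
    (hv : ev' + τv * EV ≤ ev + 2 / S * (Vv + (M1 * (α ^ 2 * D + T * (g₁ ^ 2 * SY)) +
      2 * L ^ 2 * (g₂ ^ 2 * SV)))) :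
    pot' + wx * ex' + wy * ey' + wv * ev' + α / 2 * G ≤
      pot + wx * ex + wy * ey + wv * ev + 2 / S * (wx * Vx + wy * Vy + wv * Vv) := by
  have h1 := mul_le_mul_of_nonneg_left hx hwx0
  have h2 := mul_le_mul_of_nonneg_left hy hwy0
  have h3 := mul_le_mul_of_nonneg_left hv hwv0
  have h4 := mul_le_mul_of_nonneg_right hwx hEX
  have h5 := mul_le_mul_of_nonneg_right hwy hEY
  have h6 := mul_le_mul_of_nonneg_right hwv hEV
  have h7 := mul_le_mul_of_nonneg_right hD hD0
  have h8 := mul_le_mul_of_nonneg_right hY hSY0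
  have h9 := mul_le_mul_of_nonneg_right hV hSV0
  have h10 := mul_le_mul_of_nonneg_left hexX hα
  have e1 : wx * (2 / S * (Vx + (M1 * (α ^ 2 * D + T * (g₁ ^ 2 * SY)) +
      2 * L ^ 2 * (g₂ ^ 2 * SV)))) + wy * (2 / S * (Vy + (L ^ 2 * (α ^ 2 * D) +
      L ^ 2 * (g₁ ^ 2 * SY)))) + wv * (2 / S * (Vv + (M1 * (α ^ 2 * D + T * (g₁ ^ 2 * SY)) +
      2 * L ^ 2 * (g₂ ^ 2 * SV)))) = 2 / S * (wx * Vx + wy * Vy + wv * Vv) +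
      2 / S * (α ^ 2 * ((wx + wv) * M1 + wy * L ^ 2)) * D +
      2 / S * (g₁ ^ 2 * ((wx + wv) * (M1 * T) + wy * L ^ 2)) * SY +
      2 / S * (g₂ ^ 2 * ((wx + wv) * (2 * L ^ 2))) * SV := by ring
  linarith

lemma telescope_le {W G : ℕ → ℝ} {a b : ℝ} (h : ∀ k, W (k + 1) + a * G k ≤ W k + b) (n : ℕ) :
    W n + a * ∑ k ∈ Finset.range n, G k ≤ W 0 + n * b := by
  induction n with
  | zero => simp
  | succ n ih =>
    rw [Finset.sum_range_succ]
    have := h n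
    push_cast
    linarith

end Combination

/-! ### The Lyapunov inequality in expectation -/

section Expectation

variable {p q : ℕ} {Ξ Z : Type*} [MeasurableSpace Ξ] [MeasurableSpace Z] {c : Setup}
  {B : Bilevel p q Ξ Z} {Q : Params} {x0 : Vec p} {y0 v0 : Vec q}
  {Ω : Type*} [mΩ : MeasurableSpace Ω] {P : Measure Ω} [IsProbabilityMeasure P]
  {X : Slot → Ω → Ξ × Z}

lemma continuous_gradPhi (hc : c.Valid) (hB : B.Assumptions c.toConsts) :
    Continuous B.gradPhi :=
  (LipschitzWith.of_dist_le' (K := (c.Lg + c.mu) * c.Cv) fun x y => by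
    rw [dist_eq_norm, dist_eq_norm]
    exact norm_gradPhi_sub_le hc hB x y).continuous

lemma continuous_ystar (hc : c.Valid) (hB : B.Assumptions c.toConsts) : Continuous B.ystar :=
  (LipschitzWith.of_dist_le' (K := c.Cy) fun x y => by
    rw [dist_eq_norm, dist_eq_norm]
    exact norm_ystar_sub_le hc hB x y).continuous

lemma continuous_vstar (hc : c.Valid) (hB : B.Assumptions c.toConsts) : Continuous B.vstar :=
  (LipschitzWith.of_dist_le' (K := c.Cv) fun x y => by
    rw [dist_eq_norm, dist_eq_norm]
    exact norm_vstar_sub_le hc hB x y).continuous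

/-- The hypergradient is bounded, so Φ grows at most linearly; this makes Φ(x_k) integrable. -/
lemma norm_Phi_sub_le (hc : c.Valid) (hB : B.Assumptions c.toConsts) (x y : Vec p) :
    ‖B.Phi x - B.Phi y‖ ≤ (c.Cf + c.Lg * c.M) * ‖x - y‖ :=
  Convex.norm_image_sub_le_of_norm_hasFDerivWithin_le
    (fun z _ => (hasGradientAt_iff_hasFDerivAt.mp (hasGradientAt_Phi hc hB z)).hasFDerivWithinAt)
    (fun z _ => by
      rw [LinearIsometryEquiv.norm_map]
      exact norm_gradPhi_le hc hB z) convex_univ (Set.mem_univ y) (Set.mem_univ x)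

lemma integrable_Phi_comp (hc : c.Valid) (hB : B.Assumptions c.toConsts) {x : Ω → Vec p}
    (hx : MemLp x 2 P) : Integrable (fun ω => B.Phi (x ω)) P := by
  have h1 : Continuous B.Phi := continuous_iff_continuousAt.2 fun x =>
    (hasGradientAt_Phi hc hB x).continuousAt
  have hx1 : Integrable x P := hx.integrable (by norm_num)
  refine ((integrable_const ‖B.Phi 0‖).add (hx1.norm.const_mul (c.Cf + c.Lg * c.M))).mono'
    (h1.comp_aestronglyMeasurable hx.1) (Filter.Eventually.of_forall fun ω => ?_)
  have h2 := norm_Phi_sub_le hc hB (x ω) 0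
  rw [sub_zero] at h2
  have h3 := norm_sub_norm_le (B.Phi (x ω)) (B.Phi 0)
  simp only [Pi.add_apply]
  linarith

lemma memLp_ystar_comp (hc : c.Valid) (hB : B.Assumptions c.toConsts) {x : Ω → Vec p}
    (hx : MemLp x 2 P) : MemLp (fun ω => B.ystar (x ω)) 2 P := by
  refine memLp_of_sub (g := fun _ => B.ystar 0) ?_ (memLp_const _)
  have h1 := (continuous_ystar hc hB).comp_aestronglyMeasurable hx.1
  refine hx.of_le_mul (c := c.Cy) (h1.sub aestronglyMeasurable_const)
    (Filter.Eventually.of_forall fun ω => ?_)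
  have h2 := norm_ystar_sub_le hc hB (x ω) 0
  rwa [sub_zero] at h2

lemma memLp_vstar_comp (hc : c.Valid) (hB : B.Assumptions c.toConsts) {x : Ω → Vec p}
    (hx : MemLp x 2 P) : MemLp (fun ω => B.vstar (x ω)) 2 P :=
  MemLp.of_bound ((continuous_vstar hc hB).comp_aestronglyMeasurable hx.1) c.M
    (Filter.Eventually.of_forall fun ω => norm_vstar_le hc hB (x ω))

lemma memLp_gradPhi_comp (hc : c.Valid) (hB : B.Assumptions c.toConsts) {x : Ω → Vec p}
    (hx : MemLp x 2 P) : MemLp (fun ω => B.gradPhi (x ω)) 2 P :=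
  MemLp.of_bound ((continuous_gradPhi hc hB).comp_aestronglyMeasurable hx.1) _
    (Filter.Eventually.of_forall fun ω => norm_gradPhi_le hc hB (x ω))

lemma memLp_chain_v (hc : c.Valid) (hB : B.Assumptions c.toConsts) (hX : B.IsSampling P X)
    (hQ : Q.Admissible c) (hv0 : ‖v0‖ ≤ c.M) (k : ℕ) :
    MemLp (fun ω => (B.chain Q x0 y0 v0 (fun s => X s ω) k).v) 2 P :=
  MemLp.of_bound (hX.measurableO hB k).v.aestronglyMeasurable c.M
    (Filter.Eventually.of_forall fun ω => by
      rw [← hQ.M_eq]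
      exact norm_vSt_le (j := 0) (hQ.M_eq ▸ hc.M_nonneg) (hQ.M_eq ▸ hv0) k)

lemma integrable_potential (hc : c.Valid) (hB : B.Assumptions c.toConsts)
    (hX : B.IsSampling P X) (hQ : Q.Admissible c) (hv0 : ‖v0‖ ≤ c.M) (k : ℕ) :
    Integrable (fun ω => B.potential (B.chain Q x0 y0 v0 (fun s => X s ω) k)) P := by
  have h := sqIntY (x0 := x0) (y0 := y0) hc hB hX hQ hv0 k 0
  have hx : MemLp (fun ω => (B.chain Q x0 y0 v0 (fun s => X s ω) k).x) 2 P := h.x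
  have hy : MemLp (fun ω => (B.chain Q x0 y0 v0 (fun s => X s ω) k).y) 2 P := h.y
  have hv := memLp_chain_v (x0 := x0) (y0 := y0) hc hB hX hQ hv0 k
  have h2 := (hy.sub (memLp_ystar_comp hc hB hx)).integrable_sq_norm
  have h3 := (hv.sub (memLp_vstar_comp hc hB hx)).integrable_sq_norm
  exact ((integrable_Phi_comp hc hB hx).add h2).add h3

lemma integral_potential_step_le (hc : c.Valid) (hB : B.Assumptions c.toConsts)
    (hX : B.IsSampling P X) (hQ : Q.Admissible c) (hQ' : Q.StepSizes c) (hv0 : ‖v0‖ ≤ c.M)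
    (k : ℕ) :
    ∫ ω, B.potential (B.chain Q x0 y0 v0 (fun s => X s ω) (k + 1)) ∂P +
      Q.alpha / 2 * ∫ ω, ‖B.gradPhi (B.chain Q x0 y0 v0 (fun s => X s ω) k).x‖ ^ 2 ∂P +
      Q.alpha / 5 * ∫ ω, ‖(B.chain Q x0 y0 v0 (fun s => X s ω) k).Dx‖ ^ 2 ∂P +
      Q.lam1 * Q.beta / (4 * c.Lg) *
        ∑ t ∈ Finset.range Q.T, ∫ ω, ‖(B.ySt Q x0 y0 v0 (fun s => X s ω) k t).D‖ ^ 2 ∂P +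
      Q.lam2 * Q.eta / (4 * c.Lg) *
        ∑ j ∈ Finset.range Q.J, ∫ ω, ‖(B.vSt Q x0 y0 v0 (fun s => X s ω) k j).Dv‖ ^ 2 ∂P ≤
    ∫ ω, B.potential (B.chain Q x0 y0 v0 (fun s => X s ω) k) ∂P +
      Q.alpha * ∫ ω, ‖B.errX (B.vSt Q x0 y0 v0 (fun s => X s ω) k 0)‖ ^ 2 ∂P +
      7 * (Q.lam1 * Q.beta) / c.mu *
        ∑ t ∈ Finset.range Q.T, ∫ ω, ‖B.errY (B.ySt Q x0 y0 v0 (fun s => X s ω) k t)‖ ^ 2 ∂P +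
      12 * (Q.lam2 * Q.eta) / c.mu *
        ∑ j ∈ Finset.range Q.J, ∫ ω, ‖B.errV (B.vSt Q x0 y0 v0 (fun s => X s ω) k j)‖ ^ 2 ∂P := by
  have hY := sqIntY (x0 := x0) (y0 := y0) hc hB hX hQ hv0 k
  have hV := sqIntV (x0 := x0) (y0 := y0) hc hB hX hQ hv0 k
  have hx : MemLp (fun ω => (B.chain Q x0 y0 v0 (fun s => X s ω) k).x) 2 P := (hY 0).x
  exact integral_add_sums_le
    (sy := fun t ω => ‖(B.ySt Q x0 y0 v0 (fun s => X s ω) k t).D‖ ^ 2)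
    (sv := fun j ω => ‖(B.vSt Q x0 y0 v0 (fun s => X s ω) k j).Dv‖ ^ 2)
    (ey := fun t ω => ‖B.errY (B.ySt Q x0 y0 v0 (fun s => X s ω) k t)‖ ^ 2)
    (ev := fun j ω => ‖B.errV (B.vSt Q x0 y0 v0 (fun s => X s ω) k j)‖ ^ 2)
    (integrable_potential hc hB hX hQ hv0 k)
    (integrable_potential hc hB hX hQ hv0 (k + 1))
    (memLp_gradPhi_comp hc hB hx).integrable_sq_norm
    (memLp_chain_Dx hc hB hX hQ hv0 (hV 0)).integrable_sq_norm
    (hV 0).errX.integrable_sq_norm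
    (fun t => ((hY t).D hB).integrable_sq_norm)
    (fun j => (memLp_vSt_Dv hc hB hX hQ hv0 (hV j)).integrable_sq_norm)
    (fun t => (hY t).err.integrable_sq_norm) (fun j => (hV j).errV.integrable_sq_norm)
    fun ω => potential_step_le hc hB hQ' hQ.M_eq hQ.T_pos hQ.J_pos hv0 k

/-- The potential plus the weighted mean squared errors of the three estimators. -/
def Bilevel.lyapunov (B : Bilevel p q Ξ Z) (Q : Params) (x0 : Vec p) (y0 v0 : Vec q)
    (P : Measure Ω) (X : Slot → Ω → Ξ × Z) (wx wy wv : ℝ) (k : ℕ) : ℝ :=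
  ∫ ω, B.potential (B.chain Q x0 y0 v0 (fun s => X s ω) k) ∂P +
    wx * ∫ ω, ‖B.errX (B.vSt Q x0 y0 v0 (fun s => X s ω) k 0)‖ ^ 2 ∂P +
    wy * ∫ ω, ‖B.errY (B.ySt Q x0 y0 v0 (fun s => X s ω) k 0)‖ ^ 2 ∂P +
    wv * ∫ ω, ‖B.errV (B.vSt Q x0 y0 v0 (fun s => X s ω) k 0)‖ ^ 2 ∂P

/-- Weights of the estimator errors for which the drift of the iterates is absorbed. -/
structure Params.Weights (Q : Params) (c : Setup) (wx wy wv : ℝ) : Prop where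
  wx_nonneg : 0 ≤ wx
  wy_nonneg : 0 ≤ wy
  wv_nonneg : 0 ≤ wv
  wx_ge : Q.alpha ≤ wx * Q.taux
  wy_ge : 7 * (Q.lam1 * Q.beta) / c.mu ≤ wy * Q.tauy
  wv_ge : 12 * (Q.lam2 * Q.eta) / c.mu ≤ wv * Q.tauv
  drift_x : 2 / Q.S2 * (Q.alpha ^ 2 * ((wx + wv) * c.M1 + wy * c.Lg ^ 2)) ≤ Q.alpha / 5
  drift_y : 2 / Q.S2 * ((Q.lam1 * Q.beta) ^ 2 * ((wx + wv) * (c.M1 * Q.T) + wy * c.Lg ^ 2)) ≤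
    Q.lam1 * Q.beta / (4 * c.Lg)
  drift_v : 2 / Q.S2 * ((Q.lam2 * Q.eta) ^ 2 * ((wx + wv) * (2 * c.Lg ^ 2))) ≤
    Q.lam2 * Q.eta / (4 * c.Lg)

variable {wx wy wv : ℝ}

/-- The errors at the end of the inner loops are rewritten as errors at the start of iteration k +
1, so both sides contain the same functional. -/
lemma lyapunov_step_le (hc : c.Valid) (hB : B.Assumptions c.toConsts)
    (hX : B.IsSampling P X) (hQ : Q.Admissible c) (hQ' : Q.StepSizes c)
    (hw : Q.Weights c wx wy wv) (hv0 : ‖v0‖ ≤ c.M) (k : ℕ) :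
    B.lyapunov Q x0 y0 v0 P X wx wy wv (k + 1) +
      Q.alpha / 2 * ∫ ω, ‖B.gradPhi (B.chain Q x0 y0 v0 (fun s => X s ω) k).x‖ ^ 2 ∂P ≤
    B.lyapunov Q x0 y0 v0 P X wx wy wv k +
      2 / Q.S2 * (wx * (Q.J * (Q.taux ^ 2 * c.VX)) + wy * (Q.T * (Q.tauy ^ 2 * c.sg ^ 2)) +
        wv * (Q.J * (Q.tauv ^ 2 * c.VX))) := by
  have hpot := integral_potential_step_le (x0 := x0) (y0 := y0) hc hB hX hQ hQ' hv0 k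
  have hy := sum_errY_le (x0 := x0) (y0 := y0) hc hB hX hQ hv0 k
  obtain ⟨hx, hv⟩ := sum_errX_le (x0 := x0) (y0 := y0) hc hB hX hQ hv0 k
  simp_rw [← errX_succ_zero B Q x0 y0 v0 _ hQ.J_pos] at hx
  simp_rw [← errV_succ_zero B Q x0 y0 v0 _ hQ.J_pos] at hv
  simp_rw [← errY_succ_zero B Q x0 y0 v0 _ hQ.T_pos] at hy
  have hi : ∀ u : Ω → ℝ, 0 ≤ ∫ ω, u ω ^ 2 ∂P := fun u => integral_nonneg fun ω => sq_nonneg (u ω)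
  have hs : ∀ (u : ℕ → Ω → ℝ) (n : ℕ), 0 ≤ ∑ j ∈ Finset.range n, ∫ ω, u j ω ^ 2 ∂P :=
    fun u n => Finset.sum_nonneg fun j _ => hi (u j)
  -- The potential contains only the x-error at the start of the loop, which is one term of the sum
  -- that momentum controls.
  have hex := Finset.single_le_sum
    (f := fun j => ∫ ω, ‖B.errX (B.vSt Q x0 y0 v0 (fun s => X s ω) k j)‖ ^ 2 ∂P)
    (fun j _ => hi _) (Finset.mem_range.2 hQ.J_pos)
  exact weighted_step_le hw.wx_nonneg hw.wy_nonneg hw.wv_nonneg hw.wx_ge hw.wy_ge hw.wv_ge hex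
    (hs _ _) (hs _ _) (hs _ _) hQ'.alpha_pos.le (hi _) (hs _ _) (hs _ _) hw.drift_x hw.drift_y
    hw.drift_v hpot hx hy hv

lemma lyapunov_zero_le (hB : B.Assumptions c.toConsts) (hX : B.IsSampling P X)
    (hQ : Q.Admissible c) (hw : Q.Weights c wx wy wv) (hv0 : ‖v0‖ ≤ c.M) :
    B.lyapunov Q x0 y0 v0 P X wx wy wv 0 ≤
      B.Phi x0 + ‖y0 - B.ystar x0‖ ^ 2 + ‖v0 - B.vstar x0‖ ^ 2 +
        (wx * c.VX + wy * c.sg ^ 2 + wv * c.VX) / Q.S1 := by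
  have h0 : ∀ ω, B.potential (B.chain Q x0 y0 v0 (fun s => X s ω) 0) =
      B.Phi x0 + ‖y0 - B.ystar x0‖ ^ 2 + ‖v0 - B.vstar x0‖ ^ 2 := fun ω => by
    simp only [Bilevel.potential, Bilevel.chain, Bilevel.refresh, Bilevel.run, Nat.zero_mod,
      if_true]
  have h1 := mul_le_mul_of_nonneg_left
    (init_errX (x0 := x0) (y0 := y0) hB hX hQ hv0).2 hw.wx_nonneg
  have h2 := mul_le_mul_of_nonneg_left
    (init_errY (x0 := x0) (y0 := y0) (v0 := v0) hB hX hQ).2 hw.wy_nonneg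
  have h3 := mul_le_mul_of_nonneg_left
    (init_errV (x0 := x0) (y0 := y0) hB hX hQ hv0).2 hw.wv_nonneg
  have e : (wx * c.VX + wy * c.sg ^ 2 + wv * c.VX) / Q.S1 =
      wx * (c.VX / Q.S1) + wy * (c.sg ^ 2 / Q.S1) + wv * (c.VX / Q.S1) := by ring
  rw [Bilevel.lyapunov, e]
  simp_rw [h0]
  rw [integral_const, probReal_univ, one_smul]
  linarith

lemma le_lyapunov (hc : c.Valid) (hB : B.Assumptions c.toConsts) (hX : B.IsSampling P X)
    (hQ : Q.Admissible c) (hw : Q.Weights c wx wy wv) (hv0 : ‖v0‖ ≤ c.M) (k : ℕ) :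
    (⨅ x, B.Phi x) ≤ B.lyapunov Q x0 y0 v0 P X wx wy wv k := by
  have h1 : (⨅ x, B.Phi x) ≤ ∫ ω, B.potential (B.chain Q x0 y0 v0 (fun s => X s ω) k) ∂P := by
    have h := integral_mono (μ := P) (integrable_const (⨅ x, B.Phi x))
      (integrable_potential (x0 := x0) (y0 := y0) hc hB hX hQ hv0 k) fun ω => by
        have h2 := ciInf_le hB.regular.bddBelow (B.chain Q x0 y0 v0 (fun s => X s ω) k).x
        unfold Bilevel.potential
        simp only
        nlinarith [sq_nonneg ‖(B.chain Q x0 y0 v0 (fun s => X s ω) k).y -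
          B.ystar (B.chain Q x0 y0 v0 (fun s => X s ω) k).x‖,
          sq_nonneg ‖(B.chain Q x0 y0 v0 (fun s => X s ω) k).v -
          B.vstar (B.chain Q x0 y0 v0 (fun s => X s ω) k).x‖]
    rwa [integral_const, probReal_univ, one_smul] at h
  have hi : ∀ u : Ω → ℝ, 0 ≤ ∫ ω, u ω ^ 2 ∂P := fun u => integral_nonneg fun ω => sq_nonneg (u ω)
  have h2 := mul_nonneg hw.wx_nonneg
    (hi fun ω => ‖B.errX (B.vSt Q x0 y0 v0 (fun s => X s ω) k 0)‖)
  have h3 := mul_nonneg hw.wy_nonneg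
    (hi fun ω => ‖B.errY (B.ySt Q x0 y0 v0 (fun s => X s ω) k 0)‖)
  have h4 := mul_nonneg hw.wv_nonneg
    (hi fun ω => ‖B.errV (B.vSt Q x0 y0 v0 (fun s => X s ω) k 0)‖)
  unfold Bilevel.lyapunov
  linarith

/-- Sum of the expected squared hypergradients along the iterations. -/
theorem sum_integral_sq_norm_gradPhi_le (hc : c.Valid) (hB : B.Assumptions c.toConsts)
    (hX : B.IsSampling P X) (hQ : Q.Admissible c) (hQ' : Q.StepSizes c)
    (hw : Q.Weights c wx wy wv) (hv0 : ‖v0‖ ≤ c.M) (n : ℕ) :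
    Q.alpha / 2 * ∑ k ∈ Finset.range n,
      ∫ ω, ‖B.gradPhi (B.chain Q x0 y0 v0 (fun s => X s ω) k).x‖ ^ 2 ∂P ≤
    B.Phi x0 - (⨅ x, B.Phi x) + ‖y0 - B.ystar x0‖ ^ 2 + 4 * c.M ^ 2 +
      (wx * c.VX + wy * c.sg ^ 2 + wv * c.VX) / Q.S1 +
      n * (2 / Q.S2 * (wx * (Q.J * (Q.taux ^ 2 * c.VX)) + wy * (Q.T * (Q.tauy ^ 2 * c.sg ^ 2)) +
        wv * (Q.J * (Q.tauv ^ 2 * c.VX)))) := by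
  have h1 := telescope_le (fun k => lyapunov_step_le (x0 := x0) (y0 := y0) hc hB hX hQ hQ' hw hv0 k) n
  have h2 := lyapunov_zero_le (x0 := x0) (y0 := y0) hB hX hQ hw hv0
  have h3 := le_lyapunov (x0 := x0) (y0 := y0) hc hB hX hQ hw hv0 n
  -- Both vectors lie in the ball, so the initial v-error needs no separate hypothesis.
  have h4 : ‖v0 - B.vstar x0‖ ^ 2 ≤ 4 * c.M ^ 2 := by
    have h5 : ‖v0 - B.vstar x0‖ ≤ 2 * c.M := by
      have := norm_sub_le v0 (B.vstar x0)
      have := norm_vstar_le hc hB x0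
      linarith
    have := pow_le_pow_left₀ (norm_nonneg _) h5 2
    linarith
  linarith

end Expectation

end ALS

end

noncomputable section

namespace ALS

namespace Setup

variable {c : Setup}

/-! ### Signs and mutual bounds of the parameter constants -/

section Positivity

lemma Valid.Lg_pos (hc : c.Valid) (hL : c.mu ≤ c.Lg) : 0 < c.Lg := hc.mu_pos.trans_le hL

lemma Valid.Cy_pos (hc : c.Valid) (hL : c.mu ≤ c.Lg) : 0 < c.Cy :=
  div_pos (hc.Lg_pos hL) hc.mu_pos

lemma Valid.T_cast_pos (hc : c.Valid) : (0 : ℝ) < c.T := by exact_mod_cast hc.T_pos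

lemma Valid.J_cast_pos (hc : c.Valid) : (0 : ℝ) < c.J := by exact_mod_cast hc.J_pos

lemma Valid.S2_cast_pos (hc : c.Valid) : (0 : ℝ) < c.S2 := by exact_mod_cast hc.S2_pos

lemma Valid.T_cast_one_le (hc : c.Valid) : (1 : ℝ) ≤ c.T := by exact_mod_cast hc.T_pos

lemma Valid.J_cast_one_le (hc : c.Valid) : (1 : ℝ) ≤ c.J := by exact_mod_cast hc.J_pos

lemma Valid.Ceta_mul (hc : c.Valid) :
    c.Ceta * c.lam2 * c.mu = 48 * (c.Lg ^ 2 + c.Cv ^ 2) := by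
  have := hc.mu_pos
  have := hc.lam2_pos
  unfold Ceta
  field_simp

lemma Valid.Ceta_pos (hc : c.Valid) (hL : c.mu ≤ c.Lg) : 0 < c.Ceta := by
  have := hc.mu_pos
  have := hc.lam2_pos
  have := hc.Lg_pos hL
  unfold Ceta
  positivity

lemma Valid.Cbeta_mul_ge (hc : c.Valid) :
    96 * c.Cy ^ 2 + 8 * c.M1 ≤ c.Cbeta * c.lam1 * c.mu := by
  have h1 := hc.mu_pos
  have h2 := hc.lam1_pos
  have h3 := le_max_left ((96 * c.Cy ^ 2 + 8 * c.M1) / (c.mu * c.lam1))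
    (128 * c.M1 * c.J * c.Ceta * c.lam2 / (c.mu ^ 2 * c.lam1))
  rw [div_le_iff₀ (by positivity)] at h3
  unfold Cbeta
  linarith

lemma Valid.Cbeta_mul_ge' (hc : c.Valid) :
    128 * c.M1 * c.J * c.Ceta * c.lam2 ≤ c.Cbeta * c.lam1 * c.mu ^ 2 := by
  have h1 := hc.mu_pos
  have h2 := hc.lam1_pos
  have h3 := le_max_right ((96 * c.Cy ^ 2 + 8 * c.M1) / (c.mu * c.lam1))
    (128 * c.M1 * c.J * c.Ceta * c.lam2 / (c.mu ^ 2 * c.lam1))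
  rw [div_le_iff₀ (by positivity)] at h3
  unfold Cbeta
  linarith

lemma Valid.Cbeta_pos (hc : c.Valid) (hL : c.mu ≤ c.Lg) : 0 < c.Cbeta := by
  have h1 := hc.mu_pos
  have h2 := hc.lam1_pos
  have h3 := hc.Cy_pos hL
  have h4 := c.M1_nonneg
  exact (by positivity : 0 < (96 * c.Cy ^ 2 + 8 * c.M1) / (c.mu * c.lam1)).trans_le
    (le_max_left _ _)

lemma Valid.C3_ge (hc : c.Valid) : c.J * (1 + c.M ^ 2) ≤ c.C3 ∧ 2 ≤ c.C3 := by
  have hT := hc.T_cast_one_le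
  have hJ := hc.J_cast_one_le
  have h1 : (c.J : ℝ) * (1 + c.M ^ 2) ≤ (c.J : ℝ) ^ 2 * (1 + c.M ^ 2) :=
    mul_le_mul_of_nonneg_right (by nlinarith) (by positivity)
  have h2 : 0 ≤ (c.J : ℝ) ^ 2 * (1 + c.M ^ 2) := by positivity
  unfold C3
  constructor <;> nlinarith

lemma Valid.C6_pos (hc : c.Valid) (hL : c.mu ≤ c.Lg) : 0 < c.C6 := by
  have := hc.Lg_pos hL
  have := hc.Cbeta_pos hL
  have := hc.Ceta_pos hL
  have := hc.lam1_pos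
  have := hc.lam2_pos
  have := c.M1_nonneg
  unfold C6
  positivity

/-- The large power of two in `C7` is the slack from which all numerical factors below are taken. -/
lemma Valid.C7_ge (hc : c.Valid) (hL : c.mu ≤ c.Lg) {r : ℝ} {n : ℕ}
    (hn : n ≤ 2 * (c.T + c.J) + 11)
    (hr : r ≤ c.Lg ^ 2 * c.Ceta + (c.M1 + c.Lg ^ 2) * (1 + c.T * c.Cbeta)) :
    2 ^ n * r ≤ c.C7 := by
  have := hc.Lg_pos hL
  have := hc.Cbeta_pos hL
  have := hc.Ceta_pos hL
  have := c.M1_nonneg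
  unfold C7
  refine (mul_le_mul_of_nonneg_left hr (by positivity)).trans
    (mul_le_mul_of_nonneg_right ?_ (by positivity))
  exact pow_le_pow_right₀ (by norm_num) hn

lemma Valid.C7_pos (hc : c.Valid) (hL : c.mu ≤ c.Lg) : 0 < c.C7 := by
  have := hc.Lg_pos hL
  have := hc.Cbeta_pos hL
  have := hc.Ceta_pos hL
  have := c.M1_nonneg
  unfold C7
  positivity

lemma Valid.Cetax_pos (hc : c.Valid) (hL : c.mu ≤ c.Lg) : 0 < c.Cetax := by
  have := hc.C7_pos hL
  have := hc.S2_cast_pos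
  unfold Cetax
  positivity

/-- The momentum ratios are multiples of `Cetax`, so the noise estimate involves one scale and two
dimension-free factors. -/
lemma Cetay_eq (c : Setup) : c.Cetay = c.Cetax * (c.lam1 * c.Cbeta * c.T / c.mu) := by
  unfold Cetay Cetax
  rw [← one_div_mul_one_div]
  ring

lemma Cetav_eq (c : Setup) : c.Cetav = c.Cetax * (c.lam2 * c.Ceta * c.J / c.mu) := by
  unfold Cetav Cetax
  rw [← one_div_mul_one_div]
  ring

lemma Valid.Cetay_nonneg (hc : c.Valid) (hL : c.mu ≤ c.Lg) : 0 ≤ c.Cetay := by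
  have := hc.Cetax_pos hL
  have := hc.Cbeta_pos hL
  have := hc.lam1_pos
  have := hc.mu_pos
  rw [Cetay_eq]
  positivity

lemma Valid.Cetav_nonneg (hc : c.Valid) (hL : c.mu ≤ c.Lg) : 0 ≤ c.Cetav := by
  have := hc.Cetax_pos hL
  have := hc.Ceta_pos hL
  have := hc.lam2_pos
  have := hc.mu_pos
  rw [Cetav_eq]
  positivity

lemma Valid.LPhi_nonneg (hc : c.Valid) : 0 ≤ c.LPhi := by
  have := hc.mu_pos
  have := hc.consts.Cf_nonneg
  have := hc.consts.Lf_nonneg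
  have := hc.consts.Lg_nonneg
  have := hc.Lgg_nonneg
  unfold LPhi
  positivity

lemma Valid.C8_pos (hc : c.Valid) (hL : c.mu ≤ c.Lg) : 0 < c.C8 := by
  have := hc.LPhi_nonneg
  have := hc.Cbeta_pos hL
  have := hc.Ceta_pos hL
  unfold C8
  positivity

lemma Valid.alphaMax_pos (hc : c.Valid) (hL : c.mu ≤ c.Lg) : 0 < c.alphaMax := by
  have := hc.Lg_pos hL
  have := hc.Cbeta_pos hL
  have := hc.Ceta_pos hL
  have := hc.C6_pos hL
  have := hc.C7_pos hL
  have := hc.C8_pos hL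
  have := hc.S2_cast_pos
  have := hc.T_cast_pos
  have := hc.J_cast_pos
  have := hc.lam2_pos
  have := hc.mu_pos
  have : 0 < c.C3 := by linarith [hc.C3_ge.2]
  unfold alphaMax
  refine lt_min (Real.sqrt_pos.2 (by positivity)) (lt_min ?_ (lt_min ?_ (by positivity)))
  · have := Real.sqrt_pos.2 (by positivity : 0 < c.mu / (c.C6 * (c.C3 / c.S2 + 1 + c.Cy ^ 2)))
    positivity
  · exact Real.sqrt_pos.2 (by positivity)

lemma Valid.P6_pos (hc : c.Valid) (hL : c.mu ≤ c.Lg) : 0 < c.P6 := by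
  have := hc.Lg_pos hL
  have := hc.Cbeta_pos hL
  have := hc.Ceta_pos hL
  have := c.M1_nonneg
  have := hc.S2_cast_pos
  have := hc.T_cast_pos
  unfold P6
  exact lt_min (by positivity) (lt_min (by positivity) (by positivity))

/-- Each entry of the minimum `P6` is S₂ over a quantity that `C7` dominates with a power of two to
spare, while `Cetax` is `C7`/S₂. -/
lemma Valid.Cetax_mul_P6_ge (hc : c.Valid) (hL : c.mu ≤ c.Lg) : 512 ≤ c.Cetax * c.P6 := by
  have hLg := hc.Lg_pos hL
  have hb := hc.Cbeta_pos hL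
  have he := hc.Ceta_pos hL
  have hM := c.M1_nonneg
  have hS := hc.S2_cast_pos
  have hT := hc.T_cast_pos
  have hT' := hc.T_pos
  have hJ' := hc.J_pos
  have hx := hc.Cetax_pos hL
  have hC : c.Cetax * c.S2 = c.C7 := by unfold Cetax; field_simp
  rw [mul_comm, ← div_le_iff₀ hx]
  unfold P6
  refine le_min ?_ (le_min ?_ ?_)
  · have h := hc.C7_ge hL (r := c.M1 + c.Lg ^ 2) (n := 14) (by omega) (by
      have : 0 ≤ c.Lg ^ 2 * c.Ceta + (c.M1 + c.Lg ^ 2) * (c.T * c.Cbeta) := by positivity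
      linarith)
    rw [div_le_div_iff₀ hx (by positivity)]
    linarith
  · have h := hc.C7_ge hL (r := (c.M1 + c.Lg ^ 2) * (c.T * c.Cbeta)) (n := 2 * c.T + 2 + 9)
      (by omega) (by
        have : 0 ≤ c.Lg ^ 2 * c.Ceta + (c.M1 + c.Lg ^ 2) := by positivity
        linarith)
    rw [div_le_div_iff₀ hx (by positivity)]
    have e : (1 / 2 : ℝ) ^ (2 * c.T + 2) * 2 ^ (2 * c.T + 2 + 9) = 512 := by
      rw [pow_add 2 (2 * c.T + 2) 9, ← mul_assoc, ← mul_pow]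
      norm_num
    have h2 := mul_le_mul_of_nonneg_left h
      (by positivity : 0 ≤ (1 / 2 : ℝ) ^ (2 * c.T + 2))
    rw [← mul_assoc, e, ← hC] at h2
    linarith
  · have h := hc.C7_ge hL (r := c.Lg ^ 2 * c.Ceta) (n := 2 * c.J - 1 + 14)
      (by omega) (by
        have : 0 ≤ (c.M1 + c.Lg ^ 2) * (1 + c.T * c.Cbeta) := by positivity
        linarith)
    rw [div_le_div_iff₀ hx (by positivity)]
    have e : (1 / 2 : ℝ) ^ (2 * c.J - 1) * 2 ^ (2 * c.J - 1 + 14) = 16384 := by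
      rw [pow_add 2 (2 * c.J - 1) 14, ← mul_assoc, ← mul_pow]
      norm_num
    have h2 := mul_le_mul_of_nonneg_left h
      (by positivity : 0 ≤ (1 / 2 : ℝ) ^ (2 * c.J - 1))
    rw [← mul_assoc, e, ← hC] at h2
    have : 0 ≤ c.Lg ^ 2 * c.Ceta := by positivity
    linarith

end Positivity

/-! ### The chosen step size meets all requirements -/

section StepSize

variable {ε : ℝ}

/-- A positive constant such that `α ≥ alphaLow √ε`. -/
def alphaLow (c : Setup) : ℝ :=
  if c.P6t = 0 then c.alphaMax else min (Real.sqrt (c.S2 / (16 * c.P6t))) c.alphaMax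

lemma sigmaSq_nonneg (c : Setup) : 0 ≤ c.sigmaSq := by
  unfold sigmaSq; positivity

/-- The noise calls for one factor of `Cetax`, whereas `P6t` contains two together with `P6`; the
product of the extra factor and `P6` is at least 512. -/
lemma Valid.P6t_ge (hc : c.Valid) (hL : c.mu ≤ c.Lg) :
    512 * (c.Cetax * (1 + (c.lam1 * c.Cbeta * c.T / c.mu) ^ 2 +
      (c.lam2 * c.Ceta * c.J / c.mu) ^ 2) * c.C3 * c.sigmaSq) ≤ c.P6t := by
  have h1 := hc.Cetax_mul_P6_ge hL
  have hx := hc.Cetax_pos hL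
  have hP := hc.P6_pos hL
  have hμ := hc.mu_pos
  have := hc.lam1_pos
  have := hc.lam2_pos
  have := hc.Cbeta_pos hL
  have := hc.Ceta_pos hL
  have hC3 : 0 < c.C3 := by linarith [hc.C3_ge.2]
  have hσ := c.sigmaSq_nonneg
  set u := c.lam1 * c.Cbeta * c.T / c.mu
  set w := c.lam2 * c.Ceta * c.J / c.mu
  have h2 : c.P6 ≤ 1 + c.P6 + 8 / c.mu * c.lam1 * c.Cbeta * c.C3 +
      8 / c.mu * c.lam2 * c.Ceta * c.J := by
    have : 0 ≤ 1 + 8 / c.mu * c.lam1 * c.Cbeta * c.C3 +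
      8 / c.mu * c.lam2 * c.Ceta * c.J := by positivity
    linarith
  have h3 : c.P6t = c.Cetax ^ 2 * (1 + u ^ 2 + w ^ 2) * (1 + c.P6 +
      8 / c.mu * c.lam1 * c.Cbeta * c.C3 + 8 / c.mu * c.lam2 * c.Ceta * c.J) *
      c.C3 * c.sigmaSq := by
    unfold P6t
    rw [Cetay_eq, Cetav_eq]
    ring
  rw [h3]
  calc 512 * (c.Cetax * (1 + u ^ 2 + w ^ 2) * c.C3 * c.sigmaSq)
      ≤ c.Cetax * c.P6 * (c.Cetax * (1 + u ^ 2 + w ^ 2) * c.C3 * c.sigmaSq) :=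
        mul_le_mul_of_nonneg_right h1 (by positivity)
    _ = c.Cetax ^ 2 * (1 + u ^ 2 + w ^ 2) * c.P6 * c.C3 * c.sigmaSq := by ring
    _ ≤ _ := by gcongr

lemma Valid.P6t_nonneg (hc : c.Valid) (hL : c.mu ≤ c.Lg) : 0 ≤ c.P6t := by
  refine le_trans ?_ (hc.P6t_ge hL)
  have := hc.Cetax_pos hL
  have hC3 : 0 < c.C3 := by linarith [hc.C3_ge.2]
  have := c.sigmaSq_nonneg
  positivity

lemma Valid.alphaLow_pos (hc : c.Valid) (hL : c.mu ≤ c.Lg) : 0 < c.alphaLow := by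
  have h := hc.alphaMax_pos hL
  have hS := hc.S2_cast_pos
  unfold alphaLow
  split_ifs with h0
  · exact h
  · have : 0 < c.P6t := lt_of_le_of_ne (hc.P6t_nonneg hL) (Ne.symm h0)
    exact lt_min (Real.sqrt_pos.2 (by positivity)) h

/-- The ε-dependent term is homogeneous in √ε, and the other terms only decrease when multiplied by
√ε ≤ 1. -/
lemma Valid.alpha_ge (hc : c.Valid) (hL : c.mu ≤ c.Lg) (hε : 0 ≤ ε) (hε1 : ε ≤ 1) :
    c.alphaLow * Real.sqrt ε ≤ c.alpha ε := by
  have h := (hc.alphaMax_pos hL).le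
  have hs1 : Real.sqrt ε ≤ 1 := Real.sqrt_le_one.2 hε1
  have hs := Real.sqrt_nonneg ε
  unfold alphaLow alpha
  split_ifs with h0
  · exact mul_le_of_le_one_right h hs1
  · refine le_min ?_ ?_
    · rw [mul_div_right_comm, Real.sqrt_mul' _ hε]
      exact mul_le_mul_of_nonneg_right (min_le_left _ _) hs
    · exact (mul_le_mul_of_nonneg_right (min_le_right _ _) hs).trans
        (mul_le_of_le_one_right h hs1)

lemma Valid.alpha_pos (hc : c.Valid) (hL : c.mu ≤ c.Lg) (hε : 0 < ε) (hε1 : ε ≤ 1) :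
    0 < c.alpha ε :=
  (mul_pos (hc.alphaLow_pos hL) (Real.sqrt_pos.2 hε)).trans_le (hc.alpha_ge hL hε.le hε1)

lemma Valid.alpha_sq_mul_P6t_le (hc : c.Valid) (hL : c.mu ≤ c.Lg) (hε : 0 < ε) (hε1 : ε ≤ 1) :
    c.alpha ε ^ 2 * c.P6t ≤ c.S2 * ε / 16 := by
  have hS := hc.S2_cast_pos
  by_cases h0 : c.P6t = 0
  · rw [h0, mul_zero]; positivity
  · have h1 : 0 < c.P6t := lt_of_le_of_ne (hc.P6t_nonneg hL) (Ne.symm h0)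
    have h2 : c.alpha ε ≤ Real.sqrt (c.S2 * ε / (16 * c.P6t)) := by
      unfold alpha
      rw [if_neg h0]
      exact min_le_left _ _
    have h3 := pow_le_pow_left₀ (hc.alpha_pos hL hε hε1).le h2 2
    rw [Real.sq_sqrt (by positivity), le_div_iff₀ (by positivity)] at h3
    linarith

lemma alpha_le_one_div_C8 (c : Setup) : c.alpha ε ≤ 1 / c.C8 := by
  have h : c.alphaMax ≤ 1 / c.C8 :=
    ((min_le_right _ _).trans (min_le_right _ _)).trans (min_le_right _ _)
  unfold alpha
  split_ifs
  · exact h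
  · exact (min_le_right _ _).trans h

/-- Every summand of `C8` times α is at most 1. This keeps β and η at most 1, and the square-root
summands keep the momenta at most 1. -/
lemma Valid.mul_alpha_le_one (hc : c.Valid) (hL : c.mu ≤ c.Lg) (hε : 0 < ε) (hε1 : ε ≤ 1)
    {r : ℝ} (hr : r ≤ c.C8) : r * c.alpha ε ≤ 1 := by
  have h1 := c.alpha_le_one_div_C8 (ε := ε)
  rw [le_div_iff₀ (hc.C8_pos hL)] at h1
  have h2 := mul_le_mul_of_nonneg_right hr (hc.alpha_pos hL hε hε1).le
  linarith

lemma Valid.Cbeta_mul_alpha_le (hc : c.Valid) (hL : c.mu ≤ c.Lg) (hε : 0 < ε) (hε1 : ε ≤ 1) :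
    c.Cbeta * c.alpha ε ≤ 1 := by
  refine hc.mul_alpha_le_one hL hε hε1 ?_
  have := hc.LPhi_nonneg
  have := hc.Ceta_pos hL
  have : 0 ≤ 1 + 6 * c.LPhi + c.Ceta + Real.sqrt c.Cetax + Real.sqrt c.Cetay +
    Real.sqrt c.Cetav := by positivity
  unfold C8
  linarith

lemma Valid.Ceta_mul_alpha_le (hc : c.Valid) (hL : c.mu ≤ c.Lg) (hε : 0 < ε) (hε1 : ε ≤ 1) :
    c.Ceta * c.alpha ε ≤ 1 := by
  refine hc.mul_alpha_le_one hL hε hε1 ?_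
  have := hc.LPhi_nonneg
  have := hc.Cbeta_pos hL
  have : 0 ≤ 1 + 6 * c.LPhi + c.Cbeta + Real.sqrt c.Cetax + Real.sqrt c.Cetay +
    Real.sqrt c.Cetav := by positivity
  unfold C8
  linarith

lemma Valid.sqrt_le_C8 (hc : c.Valid) (hL : c.mu ≤ c.Lg) :
    Real.sqrt c.Cetax ≤ c.C8 ∧ Real.sqrt c.Cetay ≤ c.C8 ∧ Real.sqrt c.Cetav ≤ c.C8 := by
  have := hc.LPhi_nonneg
  have := hc.Cbeta_pos hL
  have := hc.Ceta_pos hL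
  have := Real.sqrt_nonneg c.Cetax
  have := Real.sqrt_nonneg c.Cetay
  have := Real.sqrt_nonneg c.Cetav
  unfold C8
  refine ⟨?_, ?_, ?_⟩ <;> linarith

lemma Valid.mul_alpha_sq_le_one (hc : c.Valid) (hL : c.mu ≤ c.Lg) (hε : 0 < ε) (hε1 : ε ≤ 1)
    {r : ℝ} (hr0 : 0 ≤ r) (hr : Real.sqrt r ≤ c.C8) : r * c.alpha ε ^ 2 ≤ 1 := by
  have h1 := hc.mul_alpha_le_one hL hε hε1 hr
  have h2 := pow_le_one₀ (n := 2)
    (mul_nonneg (Real.sqrt_nonneg r) (hc.alpha_pos hL hε hε1).le) h1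
  rwa [mul_pow, Real.sq_sqrt hr0] at h2

variable {K S1 : ℕ}

lemma Valid.admissible_storm (hc : c.Valid) (hL : c.mu ≤ c.Lg) (hε : 0 < ε) (hε1 : ε ≤ 1)
    (hS1 : 0 < S1) : (c.storm ε K S1).Admissible c where
  M_eq := rfl
  T_pos := hc.T_pos
  J_pos := hc.J_pos
  S1_pos := hS1
  S2_pos := hc.S2_pos
  taux_nonneg := mul_nonneg (hc.Cetax_pos hL).le (sq_nonneg _)
  taux_le_one := hc.mul_alpha_sq_le_one hL hε hε1 (hc.Cetax_pos hL).le (hc.sqrt_le_C8 hL).1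
  tauy_nonneg := mul_nonneg (hc.Cetay_nonneg hL) (sq_nonneg _)
  tauy_le_one := hc.mul_alpha_sq_le_one hL hε hε1 (hc.Cetay_nonneg hL) (hc.sqrt_le_C8 hL).2.1
  tauv_nonneg := mul_nonneg (hc.Cetav_nonneg hL) (sq_nonneg _)
  tauv_le_one := hc.mul_alpha_sq_le_one hL hε hε1 (hc.Cetav_nonneg hL) (hc.sqrt_le_C8 hL).2.2

lemma Valid.stepSizes_storm (hc : c.Valid) (hL : c.mu ≤ c.Lg) (hε : 0 < ε) (hε1 : ε ≤ 1) :
    (c.storm ε K S1).StepSizes c := by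
  have hα := hc.alpha_pos hL hε hε1
  have hμ := hc.mu_pos
  have hLg := hc.Lg_pos hL
  have hb := hc.Cbeta_pos hL
  have he := hc.Ceta_pos hL
  have h1 := hc.lam1_pos
  have h2 := hc.lam2_pos
  have hb1 := hc.Cbeta_mul_alpha_le hL hε hε1
  have he1 := hc.Ceta_mul_alpha_le hL hε hε1
  have hl1 := hc.lam1_le
  have hl2 := hc.lam2_le
  have e : 2 * c.Lg + 2 * c.mu = 2 * (c.Lg + c.mu) := by ring
  rw [e] at hl1 hl2
  refine ⟨hL, hα, mul_pos h1 (mul_pos hb hα), (mul_le_of_le_one_right h1.le hb1).trans hl1,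
    mul_pos h2 (mul_pos he hα), (mul_le_of_le_one_right h2.le he1).trans hl2, ?_, ?_, ?_, ?_⟩
  · have := mul_le_mul_of_nonneg_right hc.Cbeta_mul_ge hα.le
    simp only [storm]
    linarith
  · have := mul_le_mul_of_nonneg_right hc.Cbeta_mul_ge' hα.le
    simp only [storm]
    linarith
  · have := congrArg (· * c.alpha ε) hc.Ceta_mul
    simp only [storm] at this ⊢
    linarith
  -- Smoothness follows from η ≤ 1 alone: 96 α (L_g + μ) L_g C_v ≤ 48 α (L_g + μ)(L_g² + C_v²) ≤ λ₂
  -- μ (L_g + μ) ≤ μ/2 ≤ L_g/2, and L_g cancels.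
  · simp only [storm]
    rw [le_div_iff₀ (by positivity)] at hl2
    have e1 := hc.Ceta_mul
    have h3 : c.alpha ε * (48 * (c.Lg ^ 2 + c.Cv ^ 2)) ≤ c.lam2 * c.mu := by
      rw [← e1]
      have := mul_le_mul_of_nonneg_right he1 (mul_pos h2 hμ).le
      linarith
    have h4 := mul_le_mul_of_nonneg_right h3 (by positivity : 0 ≤ 2 * (c.Lg + c.mu))
    have h5 := mul_le_mul_of_nonneg_right hl2 hμ.le
    have h6 : 2 * c.Lg * c.Cv ≤ c.Lg ^ 2 + c.Cv ^ 2 := two_mul_le_add_sq _ _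
    have h7 := mul_le_mul_of_nonneg_left h6
      (by positivity : 0 ≤ c.alpha ε * (96 * (c.Lg + c.mu)))
    have h8 : 192 * (c.alpha ε * ((c.Lg + c.mu) * c.Cv)) * c.Lg ≤ 1 * c.Lg := by linarith
    have h9 := le_of_mul_le_mul_right h8 hLg
    linarith

/-- The weights are chosen so that weight times τ equals the required coefficient exactly; the
factors 1/T and 1/J undo the T and J in `Cetay` and `Cetav`. Since the weights carry S₂/`C7`, the
drift conditions reduce to lower bounds on `C7`. -/
lemma Valid.weights_storm (hc : c.Valid) (hL : c.mu ≤ c.Lg) (hε : 0 < ε) (hε1 : ε ≤ 1) :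
    (c.storm ε K S1).Weights c (c.S2 / (c.C7 * c.alpha ε))
      (7 * c.S2 / (c.C7 * c.T * c.alpha ε)) (12 * c.S2 / (c.C7 * c.J * c.alpha ε)) := by
  have hα := hc.alpha_pos hL hε hε1
  have hμ := hc.mu_pos
  have hLg := hc.Lg_pos hL
  have hb := hc.Cbeta_pos hL
  have he := hc.Ceta_pos hL
  have h1 := hc.lam1_pos
  have h2 := hc.lam2_pos
  have hS := hc.S2_cast_pos
  have hT := hc.T_cast_pos
  have hJ := hc.J_cast_pos
  have hT1 := hc.T_cast_one_le
  have hJ1 := hc.J_cast_one_le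
  have hM := c.M1_nonneg
  have hC := hc.C7_pos hL
  have hT' := hc.T_pos
  have hl1 := hc.lam1_le
  have hl2 := hc.lam2_le
  rw [le_div_iff₀ (by positivity)] at hl1 hl2
  have hl1' : c.lam1 * c.Lg ≤ 1 / 2 := by linarith [mul_pos h1 hμ]
  have hl2' : c.lam2 * c.Lg ≤ 1 / 2 := by linarith [mul_pos h2 hμ]
  set W := c.S2 / (c.C7 * c.alpha ε) with hW
  have hW0 : 0 < W := by positivity
  have hWS : 2 / c.S2 * W = 2 / (c.C7 * c.alpha ε) := by rw [hW]; field_simp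
  have ewy : 7 * c.S2 / (c.C7 * c.T * c.alpha ε) = 7 / c.T * W := by rw [hW]; field_simp
  have ewv : 12 * c.S2 / (c.C7 * c.J * c.alpha ε) = 12 / c.J * W := by rw [hW]; field_simp
  have hy7 : 7 / (c.T : ℝ) ≤ 7 := div_le_self (by norm_num) hT1
  have hv12 : 12 / (c.J : ℝ) ≤ 12 := div_le_self (by norm_num) hJ1
  have hC1 := hc.C7_ge hL (r := c.M1 + c.Lg ^ 2) (n := 13) (by omega) (by
    have : 0 ≤ c.Lg ^ 2 * c.Ceta + (c.M1 + c.Lg ^ 2) * (c.T * c.Cbeta) := by positivity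
    linarith)
  have hC2 := hc.C7_ge hL (r := (c.M1 + c.Lg ^ 2) * (c.T * c.Cbeta)) (n := 13) (by omega) (by
    have : 0 ≤ c.Lg ^ 2 * c.Ceta + (c.M1 + c.Lg ^ 2) := by positivity
    linarith)
  have hC3 := hc.C7_ge hL (r := c.Lg ^ 2 * c.Ceta) (n := 13) (by omega) (by
    have : 0 ≤ (c.M1 + c.Lg ^ 2) * (1 + c.T * c.Cbeta) := by positivity
    linarith)
  refine ⟨hW0.le, by positivity, by positivity, ?_, ?_, ?_, ?_, ?_, ?_⟩
  · simp only [storm, Cetax]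
    rw [hW]
    exact le_of_eq (by field_simp)
  · simp only [storm, Cetay]
    exact le_of_eq (by field_simp)
  · simp only [storm, Cetav]
    exact le_of_eq (by field_simp)
  · simp only [storm]
    rw [ewy, ewv]
    have h3 : (W + 12 / c.J * W) * c.M1 + 7 / c.T * W * c.Lg ^ 2 ≤
        13 * (c.M1 + c.Lg ^ 2) * W := by
      have a1 := mul_le_mul_of_nonneg_right hv12 (mul_nonneg hW0.le hM)
      have a2 := mul_le_mul_of_nonneg_right hy7 (mul_nonneg hW0.le (sq_nonneg c.Lg))
      linarith [mul_nonneg hW0.le (sq_nonneg c.Lg)]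
    calc 2 / c.S2 * (c.alpha ε ^ 2 * ((W + 12 / c.J * W) * c.M1 + 7 / c.T * W * c.Lg ^ 2))
        ≤ 2 / c.S2 * (c.alpha ε ^ 2 * (13 * (c.M1 + c.Lg ^ 2) * W)) := by gcongr
      _ = 2 / c.S2 * W * (c.alpha ε ^ 2 * (13 * (c.M1 + c.Lg ^ 2))) := by ring
      _ = 26 * (c.M1 + c.Lg ^ 2) * c.alpha ε / c.C7 := by rw [hWS]; field_simp; norm_num
      _ ≤ c.alpha ε / 5 := by
        rw [div_le_iff₀ hC]
        linarith [mul_le_mul_of_nonneg_right hC1 hα.le, mul_pos hC hα]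
  · simp only [storm]
    rw [ewy, ewv]
    set g := c.lam1 * (c.Cbeta * c.alpha ε) with hg
    have hg0 : 0 < g := by positivity
    have h3 : (W + 12 / c.J * W) * (c.M1 * c.T) + 7 / c.T * W * c.Lg ^ 2 ≤
        13 * ((c.M1 + c.Lg ^ 2) * c.T) * W := by
      have a1 := mul_le_mul_of_nonneg_right hv12 (mul_nonneg hW0.le (mul_nonneg hM hT.le))
      have a2 := mul_le_mul_of_nonneg_right hy7 (mul_nonneg hW0.le (sq_nonneg c.Lg))
      have a3 := mul_le_mul_of_nonneg_left hT1 (mul_nonneg hW0.le (sq_nonneg c.Lg))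
      linarith [mul_nonneg hW0.le (sq_nonneg c.Lg)]
    -- One factor g is kept for the right-hand side; the other is expanded to λ₁ C_β α, whose α
    -- cancels the one in W.
    calc 2 / c.S2 * (g ^ 2 * ((W + 12 / c.J * W) * (c.M1 * c.T) + 7 / c.T * W * c.Lg ^ 2))
        ≤ 2 / c.S2 * (g ^ 2 * (13 * ((c.M1 + c.Lg ^ 2) * c.T) * W)) := by gcongr
      _ = 2 / c.S2 * W * (g ^ 2 * (13 * ((c.M1 + c.Lg ^ 2) * c.T))) := by ring
      _ = 26 * ((c.M1 + c.Lg ^ 2) * (c.T * c.Cbeta)) * (g * c.lam1) / c.C7 := by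
        rw [hWS]
        nth_rewrite 1 [sq]
        nth_rewrite 2 [hg]
        field_simp
        norm_num
      _ ≤ 26 * (c.C7 / 2 ^ 13) * (g * c.lam1) / c.C7 := by
        gcongr
        rw [le_div_iff₀ (by positivity)]
        linarith
      _ = 26 / 2 ^ 13 * (g * c.lam1) := by field_simp
      _ ≤ g / (4 * c.Lg) := by
        rw [le_div_iff₀ (by positivity)]
        linarith [mul_le_mul_of_nonneg_left hl1' hg0.le]
  · simp only [storm]
    rw [ewv]
    set g := c.lam2 * (c.Ceta * c.alpha ε) with hg
    have hg0 : 0 < g := by positivity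
    have h3 : W + 12 / c.J * W ≤ 13 * W := by
      have a1 := mul_le_mul_of_nonneg_right hv12 hW0.le
      linarith
    calc 2 / c.S2 * (g ^ 2 * ((W + 12 / c.J * W) * (2 * c.Lg ^ 2)))
        ≤ 2 / c.S2 * (g ^ 2 * (13 * W * (2 * c.Lg ^ 2))) := by gcongr
      _ = 2 / c.S2 * W * (g ^ 2 * (26 * c.Lg ^ 2)) := by ring
      _ = 52 * (c.Lg ^ 2 * c.Ceta) * (g * c.lam2) / c.C7 := by
        rw [hWS]
        nth_rewrite 1 [sq]
        nth_rewrite 2 [hg]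
        field_simp
        norm_num
      _ ≤ 52 * (c.C7 / 2 ^ 13) * (g * c.lam2) / c.C7 := by
        gcongr
        rw [le_div_iff₀ (by positivity)]
        linarith
      _ = 52 / 2 ^ 13 * (g * c.lam2) := by field_simp
      _ ≤ g / (4 * c.Lg) := by
        rw [le_div_iff₀ (by positivity)]
        linarith [mul_le_mul_of_nonneg_left hl2' hg0.le]

/-- A weight of order 1/α times τ² of order α⁴ gives α³. The ε-dependent bound on α trades α² for ε,
with `P6t` dominating the constant. In the noiseless case `P6t` may vanish, and then so does the
noise. -/
lemma Valid.noise_storm_le (hc : c.Valid) (hL : c.mu ≤ c.Lg) (hε : 0 < ε) (hε1 : ε ≤ 1) :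
    2 / c.S2 * (c.S2 / (c.C7 * c.alpha ε) * (c.J * ((c.Cetax * c.alpha ε ^ 2) ^ 2 * c.VX)) +
      7 * c.S2 / (c.C7 * c.T * c.alpha ε) *
        (c.T * ((c.Cetay * c.alpha ε ^ 2) ^ 2 * c.sg ^ 2)) +
      12 * c.S2 / (c.C7 * c.J * c.alpha ε) *
        (c.J * ((c.Cetav * c.alpha ε ^ 2) ^ 2 * c.VX))) ≤ c.alpha ε * ε / 100 := by
  have hα := hc.alpha_pos hL hε hε1
  have hμ := hc.mu_pos
  have hb := hc.Cbeta_pos hL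
  have he := hc.Ceta_pos hL
  have h1 := hc.lam1_pos
  have h2 := hc.lam2_pos
  have hS := hc.S2_cast_pos
  have hT := hc.T_cast_pos
  have hJ := hc.J_cast_pos
  have hJ1 := hc.J_cast_one_le
  have hC := hc.C7_pos hL
  have hx := hc.Cetax_pos hL
  have hσ := c.sigmaSq_nonneg
  have hCx : c.C7 = c.Cetax * c.S2 := by unfold Cetax; field_simp
  have hP := (mul_le_mul_of_nonneg_left (hc.P6t_ge hL) (sq_nonneg (c.alpha ε))).trans
    (hc.alpha_sq_mul_P6t_le hL hε hε1)
  rw [Cetay_eq, Cetav_eq, hCx]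
  set a := c.alpha ε
  set u := c.lam1 * c.Cbeta * c.T / c.mu
  set w := c.lam2 * c.Ceta * c.J / c.mu
  have hVJ : c.J * c.VX ≤ 2 * (c.C3 * c.sigmaSq) := by
    have := mul_le_mul_of_nonneg_right hc.C3_ge.1 hσ
    unfold VX
    linarith
  have hV0 : 0 ≤ c.VX := by unfold VX; positivity
  have hV : c.VX ≤ 2 * (c.C3 * c.sigmaSq) := by
    have := mul_le_mul_of_nonneg_right hJ1 hV0
    linarith
  have hsg : c.sg ^ 2 ≤ c.C3 * c.sigmaSq := by
    have a1 : c.sg ^ 2 ≤ c.sigmaSq := by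
      unfold sigmaSq
      have : 0 ≤ c.sf ^ 2 + c.sgxy ^ 2 + c.sgyy ^ 2 := by positivity
      linarith
    have a2 := mul_le_mul_of_nonneg_right hc.C3_ge.2 hσ
    linarith
  have hsum : c.J * c.VX + 7 * u ^ 2 * c.sg ^ 2 + 12 * w ^ 2 * c.VX ≤
      24 * ((1 + u ^ 2 + w ^ 2) * (c.C3 * c.sigmaSq)) := by
    have b1 := mul_le_mul_of_nonneg_left hsg (by positivity : 0 ≤ 7 * u ^ 2)
    have b2 := mul_le_mul_of_nonneg_left hV (by positivity : 0 ≤ 12 * w ^ 2)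
    have b3 : 0 ≤ c.C3 * c.sigmaSq := hsg.trans' (sq_nonneg _)
    have b4 := mul_nonneg (sq_nonneg u) b3
    have b5 := mul_nonneg (sq_nonneg w) b3
    linarith
  calc _ = 2 * c.Cetax * a ^ 3 / c.S2 *
        (c.J * c.VX + 7 * u ^ 2 * c.sg ^ 2 + 12 * w ^ 2 * c.VX) := by
        clear_value a u w
        field_simp
    _ ≤ 2 * c.Cetax * a ^ 3 / c.S2 * (24 * ((1 + u ^ 2 + w ^ 2) * (c.C3 * c.sigmaSq))) := by
        gcongr
    _ = 48 / 512 * (a / c.S2) * (a ^ 2 * (512 * (c.Cetax * (1 + u ^ 2 + w ^ 2) * c.C3 *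
        c.sigmaSq))) := by ring
    _ ≤ 48 / 512 * (a / c.S2) * (c.S2 * ε / 16) := by gcongr
    _ = 3 / 512 * (a * ε) := by field_simp; norm_num
    _ ≤ a * ε / 100 := by
        have := mul_pos hα hε
        linarith

end StepSize

end Setup

end ALS

end

noncomputable section

namespace ALS

/-! ### Averaging over the random output index, and the complexity bound -/

section Final

lemma integral_uniformOn_univ {K : ℕ} (hK : 0 < K) (f : Fin K → ℝ) :
    ∫ k, f k ∂(uniformOn (Set.univ : Set (Fin K))) = (∑ k, f k) / K := by
  have : Nonempty (Fin K) := ⟨⟨0, hK⟩⟩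
  have : IsProbabilityMeasure (uniformOn (Set.univ : Set (Fin K))) :=
    isProbabilityMeasure_uniformOn Set.finite_univ Set.univ_nonempty
  rw [integral_fintype .of_finite]
  have h : ∀ k : Fin K, (uniformOn (Set.univ : Set (Fin K))).real {k} = (K : ℝ)⁻¹ := fun k => by
    rw [Measure.real, uniformOn_univ]
    simp
  simp_rw [h, smul_eq_mul, ← Finset.mul_sum]
  rw [div_eq_inv_mul]

lemma rpow_neg_three_halves {ε : ℝ} (hε : 0 < ε) :
    ε ^ (-(3 / 2) : ℝ) = (Real.sqrt ε ^ 3)⁻¹ := by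
  rw [Real.rpow_neg hε.le, Real.sqrt_eq_rpow, ← Real.rpow_natCast, ← Real.rpow_mul hε.le]
  norm_num

lemma rpow_neg_one_half {ε : ℝ} (hε : 0 < ε) :
    ε ^ (-(1 / 2) : ℝ) = (Real.sqrt ε)⁻¹ := by
  rw [Real.rpow_neg hε.le, Real.sqrt_eq_rpow]

/-- With s = √ε, the initial potential and the initial estimator errors each take at most 1/8 of K
s² a, and the accumulated noise takes 1/100. Together this is below the 1/2 available. -/
lemma average_le {a a₀ s S A c₁ D V K G W : ℝ} (ha₀ : 0 < a₀) (hs : 0 < s)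
    (ha : a₀ * s ≤ a) (hS : c₁ ≤ S * s) (hc₁ : 0 < c₁) (hK : A ≤ K * s ^ 3) (hA : 0 < A)
    (hAD : 8 * D ≤ A * a₀) (hAV : 8 * V ≤ A * (a₀ ^ 2 * c₁)) (hW : W ≤ V / a)
    (hG : a / 2 * G ≤ D + W / S + K * (a * s ^ 2 / 100)) : G / K ≤ s ^ 2 := by
  have ha0 : 0 < a := (mul_pos ha₀ hs).trans_le ha
  have hS0 : 0 < S := by
    by_contra h
    nlinarith
  have hK0 : 0 < K := by
    by_contra h
    have : 0 < s ^ 3 := by positivity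
    nlinarith
  rw [div_le_iff₀ hK0]
  have h1 : 8 * D ≤ K * s ^ 2 * a :=
    calc 8 * D ≤ A * a₀ := hAD
      _ ≤ K * s ^ 3 * a₀ := by gcongr
      _ = K * s ^ 2 * (a₀ * s) := by ring
      _ ≤ _ := by gcongr
  have h2 : 8 * (W / S) ≤ K * s ^ 2 * a := by
    have h3 : 8 * V ≤ K * s ^ 2 * a ^ 2 * S :=
      calc 8 * V ≤ A * (a₀ ^ 2 * c₁) := hAV
        _ ≤ K * s ^ 3 * (a₀ ^ 2 * (S * s)) := by gcongr
        _ = K * s ^ 2 * (a₀ * s) ^ 2 * S := by ring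
        _ ≤ _ := by gcongr
    have h4 : W / S ≤ V / a / S := by gcongr
    have h5 : 8 * (V / a / S) ≤ K * s ^ 2 * a := by
      rw [div_div, mul_div_assoc', div_le_iff₀ (by positivity)]
      linarith
    linarith
  have h6 : a / 2 * G ≤ a / 2 * (s ^ 2 * K) := by
    have : 0 ≤ K * s ^ 2 * a := by positivity
    linarith
  exact le_of_mul_le_mul_left h6 (by positivity)

variable {p q : ℕ} {Ξ Z : Type*} [MeasurableSpace Ξ] [MeasurableSpace Z] {c : Setup}
  {B : Bilevel p q Ξ Z} {x0 : Vec p} {y0 v0 : Vec q}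
  {Ω : Type*} [mΩ : MeasurableSpace Ω] {P : Measure Ω} {X : Slot → Ω → Ξ × Z}

lemma Setup.Valid.initial_error_le (hc : c.Valid) (hL : c.mu ≤ c.Lg) {ε : ℝ} (hε : 0 < ε)
    (hε1 : ε ≤ 1) :
    c.S2 / (c.C7 * c.alpha ε) * c.VX + 7 * c.S2 / (c.C7 * c.T * c.alpha ε) * c.sg ^ 2 +
      12 * c.S2 / (c.C7 * c.J * c.alpha ε) * c.VX ≤
    c.S2 / c.C7 * (13 * c.VX + 7 * c.sg ^ 2) / c.alpha ε := by
  have hα := hc.alpha_pos hL hε hε1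
  have hS := hc.S2_cast_pos
  have hT := hc.T_cast_pos
  have hJ := hc.J_cast_pos
  have hC := hc.C7_pos hL
  have hV0 : 0 ≤ c.VX := by
    have := c.sigmaSq_nonneg
    unfold Setup.VX; positivity
  set W := c.S2 / (c.C7 * c.alpha ε) with hW
  have hW0 : 0 < W := by positivity
  have ewy : 7 * c.S2 / (c.C7 * c.T * c.alpha ε) = 7 / c.T * W := by rw [hW]; field_simp
  have ewv : 12 * c.S2 / (c.C7 * c.J * c.alpha ε) = 12 / c.J * W := by rw [hW]; field_simp
  have e : c.S2 / c.C7 * (13 * c.VX + 7 * c.sg ^ 2) / c.alpha ε =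
    W * (13 * c.VX + 7 * c.sg ^ 2) := by rw [hW]; field_simp
  have hy7 : 7 / (c.T : ℝ) ≤ 7 := div_le_self (by norm_num) hc.T_cast_one_le
  have hv12 : 12 / (c.J : ℝ) ≤ 12 := div_le_self (by norm_num) hc.J_cast_one_le
  rw [ewy, ewv, e]
  have a1 := mul_le_mul_of_nonneg_right hv12 (mul_nonneg hW0.le hV0)
  have a2 := mul_le_mul_of_nonneg_right hy7 (mul_nonneg hW0.le (sq_nonneg c.sg))
  linarith

lemma measurable_run_x (hB : B.Assumptions c.toConsts) (hX : B.IsSampling P X) {Q : Params}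
    {K : ℕ} (hK : K = Q.q1) :
    Measurable fun ω : Ω × Fin K => (B.run Q x0 y0 v0 (fun s => X s ω.1) ω.2).x := by
  refine measurable_from_prod_countable_left fun k => ?_
  have h : ∀ ω, (B.run Q x0 y0 v0 (fun s => X s ω) k).x =
      (B.chain Q x0 y0 v0 (fun s => X s ω) k).x := fun ω =>
    run_x_eq_chain_x B Q x0 y0 v0 _ (hK ▸ k.2)
  simp only [h]
  exact (hX.measurableO hB k).x

lemma gradient_Phi (hc : c.Valid) (hB : B.Assumptions c.toConsts) :
    gradient B.Phi = B.gradPhi :=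
  funext fun x => (hasGradientAt_Phi hc hB x).gradient

variable [IsProbabilityMeasure P]

lemma integrable_sq_norm_gradient_run (hc : c.Valid) (hB : B.Assumptions c.toConsts)
    (hX : B.IsSampling P X) {Q : Params} {K : ℕ} (hK : K = Q.q1) (hK0 : 0 < K) :
    Integrable (fun ω : Ω × Fin K =>
      ‖gradient B.Phi (B.run Q x0 y0 v0 (fun s => X s ω.1) ω.2).x‖ ^ 2)
      (P.prod (uniformOn (Set.univ : Set (Fin K)))) := by
  have : Nonempty (Fin K) := ⟨⟨0, hK0⟩⟩
  have : IsProbabilityMeasure (uniformOn (Set.univ : Set (Fin K))) :=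
    isProbabilityMeasure_uniformOn Set.finite_univ Set.univ_nonempty
  rw [gradient_Phi hc hB]
  have h := (continuous_gradPhi hc hB).measurable.comp
    (measurable_run_x (x0 := x0) (y0 := y0) (v0 := v0) hB hX hK)
  exact (MemLp.of_bound (p := 2) h.aestronglyMeasurable _
    (Filter.Eventually.of_forall fun ω => norm_gradPhi_le hc hB _)).integrable_sq_norm

/-- Fubini for the independent uniform index. All indices lie below the restart period, so the run
agrees with the chain. -/
lemma integral_sq_norm_gradient_run (hc : c.Valid) (hB : B.Assumptions c.toConsts)
    (hX : B.IsSampling P X) {Q : Params} {K : ℕ} (hK : K = Q.q1) (hK0 : 0 < K) :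
    ∫ ω : Ω × Fin K, ‖gradient B.Phi (B.run Q x0 y0 v0 (fun s => X s ω.1) ω.2).x‖ ^ 2
      ∂(P.prod (uniformOn (Set.univ : Set (Fin K)))) =
    (∑ k ∈ Finset.range K,
      ∫ ω, ‖B.gradPhi (B.chain Q x0 y0 v0 (fun s => X s ω) k).x‖ ^ 2 ∂P) / K := by
  have : Nonempty (Fin K) := ⟨⟨0, hK0⟩⟩
  have : IsProbabilityMeasure (uniformOn (Set.univ : Set (Fin K))) :=
    isProbabilityMeasure_uniformOn Set.finite_univ Set.univ_nonempty
  rw [integral_prod_symm _ (integrable_sq_norm_gradient_run hc hB hX hK hK0),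
    integral_uniformOn_univ hK0, Finset.sum_range, gradient_Phi hc hB]
  congr 1
  refine Finset.sum_congr rfl fun k _ => ?_
  have h : ∀ ω, (B.run Q x0 y0 v0 (fun s => X s ω) k).x =
      (B.chain Q x0 y0 v0 (fun s => X s ω) k).x := fun ω =>
    run_x_eq_chain_x B Q x0 y0 v0 _ (hK ▸ k.2)
  simp only [h]

end Final

end ALS

end

theorem theorem2 (c : ALS.Setup) (hc : c.Valid) (c₁ c₂ Δ : ℝ) (hc₁ : 0 < c₁) :
    ∃ A C : ℝ, 0 < A ∧ 0 < C ∧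
      ∀ (p q : ℕ), 0 < q →
      ∀ (Ξ : Type*) (Z : Type*) (Ω : Type*)
        [MeasurableSpace Ξ] [MeasurableSpace Z] [MeasurableSpace Ω]
        (B : ALS.Bilevel p q Ξ Z), B.Assumptions c.toConsts →
      ∀ (P : MeasureTheory.Measure Ω) [MeasureTheory.IsProbabilityMeasure P]
        (X : ALS.Slot → Ω → Ξ × Z), B.IsSampling P X →
      ∀ (x0 : ALS.Vec p) (y0 v0 : ALS.Vec q), ‖v0‖ ≤ c.M →
        B.Phi x0 - (⨅ x, B.Phi x) + ‖y0 - B.ystar x0‖ ^ 2 ≤ Δ →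
      ∀ ε : ℝ, 0 < ε → ε ≤ 1 →
      ∀ S1 : ℕ, c₁ * ε ^ (-(1 / 2) : ℝ) ≤ S1 → (S1 : ℝ) ≤ c₂ * ε ^ (-(1 / 2) : ℝ) →
      ∀ K : ℕ, A * ε ^ (-(3 / 2) : ℝ) ≤ K →
        ALS.IsEpsStationary B.Phi
          (P.prod (ProbabilityTheory.uniformOn (Set.univ : Set (Fin K))))
          (fun ω => (B.run (c.storm ε K S1) x0 y0 v0 (fun s => X s ω.1) ω.2).x) ε ∧
        ((K : ℝ) ≤ A * ε ^ (-(3 / 2) : ℝ) + 1 →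
          ∀ ω : Ω,
            ((B.run (c.storm ε K S1) x0 y0 v0 (fun s => X s ω) K).cost.total : ℝ) ≤
              C * ε ^ (-(3 / 2) : ℝ)) := by
  -- If L_g < μ, no admissible problem with q ≥ 1 exists and any constants will do.
  by_cases hL : c.mu ≤ c.Lg
  swap
  · exact ⟨1, 1, one_pos, one_pos, fun p q hq Ξ Z Ω _ _ _ B hB =>
      absurd (ALS.mu_le_Lg hc hB hq) hL⟩
  have ha₀ := hc.alphaLow_pos hL
  have hV : 0 ≤ c.S2 / c.C7 * (13 * c.VX + 7 * c.sg ^ 2) := by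
    have := hc.C7_pos hL
    have := c.sigmaSq_nonneg
    unfold ALS.Setup.VX
    positivity
  -- The absolute value avoids assuming Δ ≥ 0; 4M² bounds the initial v-error.
  set D := |Δ| + 4 * c.M ^ 2
  have hD : 0 ≤ D := by positivity
  set V := c.S2 / c.C7 * (13 * c.VX + 7 * c.sg ^ 2)
  -- The two fractions are what `average_le` needs for the initial potential and the initial batch;
  -- the 1 keeps `A` positive.
  set A := 1 + 8 * D / c.alphaLow + 8 * V / (c.alphaLow ^ 2 * c₁) with hA
  have hA1 : 1 ≤ A := by
    have : 0 ≤ 8 * D / c.alphaLow + 8 * V / (c.alphaLow ^ 2 * c₁) := by positivity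
    linarith
  have hAD : 8 * D ≤ A * c.alphaLow := by
    rw [← div_le_iff₀ ha₀]
    have : 0 ≤ 8 * V / (c.alphaLow ^ 2 * c₁) := by positivity
    linarith
  have hAV : 8 * V ≤ A * (c.alphaLow ^ 2 * c₁) := by
    rw [← div_le_iff₀ (by positivity)]
    have : 0 ≤ 8 * D / c.alphaLow := by positivity
    linarith
  -- The `A + 1` comes from K ≤ A ε^(-3/2) + 1 with ε ≤ 1, and 5|c₂| from the initial batches, since
  -- ε^(-1/2) ≤ ε^(-3/2). The final 1 makes the constant positive.
  refine ⟨A, (A + 1) * (c.S2 * (2 * c.T + 8 * c.J)) + 5 * |c₂| + 1, by linarith, by positivity, ?_⟩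
  intro p q hq Ξ Z Ω _ _ _ B hB P _ X hX x0 y0 v0 hv0 hΔ ε hε hε1 S1 hS1 hS1' K hK
  rw [ALS.rpow_neg_three_halves hε] at hK ⊢
  rw [ALS.rpow_neg_one_half hε] at hS1 hS1'
  set s := Real.sqrt ε with hs_def
  have hs : 0 < s := Real.sqrt_pos.2 hε
  have hs1 : s ≤ 1 := Real.sqrt_le_one.2 hε1
  have hs2 : s ^ 2 = ε := Real.sq_sqrt hε.le
  have hS1_pos : 0 < S1 := by
    have : (0 : ℝ) < S1 := (by positivity : 0 < c₁ * s⁻¹).trans_le hS1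
    exact_mod_cast this
  have hK0 : 0 < K := by
    have : (0 : ℝ) < K := (by positivity : 0 < A * (s ^ 3)⁻¹).trans_le hK
    exact_mod_cast this
  have hKs : A ≤ K * s ^ 3 := by rwa [← div_eq_mul_inv, div_le_iff₀ (by positivity)] at hK
  have hSs : c₁ ≤ S1 * s := by rwa [← div_eq_mul_inv, div_le_iff₀ hs] at hS1
  refine ⟨⟨fun x => (ALS.hasGradientAt_Phi hc hB x).differentiableAt,
    ALS.integrable_sq_norm_gradient_run hc hB hX rfl hK0, ?_⟩, fun hK' ω => ?_⟩
  · have hE := ALS.integral_sq_norm_gradient_run (x0 := x0) (y0 := y0) (v0 := v0) hc hB hX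
      (Q := c.storm ε K S1) (K := K) rfl hK0
    have hG := ALS.sum_integral_sq_norm_gradPhi_le (x0 := x0) (y0 := y0) hc hB hX
      (hc.admissible_storm (K := K) hL hε hε1 hS1_pos) (hc.stepSizes_storm hL hε hε1)
      (hc.weights_storm hL hε hε1) hv0 K
    have hN := mul_le_mul_of_nonneg_left (hc.noise_storm_le hL hε hε1) (Nat.cast_nonneg (α := ℝ) K)
    refine hE.le.trans ((ALS.average_le ha₀ hs (hc.alpha_ge hL hε.le hε1) hSs hc₁ hKs
      (by linarith) hAD hAV (hc.initial_error_le hL hε hε1) (hG.trans ?_)).trans_eq hs2)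
    rw [hs2]
    refine add_le_add (add_le_add ?_ le_rfl) hN
    have := le_abs_self Δ
    simp only [D]
    linarith
  · have hT := ALS.total_run B (c.storm ε K S1) x0 y0 v0 (fun s => X s ω) hK0
    change (B.run (c.storm ε K S1) x0 y0 v0 (fun s => X s ω) K).cost.total =
      5 * S1 + K * (c.S2 * (2 * c.T + 8 * c.J)) at hT
    rw [hT]
    have h1 : 1 ≤ (s ^ 3)⁻¹ := (one_le_inv₀ (by positivity)).2 (pow_le_one₀ hs.le hs1)
    have h2 : s⁻¹ ≤ (s ^ 3)⁻¹ := by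
      refine inv_anti₀ (by positivity) ?_
      calc s ^ 3 = s * s ^ 2 := by ring
        _ ≤ s * 1 := by gcongr; exact pow_le_one₀ hs.le hs1
        _ = s := mul_one s
    have h3 : (S1 : ℝ) ≤ |c₂| * (s ^ 3)⁻¹ :=
      hS1'.trans ((mul_le_mul_of_nonneg_right (le_abs_self c₂) (by positivity)).trans
        (mul_le_mul_of_nonneg_left h2 (abs_nonneg c₂)))
    have h4 : (K : ℝ) ≤ (A + 1) * (s ^ 3)⁻¹ := by linarith
    have h5 := mul_le_mul_of_nonneg_right h4
      (by positivity : (0 : ℝ) ≤ c.S2 * (2 * c.T + 8 * c.J))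
    push_cast
    linarith
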